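/- For a continuous map $\varphi\colon X\to Y$ with $X$ nonempty, let $\mathrm{TC}(\varphi)$ be the least integer $k\ge 0$ (or $\infty$) such that $X\times X$ is covered by $k+1$ open sets $U_0,\dots,U_k$, each admitting a continuous map $s_i\colon U_i\to Y^{[0,1]}$ with $s_i(x_0,x_1)(0)=\varphi(x_0)$ and $s_i(x_0,x_1)(1)=\varphi(x_1)$. For a group homomorphism $f\colon G\to H$, the topological complexity $\mathrm{TC}(f)$ is $\mathrm{TC}(Bf)$, where $Bf\colon BG\to BH$ is any continuous map inducing $f$ on fundamental groups and $BG=K(G,1)$, $BH=K(H,1)$ are any Eilenberg–MacLane spaces (path-connected spaces of the homotopy type of a CW complex with the given fundamental group and vanishing higher homotopy groups). Theorem. Let $F(n)$ denote the free group on $n$ generators, let $n,m\ge 0$ be integers and let $f\colon F(n)\to F(m)$ be a group homomorphism. Then $$\mathrm{TC}(f)=\begin{cases}0&\text{if } f \text{ is trivial},\\ 1&\text{if } \operatorname{im}(f)\cong\mathbb Z,\\ 2&\text{otherwise.}\end{cases}$$ That is, these values hold for $\mathrm{TC}(\varphi)$ for every continuous map $\varphi\colon X\to Y$ from a $K(F(n),1)$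 to a $K(F(m),1)$ that induces $f$ on fundamental groups. -/

import Mathlib

open scoped Topology unitInterval ContinuousMap

/-- An `f`-motion planner on `Z ⊆ X × X`: a continuous map `s : Z → Y^I` (compact-open topology)
such that `s (x₀, x₁)` is a path from `f x₀` to `f x₁`. -/
def IsMotionPlanner {X Y : Type*} [TopologicalSpace X] [TopologicalSpace Y] (f : C(X, Y))
    (Z : Set (X × X)) (s : C(Z, C(I, Y))) : Prop :=
  ∀ z : Z, s z 0 = f z.1.1 ∧ s z 1 = f z.1.2

/-- `X × X` is covered by `k + 1` open sets, each of which carries an `f`-motion planner. -/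
def HasMotionPlanning {X Y : Type*} [TopologicalSpace X] [TopologicalSpace Y] (f : C(X, Y))
    (k : ℕ) : Prop :=
  ∃ U : Fin (k + 1) → Set (X × X), (∀ i, IsOpen (U i)) ∧ (⋃ i, U i) = Set.univ ∧
    ∀ i, ∃ s : C(U i, C(I, Y)), IsMotionPlanner f (U i) s

/-- The (reduced, pullback) topological complexity of a map `f : X → Y` with `X` nonempty:
the least `k` such that `X × X` is covered by `k + 1` open sets with `f`-motion planners,
and `⊤` if there is no such `k`. -/
noncomputable def mapTC {X Y : Type*} [TopologicalSpace X] [TopologicalSpace Y] (f : C(X, Y)) :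
    ℕ∞ :=
  ⨅ (k : ℕ) (_ : HasMotionPlanning f k), (k : ℕ∞)

/-- `X` has the homotopy type of a CW complex. -/
def HasCWHomotopyType.{u} (X : Type u) [TopologicalSpace X] : Prop :=
  ∃ C : TopCat.{u}, Nonempty (TopCat.CWComplex C) ∧ Nonempty (X ≃ₕ C)

/-- `X` is an Eilenberg–MacLane space `K(G, 1)`: a path-connected space of the homotopy type of a
CW complex with `π₁ ≅ G` and `π_k = 0` for `k ≥ 2`. -/
structure IsEilenbergMacLaneOne (G : Type*) [Group G] (X : Type*) [TopologicalSpace X] :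
    Prop where
  pathConnected : PathConnectedSpace X
  hasCWHomotopyType : HasCWHomotopyType X
  fundamentalGroup : ∀ x : X, Nonempty (FundamentalGroup X x ≃* G)
  homotopyGroup : ∀ (k : ℕ) (x : X), 2 ≤ k → Subsingleton (π_ k X x)

/-- The map `φ : X → Y` induces the homomorphism `f : G → H` on fundamental groups, under some
identifications `π₁(X, x) ≅ G` and `π₁(Y, φ x) ≅ H`. -/
def InducesOnPiOne {G H X Y : Type*} [Group G] [Group H] [TopologicalSpace X]
    [TopologicalSpace Y] (φ : C(X, Y)) (f : G →* H) : Prop :=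
  ∃ (x : X) (eX : FundamentalGroup X x ≃* G) (eY : FundamentalGroup Y (φ x) ≃* H),
    ∀ γ : FundamentalGroup X x, eY (FundamentalGroup.map φ x γ) = f (eX γ)

/-- `φ : X → Y` is a model of `Bf : BG → BH` for the group homomorphism `f : G → H`, so that
the topological complexity of `f` is by definition that of `φ`. -/
structure IsClassifyingMap {G H X Y : Type*} [Group G] [Group H] [TopologicalSpace X]
    [TopologicalSpace Y] (φ : C(X, Y)) (f : G →* H) : Prop where
  source : IsEilenbergMacLaneOne G X
  target : IsEilenbergMacLaneOne H Y
  induces : InducesOnPiOne φ f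

/-! Upper bounds come from factoring `φ` up to homotopy through a simple space `Γ`: if `φ ≃ b ∘ a`
with `a : X → Γ`, motion planners of `Γ` pull back to `φ`-motion planners
(`HasMotionPlanning.of_homotopic_comp`). The spaces used are a point, the circle and a rose, planned
with one, two and three open sets. The factorization (`HasMotionPlanning.of_map_range_le`) needs a
contractible covering space of `Γ`, a `π₁`-injective map `b : Γ → Y` whose image on `π₁` contains
that of `φ`, and the vanishing of the higher homotopy groups of `Y`. It is a section of the
projection to `X`, replaced by a CW complex, from one component of the homotopy pullback of `φ` and
`b`, built cell by cell. The contractible cover of the rose is the Cayley tree of the free group.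

Lower bounds come from monodromy. Two loops in `X` span a torus; over an open set with a planner,
closing up the planned path along the two loops gives a locally constant function `h` from an open
subset of the plane `ℝ × ℝ` to `π₁(Y)`. One unit translation multiplies `h` on the right by the
image `a` of the first loop, the other multiplies it on the left by the inverse of the image `b` of
the second (`exists_group_monodromy`). A planner defined everywhere makes `h` constant, so `φ` is
trivial on `π₁`. If instead two open sets suffice and `(i, j) ↦ (h ↦ b ^ (-j) * h * a ^ i)` is a
free action of `ℤ × ℤ` on `π₁(Y)`, then `h` followed by an equivariant map to `ℤ × ℤ` kills one
generator of the first cohomology of the torus on each of the two sets. This contradicts their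
nonzero cup product, here in the form of a degree argument (`false_of_equivariant_cover`).

Freeness of that action is a fact about free groups: if `u` and `v` do not commute, no nontrivial
power of `u` is conjugate to a power of the commutator of `u` and `v`
(`zpow_conj_commutator_freeGroup`). A faithful representation by units of a matrix polynomial ring,
all congruent to `1` modulo `X`, supplies a filtration by order of vanishing. Nontrivial powers and
conjugates keep the order, and commutators strictly raise it. Noncommuting elements exist in the
image because a subgroup of a free group is free, and a free group that is neither trivial nor
infinite cyclic is nonabelian. -/

/-! ### Lifting maps out of CW complexes. -/

open CategoryTheory Limits in
/-- The universal property of a small colimit of topological spaces, for continuous maps to a space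
in an arbitrary universe. -/
theorem exists_continuousMap_of_isColimit.{w, u, v₁, v₂} {J : Type v₁} [Category.{v₂} J]
    [Small.{u} J] {F : J ⥤ TopCat.{u}} {c : Cocone F} (hc : IsColimit c) {Z : Type w}
    [TopologicalSpace Z] (s : ∀ j, C(F.obj j, Z))
    (hs : ∀ ⦃j k : J⦄ (f : j ⟶ k) (x : F.obj j), s k (F.map f x) = s j x) :
    ∃ h : C(c.pt, Z), ∀ j (x : F.obj j), h (c.ι.app j x) = s j x := by
  -- The legs of the cocone only reach a `u`-small subset of `Z`, so this subset has a homeomorphic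
  -- copy in the universe where the colimit property applies.
  let S : Set Z := Set.range (fun p : Σ j, F.obj j => s p.1 p.2)
  have : Small.{u} S := small_range _
  let e : Shrink.{u} S ≃ₜ S := (Shrink.homeomorph S).symm
  let c' : Cocone F :=
    { pt := TopCat.of (Shrink.{u} S)
      ι :=
        { app := fun j => TopCat.ofHom
            ⟨fun x => e.symm ⟨s j x, ⟨⟨j, x⟩, rfl⟩⟩,
              e.symm.continuous.comp ((s j).continuous.subtype_mk _)⟩
          naturality := by
            intro j k f
            ext x
            simp [hs f x] } }
  refine ⟨⟨fun x => (e (hc.desc c' x) : Z),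
    continuous_subtype_val.comp (e.continuous.comp (hc.desc c').hom.continuous)⟩, ?_⟩
  intro j x
  have h := ConcreteCategory.congr_hom (hc.fac c' j) x
  have h2 : hc.desc c' (c.ι.app j x) = c'.ι.app j x := h
  simp only [ContinuousMap.coe_mk, h2]
  simp [c']

/-- `i : A ⟶ B` has the left lifting property against the continuous map `p : P → Q`. -/
def HasLiftsAgainst.{u, w₁, w₂} {A B : TopCat.{u}} (i : A ⟶ B) {P : Type w₁} {Q : Type w₂}
    [TopologicalSpace P] [TopologicalSpace Q] (p : C(P, Q)) : Prop :=
  ∀ (f : C(A, P)) (g : C(B, Q)), (∀ x, p (f x) = g (i x)) →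
    ∃ h : C(B, P), (∀ x, h (i x) = f x) ∧ ∀ x, p (h x) = g x

section

universe u w₁ w₂

variable {P : Type w₁} {Q : Type w₂} [TopologicalSpace P] [TopologicalSpace Q] {p : C(P, Q)}

open CategoryTheory Limits HomotopicalAlgebra

/-- Left lifting properties are stable under coproducts and cobase change; attaching cells is a
pushout of a coproduct of the maps `g a`. -/
theorem HasLiftsAgainst.attachCells {α : Type*} {A B : α → TopCat.{u}} {g : ∀ a, A a ⟶ B a}
    (hg : ∀ a, HasLiftsAgainst (g a) p) {X₁ X₂ : TopCat.{u}} {f : X₁ ⟶ X₂}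
    (c : AttachCells.{u} g f) : HasLiftsAgainst f p := by
  intro a b hab
  have hcell : ∀ i : c.ι, ∃ h : C(B (c.π i), P),
      (∀ x, h (g (c.π i) x) = a (c.g₁ (c.cofan₁.inj i x))) ∧
      ∀ x, p (h x) = b (c.g₂ (c.cofan₂.inj i x)) := by
    intro i
    refine hg (c.π i) (a.comp (c.g₁.hom.comp (c.cofan₁.inj i).hom))
      (b.comp (c.g₂.hom.comp (c.cofan₂.inj i).hom)) ?_
    intro x
    have h1 := ConcreteCategory.congr_hom c.isPushout.w (c.cofan₁.inj i x)
    have h2 := ConcreteCategory.congr_hom (c.hm i) x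
    simp only [ConcreteCategory.comp_apply] at h1 h2
    change p (a (c.g₁ (c.cofan₁.inj i x))) = b (c.g₂ (c.cofan₂.inj i (g (c.π i) x)))
    rw [hab, h1, h2]
  choose H hH₁ hH₂ using hcell
  obtain ⟨k, hk⟩ := exists_continuousMap_of_isColimit c.isColimit₂ (Z := P) (fun j => H j.as)
    (by rintro ⟨j⟩ ⟨k⟩ ⟨⟨⟨⟩⟩⟩ x; simp)
  replace hk : ∀ (i : c.ι) x, k (c.cofan₂.inj i x) = H i x := fun i x => hk ⟨i⟩ x
  have rep₁ : ∀ z : c.cofan₁.pt, ∃ (i : c.ι) (x : A (c.π i)), c.cofan₁.inj i x = z := by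
    intro z
    obtain ⟨⟨j⟩, x, hx⟩ := Concrete.isColimit_exists_rep _ c.isColimit₁ z
    exact ⟨j, x, hx⟩
  have rep₂ : ∀ z : c.cofan₂.pt, ∃ (i : c.ι) (x : B (c.π i)), c.cofan₂.inj i x = z := by
    intro z
    obtain ⟨⟨j⟩, x, hx⟩ := Concrete.isColimit_exists_rep _ c.isColimit₂ z
    exact ⟨j, x, hx⟩
  have hkm : ∀ z, k (c.m z) = a (c.g₁ z) := by
    intro z
    obtain ⟨i, x, rfl⟩ := rep₁ z
    have h2 := ConcreteCategory.congr_hom (c.hm i) x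
    simp only [ConcreteCategory.comp_apply] at h2
    rw [h2, hk, hH₁]
  obtain ⟨h, hh⟩ := exists_continuousMap_of_isColimit c.isPushout.isColimit (Z := P)
    (fun j => match j with
      | none => a.comp c.g₁.hom
      | some .left => a
      | some .right => k) (by
        rintro _ _ (_ | _ | _) x
        · simp
        · rfl
        · exact hkm x)
  have hl : ∀ x, h (f x) = a x := fun x => hh (some .left) x
  have hr : ∀ x, h (c.g₂ x) = k x := fun x => hh (some .right) x
  refine ⟨h, hl, ?_⟩
  intro z
  obtain ⟨j, x, rfl⟩ := Concrete.isColimit_exists_rep _ c.isPushout.isColimit z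
  have key₁ : ∀ x, p (h (f x)) = b (f x) := fun x => by rw [hl, hab]
  have key₂ : ∀ x, p (h (c.g₂ x)) = b (c.g₂ x) := fun x => by
    obtain ⟨i, x, rfl⟩ := rep₂ x
    rw [hr, hk, hH₂]
  rcases j with _ | _ | _
  · exact key₁ (c.g₁ x)
  · exact key₁ x
  · exact key₂ x

/-- A map from a CW complex lifts through any continuous map with the right lifting property
against the inclusions of the boundary spheres in the disks. -/
theorem TopCat.CWComplex.exists_lift {C : TopCat.{u}} (c : TopCat.CWComplex C)
    (hp : ∀ n, HasLiftsAgainst (TopCat.diskBoundaryInclusion.{u} n) p) (g : C(C, Q)) :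
    ∃ h : C(C, P), ∀ x, p (h x) = g x := by
  have step : ∀ n : ℕ, HasLiftsAgainst (c.F.map (homOfLE (Nat.le_succ n))) p := fun n =>
    HasLiftsAgainst.attachCells (fun _ => hp n) (c.attachCells n (not_isMax n))
  let G : ∀ n, C(c.F.obj n, Q) := fun n => g.comp (c.incl.app n).hom
  have hG : ∀ ⦃m n : ℕ⦄ (f : m ⟶ n) x, G n (c.F.map f x) = G m x := by
    intro m n f x
    have := ConcreteCategory.congr_hom (c.incl.naturality f) x
    simp only [ConcreteCategory.comp_apply] at this
    exact congrArg g this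
  have : IsEmpty (c.F.obj ⊥) := by
    have h1 : IsEmpty (⊥_ TopCat.{u} : TopCat.{u}) := by
      have e : (⊥_ TopCat.{u}) ≅ TopCat.of PEmpty := initialIsoIsInitial TopCat.isInitialPEmpty
      exact Function.isEmpty e.hom
    exact Function.isEmpty c.isoBot.hom
  let T : ℕ → Type _ := fun n => {h : C(c.F.obj n, P) // ∀ x, p (h x) = G n x}
  have hsucc : ∀ n (h : T n), ∃ h' : T (n + 1),
      ∀ x, h'.1 (c.F.map (homOfLE (Nat.le_succ n)) x) = h.1 x := by
    rintro n ⟨h, hh⟩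
    obtain ⟨h', h1, h2⟩ := step n h (G (n + 1)) (fun x => by rw [hh, hG])
    exact ⟨⟨h', h2⟩, h1⟩
  choose S hS using hsucc
  let t₀ : T 0 := ⟨⟨fun x => this.elim x, by
    exact continuous_of_const fun x => this.elim x⟩, fun x => this.elim x⟩
  let t : ∀ n, T n := fun n => Nat.rec t₀ (fun n h => S n h) n
  have ht : ∀ n x, (t (n + 1)).1 (c.F.map (homOfLE (Nat.le_succ n)) x) = (t n).1 x :=
    fun n x => hS n (t n) x
  have ht' : ∀ m n (hmn : m ≤ n) x, (t n).1 (c.F.map (homOfLE hmn) x) = (t m).1 x := by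
    intro m n hmn
    induction n, hmn using Nat.le_induction with
    | base => intro x; simp
    | succ n hmn ih =>
      intro x
      have : c.F.map (homOfLE (Nat.le_succ_of_le hmn)) =
          c.F.map (homOfLE hmn) ≫ c.F.map (homOfLE (Nat.le_succ n)) := by
        rw [← c.F.map_comp]; rfl
      rw [this, ConcreteCategory.comp_apply, ht, ih]
  obtain ⟨h, hh⟩ := exists_continuousMap_of_isColimit c.isColimit (Z := P) (fun n => (t n).1)
    (fun m n f x => ht' m n (leOfHom f) x)
  refine ⟨h, fun z => ?_⟩
  obtain ⟨n, x, rfl⟩ := Concrete.isColimit_exists_rep _ c.isColimit z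
  have := hh n x
  rw [this, (t n).2]
  rfl

end

/-! ### Filling balls and squares. -/

open Metric in
/-- A nullhomotopic map on the unit sphere extends to the unit ball. -/
theorem ContinuousMap.Nullhomotopic.exists_extend_closedBall {V Z : Type*} [NormedAddCommGroup V]
    [NormedSpace ℝ V] [ProperSpace V] [Nontrivial V] [TopologicalSpace Z]
    {g : C(sphere (0 : V) 1, Z)} (hg : g.Nullhomotopic) :
    ∃ G : C(closedBall (0 : V) 1, Z), ∀ x : sphere (0 : V) 1,
      G ⟨x, sphere_subset_closedBall x.2⟩ = g x := by
  obtain ⟨z, ⟨H⟩⟩ := hg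
  -- The ball is the cone on the sphere: `q` collapses exactly the end `s = 1`, where the
  -- nullhomotopy is constant.
  let q : C(I × sphere (0 : V) 1, closedBall (0 : V) 1) :=
    ⟨fun p => ⟨(1 - (p.1 : ℝ)) • (p.2 : V), by
      have h1 : ‖(p.2 : V)‖ = 1 := by simp
      have := p.1.2.1
      have := p.1.2.2
      rw [mem_closedBall_zero_iff, norm_smul, h1, mul_one, Real.norm_eq_abs, abs_le]
      constructor <;> linarith⟩, by fun_prop⟩
  have hnorm : ∀ p, ‖(q p : V)‖ = 1 - p.1 := by
    intro p
    have h1 : ‖(p.2 : V)‖ = 1 := by simp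
    have := p.1.2.2
    change ‖(1 - (p.1 : ℝ)) • (p.2 : V)‖ = _
    rw [norm_smul, h1, mul_one, Real.norm_eq_abs, abs_of_nonneg (by linarith)]
  have hsurj : Function.Surjective q := by
    rintro ⟨v, hv⟩
    rw [mem_closedBall_zero_iff] at hv
    by_cases h0 : v = 0
    · obtain ⟨w, hw⟩ := NormedSpace.sphere_nonempty (x := (0 : V)) (r := 1) |>.2 zero_le_one
      exact ⟨(1, ⟨w, hw⟩), by ext; simp [q, h0]⟩
    · have hv0 : 0 < ‖v‖ := norm_pos_iff.2 h0
      refine ⟨(⟨1 - ‖v‖, by constructor <;> linarith⟩, ⟨‖v‖⁻¹ • v, ?_⟩), ?_⟩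
      · rw [mem_sphere_zero_iff_norm, norm_smul, norm_inv, norm_norm, inv_mul_cancel₀ hv0.ne']
      · ext
        simp [q, smul_smul, hv0.ne']
  have hq : Topology.IsQuotientMap q := Topology.IsQuotientMap.of_surjective_continuous hsurj q.continuous
  have hfac : Function.FactorsThrough H.toContinuousMap q := by
    rintro ⟨s, x⟩ ⟨t, y⟩ h
    have hst : s = t := by
      have h1 := hnorm (s, x)
      rw [h, hnorm] at h1
      ext
      simpa using h1.symm
    subst hst
    by_cases hs : s = 1
    · subst hs
      simp
    · have hs' : (1 - (s : ℝ)) ≠ 0 := by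
        intro h0
        exact hs (Subtype.ext (by simpa using (sub_eq_zero.1 h0).symm))
      have : x = y := by
        ext
        exact smul_right_injective V hs' (congrArg Subtype.val h)
      rw [this]
  refine ⟨hq.lift H.toContinuousMap hfac, fun x => ?_⟩
  have : (⟨x, sphere_subset_closedBall x.2⟩ : closedBall (0 : V) 1) = q (0, x) := by
    ext; simp [q]
  rw [this]
  exact (DFunLike.congr_fun (hq.lift_comp H.toContinuousMap hfac) (0, x)).trans (by simp)

/-- The two ways around a filled square are homotopic. -/
theorem Path.homotopic_of_square {Y : Type*} [TopologicalSpace Y] (F : C(I × I, Y))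
    {y₀₀ y₁₀ y₀₁ y₁₁ : Y} (bot : Path y₀₀ y₁₀) (right : Path y₁₀ y₁₁) (left : Path y₀₀ y₀₁)
    (top : Path y₀₁ y₁₁) (hb : ∀ s, F (s, 0) = bot s) (hr : ∀ t, F (1, t) = right t)
    (hl : ∀ t, F (0, t) = left t) (ht : ∀ s, F (s, 1) = top s) :
    (bot.trans right).Homotopic (left.trans top) := by
  let B : Path ((0, 0) : I × I) (1, 0) := Path.id.prod (Path.refl 0)
  let R : Path ((1, 0) : I × I) (1, 1) := (Path.refl 1).prod Path.id
  let L : Path ((0, 0) : I × I) (0, 1) := (Path.refl 0).prod Path.id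
  let T : Path ((0, 1) : I × I) (1, 1) := Path.id.prod (Path.refl 1)
  have e₀₀ : y₀₀ = F (0, 0) := by rw [hb, bot.source]
  have e₁₀ : y₁₀ = F (1, 0) := by rw [hb, bot.target]
  have e₀₁ : y₀₁ = F (0, 1) := by rw [hl, left.target]
  have e₁₁ : y₁₁ = F (1, 1) := by rw [hr, right.target]
  subst e₀₀ e₁₀ e₀₁ e₁₁
  have hB : bot = B.map F.continuous := by ext s; simp [B, ← hb]
  have hR : right = R.map F.continuous := by ext s; simp [R, ← hr]
  have hL : left = L.map F.continuous := by ext s; simp [L, ← hl]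
  have hT : top = T.map F.continuous := by ext s; simp [T, ← ht]
  rw [hB, hR, hL, hT, ← Path.map_trans, ← Path.map_trans]
  have : ContractibleSpace I := (convex_Icc (0 : ℝ) 1).contractibleSpace ⟨0, by simp⟩
  have : ContractibleSpace (I × I) := inferInstance
  exact (SimplyConnectedSpace.paths_homotopic (B.trans R) (L.trans T)).map F

/-- If the two ways around the boundary of a square are homotopic, the square can be filled. -/
theorem Path.Homotopic.exists_square {Y : Type*} [TopologicalSpace Y]
    {y₀₀ y₁₀ y₀₁ y₁₁ : Y} {bot : Path y₀₀ y₁₀} {right : Path y₁₀ y₁₁} {left : Path y₀₀ y₀₁}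
    {top : Path y₀₁ y₁₁} (h : (bot.trans right).Homotopic (left.trans top)) :
    ∃ F : C(I × I, Y), (∀ s, F (s, 0) = bot s) ∧ (∀ t, F (1, t) = right t) ∧
      (∀ t, F (0, t) = left t) ∧ ∀ s, F (s, 1) = top s := by
  obtain ⟨H⟩ := h
  have hI : ∀ {a b : ℝ}, a ∈ I → b ∈ I → ∀ s : I, (1 - (s : ℝ)) * a + s * b ∈ I := by
    rintro a b ⟨ha, ha'⟩ ⟨hb, hb'⟩ ⟨s, hs, hs'⟩
    constructor
    · have := mul_nonneg (sub_nonneg.2 hs') ha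
      have := mul_nonneg hs hb
      simp only; linarith
    · have := mul_le_mul_of_nonneg_left ha' (sub_nonneg.2 hs')
      have := mul_le_mul_of_nonneg_left hb' hs
      simp only; linarith
  -- The curve `(u, v)` runs along the bottom and then the right side of the square, and `(v, u)`
  -- along the left and then the top. The map `q` below interpolates linearly between them.
  let u : I → ℝ := fun x => min (2 * x) 1
  let v : I → ℝ := fun x => max (2 * x - 1) 0
  have hu : ∀ x, u x ∈ I := fun x => ⟨le_min (by have := x.2.1; linarith) zero_le_one, min_le_right _ _⟩
  have hv : ∀ x, v x ∈ I := fun x => ⟨le_max_right _ _, max_le (by have := x.2.2; linarith) zero_le_one⟩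
  have huv : ∀ x : I, u x + v x = 2 * x := by
    intro x
    rcases le_total (2 * (x : ℝ)) 1 with h | h
    · simp only [u, v]; rw [min_eq_left h, max_eq_right (by linarith)]; ring
    · simp only [u, v]; rw [min_eq_right h, max_eq_left (by linarith)]; ring
  have huc : Continuous u := by fun_prop
  have hvc : Continuous v := by fun_prop
  let q : C(I × I, I × I) :=
    ⟨fun p => (⟨(1 - (p.1 : ℝ)) * u p.2 + p.1 * v p.2, hI (hu _) (hv _) _⟩,
      ⟨(1 - (p.1 : ℝ)) * v p.2 + p.1 * u p.2, hI (hv _) (hu _) _⟩), by fun_prop⟩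
  -- For fixed `x`, the image of `q` lies on an antidiagonal. Sum and difference of the coordinates
  -- recover `x` and then `s`, except at `x = 0, 1`, where the homotopy is constant.
  have hsum : ∀ p, ((q p).1 : ℝ) + (q p).2 = 2 * p.2 := by
    intro p
    rw [← huv p.2]
    simp only [q, ContinuousMap.coe_mk]
    ring
  have hdiff : ∀ p, ((q p).1 : ℝ) - (q p).2 = (1 - 2 * p.1) * (u p.2 - v p.2) := by
    intro p
    simp only [q, ContinuousMap.coe_mk]
    ring
  have hpos : ∀ x : I, x ≠ 0 → x ≠ 1 → 0 < u x - v x := by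
    intro x h0 h1
    have h0' : 0 < (x : ℝ) := lt_of_le_of_ne x.2.1 (fun h => h0 (by ext; simp [← h]))
    have h1' : (x : ℝ) < 1 := lt_of_le_of_ne x.2.2 (fun h => h1 (by ext; simp [h]))
    simp only [u, v]
    rcases le_total (2 * (x : ℝ)) 1 with h | h
    · rw [min_eq_left h, max_eq_right (by linarith)]; linarith
    · rw [min_eq_right h, max_eq_left (by linarith)]; linarith
  have hsurj : Function.Surjective q := by
    rintro ⟨a, b⟩
    have ha := a.2
    have hb := b.2
    let x : I := ⟨((a : ℝ) + b) / 2, by constructor <;> linarith [ha.1, ha.2, hb.1, hb.2]⟩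
    have hx : 2 * (x : ℝ) = a + b := by simp only [x]; ring
    have hle : |(a : ℝ) - b| ≤ u x - v x := by
      rw [abs_le]
      simp only [u, v, hx]
      rcases le_total ((a : ℝ) + b) 1 with h | h
      · rw [min_eq_left h, max_eq_right (by linarith)]
        constructor <;> linarith [ha.1, ha.2, hb.1, hb.2]
      · rw [min_eq_right h, max_eq_left (by linarith)]
        constructor <;> linarith [ha.1, ha.2, hb.1, hb.2]
    have key : ∃ s : I, ((a : ℝ) - b) = (1 - 2 * s) * (u x - v x) := by
      by_cases hd : u x - v x = 0
      · rw [hd] at hle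
        exact ⟨0, by rw [hd, mul_zero]; exact abs_nonpos_iff.1 hle⟩
      · have hd' : 0 < u x - v x := lt_of_le_of_ne ((abs_nonneg _).trans hle) (Ne.symm hd)
        rw [abs_le] at hle
        have h1 : ((a : ℝ) - b) / (u x - v x) ≤ 1 := (div_le_one hd').2 hle.2
        have h2 : -1 ≤ ((a : ℝ) - b) / (u x - v x) := (le_div_iff₀ hd').2 (by linarith)
        refine ⟨⟨(1 - ((a : ℝ) - b) / (u x - v x)) / 2, by constructor <;> linarith⟩, ?_⟩
        simp only
        field_simp
        ring
    obtain ⟨s, hs⟩ := key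
    refine ⟨(s, x), ?_⟩
    have h1 := hsum (s, x)
    have h2 := hdiff (s, x)
    simp only [← hs, hx] at h1 h2
    ext
    · linarith
    · simp only; linarith
  have hq : Topology.IsQuotientMap q :=
    Topology.IsQuotientMap.of_surjective_continuous hsurj q.continuous
  have hfac : Function.FactorsThrough H.toContinuousMap q := by
    rintro ⟨s, x⟩ ⟨t, y⟩ hst
    have hxy : x = y := by
      have h1 := hsum (s, x)
      rw [hst, hsum] at h1
      ext
      simpa using h1.symm
    subst hxy
    by_cases h0 : x = 0
    · subst h0; simp
    by_cases h1 : x = 1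
    · subst h1; simp
    have h2 := hdiff (s, x)
    rw [hst, hdiff] at h2
    have h3 := mul_right_cancel₀ (hpos x h0 h1).ne' h2
    have : s = t := by ext; simp only at h3; linarith
    rw [this]
  let F : C(I × I, Y) := hq.lift H.toContinuousMap hfac
  have hF : ∀ s x, F (q (s, x)) = H (s, x) := fun s x =>
    DFunLike.congr_fun (hq.lift_comp H.toContinuousMap hfac) (s, x)
  have hlow : ∀ {t : ℝ}, t ∈ I → t / 2 ∈ I := fun ht => ⟨by linarith [ht.1], by linarith [ht.2]⟩
  have hupp : ∀ {t : ℝ}, t ∈ I → (1 + t) / 2 ∈ I := fun ht =>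
    ⟨by linarith [ht.1], by linarith [ht.2]⟩
  have ulow : ∀ t : I, u ⟨t / 2, hlow t.2⟩ = t := fun t => by
    simp only [u]; rw [min_eq_left (by linarith [t.2.2])]; ring
  have vlow : ∀ t : I, v ⟨t / 2, hlow t.2⟩ = 0 := fun t => by
    simp only [v]; rw [max_eq_right (by linarith [t.2.2])]
  have uupp : ∀ t : I, u ⟨(1 + t) / 2, hupp t.2⟩ = 1 := fun t => by
    simp only [u]; rw [min_eq_right (by linarith [t.2.1])]
  have vupp : ∀ t : I, v ⟨(1 + t) / 2, hupp t.2⟩ = t := fun t => by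
    simp only [v]; rw [max_eq_left (by linarith [t.2.1])]; ring
  have tlow : ∀ {a b c : Y} (p : Path a b) (r : Path b c) (t : I),
      (p.trans r) ⟨t / 2, hlow t.2⟩ = p t := by
    intro a b c p r t
    rw [Path.trans_apply, dif_pos (by simp only; linarith [t.2.2])]
    congr 1; ext; simp only; ring
  have tupp : ∀ {a b c : Y} (p : Path a b) (r : Path b c) (t : I),
      (p.trans r) ⟨(1 + t) / 2, hupp t.2⟩ = r t := by
    intro a b c p r t
    rw [← Path.extend_extends', Path.extend_trans_of_half_le _ _ (by simp only; linarith [t.2.1])]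
    rw [← Path.extend_extends']
    congr 1; simp only; ring
  refine ⟨F, fun s => ?_, fun t => ?_, fun t => ?_, fun s => ?_⟩
  · rw [← tlow bot right]
    refine Eq.trans ?_ (H.apply_zero _)
    rw [← hF]
    congr 1; ext <;> simp [q, ulow, vlow]
  · rw [← tupp bot right]
    refine Eq.trans ?_ (H.apply_zero _)
    rw [← hF]
    congr 1; ext <;> simp [q, uupp, vupp]
  · rw [← tlow left top]
    refine Eq.trans ?_ (H.apply_one _)
    rw [← hF]
    congr 1; ext <;> simp [q, ulow, vlow]
  · rw [← tupp left top]
    refine Eq.trans ?_ (H.apply_one _)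
    rw [← hF]
    congr 1; ext <;> simp [q, uupp, vupp]

open Metric in
/-- The unit spheres of two linearly homeomorphic normed spaces are homeomorphic. -/
noncomputable def ContinuousLinearEquiv.sphereHomeomorph {V W : Type*} [NormedAddCommGroup V]
    [NormedSpace ℝ V] [NormedAddCommGroup W] [NormedSpace ℝ W] (L : V ≃L[ℝ] W) :
    sphere (0 : V) 1 ≃ₜ sphere (0 : W) 1 where
  toFun x := ⟨‖L x‖⁻¹ • L x, by
    have : L x ≠ 0 := by simpa using ne_zero_of_mem_unit_sphere x
    simp [norm_smul, this]⟩
  invFun y := ⟨‖L.symm y‖⁻¹ • L.symm y, by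
    have : L.symm y ≠ 0 := by simpa using ne_zero_of_mem_unit_sphere y
    simp [norm_smul, this]⟩
  left_inv x := by
    have h0 : ‖L x‖ ≠ 0 := by simpa using ne_zero_of_mem_unit_sphere x
    have h1 : ‖(x : V)‖ = 1 := by simp
    ext
    simp [norm_smul, smul_smul, h0]
  right_inv y := by
    have h0 : ‖L.symm y‖ ≠ 0 := by simpa using ne_zero_of_mem_unit_sphere y
    have h1 : ‖(y : W)‖ = 1 := by simp
    ext
    simp [norm_smul, smul_smul, h0]
  continuous_toFun := by
    refine Continuous.subtype_mk (Continuous.smul (Continuous.inv₀ (by fun_prop) ?_)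
      (by fun_prop)) _
    intro x
    simpa using ne_zero_of_mem_unit_sphere x
  continuous_invFun := by
    refine Continuous.subtype_mk (Continuous.smul (Continuous.inv₀ (by fun_prop) ?_)
      (by fun_prop)) _
    intro x
    simpa using ne_zero_of_mem_unit_sphere x

/-! ### Vanishing homotopy groups and maps from spheres. -/

section

open Metric

variable {V : Type*} [NormedAddCommGroup V] [NormedSpace ℝ V]

/-- The sphere for the maximum norm on `V × ℝ` is the boundary of a cylinder. By radius, the inner
third of the ball covers the bottom face, the middle third climbs the side, and the outer third
covers the top face with the boundary of the ball going to its centre. -/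
theorem wrap_profile (r : ℝ) :
    (min 1 (3 - 3 * r) / max r (1 / 3) * r = 3 * r ∧ max (-1) (min 1 (6 * r - 3)) = -1 ∧ r ≤ 1 / 3) ∨
    (min 1 (3 - 3 * r) / max r (1 / 3) * r = 1 ∧ max (-1) (min 1 (6 * r - 3)) = 6 * r - 3 ∧
      1 / 3 ≤ r ∧ r ≤ 2 / 3) ∨
    (min 1 (3 - 3 * r) / max r (1 / 3) * r = 3 - 3 * r ∧ max (-1) (min 1 (6 * r - 3)) = 1 ∧
      2 / 3 ≤ r) := by
  rcases le_total r (1 / 3) with h | h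
  · left
    rw [max_eq_right h, min_eq_left (by linarith), min_eq_right (by linarith),
        max_eq_left (by linarith)]
    exact ⟨by norm_num, rfl, h⟩
  · right
    rw [max_eq_left h, div_mul_cancel₀ _ (by linarith)]
    rcases le_total r (2 / 3) with h' | h'
    · left
      rw [min_eq_left (by linarith), min_eq_right (by linarith), max_eq_right (by linarith)]
      exact ⟨rfl, rfl, h, h'⟩
    · right
      rw [min_eq_right (by linarith), min_eq_left (by linarith), max_eq_right (by linarith)]
      exact ⟨rfl, rfl, h'⟩

theorem norm_wrap_smul {r : ℝ} (h0 : 0 ≤ r) (h1 : r ≤ 1) {z : V} (hz : ‖z‖ = r) :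
    ‖(min 1 (3 - 3 * r) / max r (1 / 3)) • z‖ = min 1 (3 - 3 * r) / max r (1 / 3) * r := by
  rw [norm_smul, hz, Real.norm_eq_abs, abs_of_nonneg (div_nonneg (le_min zero_le_one (by linarith))
    (h0.trans (le_max_left _ _)))]

/-- The map from the unit ball of `V` to the unit sphere of `V × ℝ` that wraps the ball around the
sphere and collapses the boundary to a point. -/
noncomputable def ballToSphere : C(closedBall (0 : V) 1, sphere (0 : V × ℝ) 1) where
  toFun x := ⟨((min 1 (3 - 3 * ‖(x : V)‖) / max ‖(x : V)‖ (1 / 3)) • (x : V),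
      max (-1) (min 1 (6 * ‖(x : V)‖ - 3))), by
    have hx : ‖(x : V)‖ ≤ 1 := mem_closedBall_zero_iff.1 x.2
    have hx0 := norm_nonneg (x : V)
    rw [mem_sphere_zero_iff_norm, Prod.norm_def, norm_wrap_smul hx0 hx rfl, Real.norm_eq_abs]
    dsimp only
    rcases wrap_profile ‖(x : V)‖ with ⟨h1, h2, h3⟩ | ⟨h1, h2, h3, h4⟩ | ⟨h1, h2, h3⟩
    · rw [h1, h2, abs_neg, abs_one, max_eq_right (by linarith)]
    · rw [h1, h2, max_eq_left]
      rw [abs_le]; constructor <;> linarith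
    · rw [h1, h2, abs_one, max_eq_right (by linarith)]⟩
  continuous_toFun := by
    refine Continuous.subtype_mk (Continuous.prodMk (Continuous.smul (Continuous.div
      (by fun_prop) (by fun_prop) ?_) (by fun_prop)) (by fun_prop)) _
    intro x
    have : (0 : ℝ) < max ‖(x : V)‖ (1 / 3) := lt_max_of_lt_right (by norm_num)
    exact this.ne'

theorem ballToSphere_surjective [Nontrivial V] :
    Function.Surjective (ballToSphere (V := V)) := by
  rintro ⟨⟨v, s⟩, h⟩
  rw [mem_sphere_zero_iff_norm, Prod.norm_def, Real.norm_eq_abs] at h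
  have hv : ‖v‖ ≤ 1 := h ▸ le_max_left _ _
  have hs : |s| ≤ 1 := h ▸ le_max_right _ _
  rw [abs_le] at hs
  have h0 := norm_nonneg v
  by_cases h1 : s = -1
  · have hn : ‖(1 / 3 : ℝ) • v‖ = ‖v‖ / 3 := by rw [norm_smul]; norm_num; ring
    refine ⟨⟨(1 / 3 : ℝ) • v, by rw [mem_closedBall_zero_iff, hn]; linarith⟩, ?_⟩
    ext
    · simp only [ballToSphere, ContinuousMap.coe_mk, hn]
      rw [min_eq_left (by linarith), max_eq_right (by linarith), smul_smul]
      norm_num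
    · simp only [ballToSphere, ContinuousMap.coe_mk, hn]
      rw [min_eq_right (by linarith), max_eq_left (by linarith), h1]
  by_cases h2 : s = 1
  · obtain ⟨w, hw, hwv⟩ : ∃ w : V, ‖w‖ = 1 ∧ v = ‖v‖ • w := by
      by_cases hv0 : v = 0
      · obtain ⟨w, hw⟩ := NormedSpace.sphere_nonempty (x := (0 : V)) (r := 1) |>.2 zero_le_one
        exact ⟨w, by simpa using hw, by simp [hv0]⟩
      · exact ⟨‖v‖⁻¹ • v, by simp [norm_smul, hv0], by simp [smul_smul, hv0]⟩
    have hn : ‖(1 - ‖v‖ / 3) • w‖ = 1 - ‖v‖ / 3 := by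
      rw [norm_smul, hw, mul_one, Real.norm_eq_abs, abs_of_nonneg (by linarith)]
    refine ⟨⟨(1 - ‖v‖ / 3) • w, by rw [mem_closedBall_zero_iff, hn]; linarith⟩, ?_⟩
    ext
    · simp only [ballToSphere, ContinuousMap.coe_mk, hn]
      rw [min_eq_right (by linarith), max_eq_left (by linarith), smul_smul,
        div_mul_cancel₀ _ (by linarith)]
      conv_rhs => rw [hwv]
      congr 1
      ring
    · simp only [ballToSphere, ContinuousMap.coe_mk, hn]
      rw [min_eq_left (by linarith), max_eq_right (by linarith), h2]
  · have h1' : -1 < s := lt_of_le_of_ne hs.1 (Ne.symm h1)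
    have h2' : s < 1 := lt_of_le_of_ne hs.2 h2
    have hv1 : ‖v‖ = 1 := by
      rcases max_choice ‖v‖ |s| with hc | hc
      · rw [hc] at h; exact h
      · rw [hc] at h
        have : |s| < 1 := abs_lt.2 ⟨h1', h2'⟩
        linarith
    have hn : ‖((s + 3) / 6) • v‖ = (s + 3) / 6 := by
      rw [norm_smul, hv1, mul_one, Real.norm_eq_abs, abs_of_nonneg (by linarith)]
    refine ⟨⟨((s + 3) / 6) • v, by rw [mem_closedBall_zero_iff, hn]; linarith⟩, ?_⟩
    ext
    · simp only [ballToSphere, ContinuousMap.coe_mk, hn]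
      rw [min_eq_left (by linarith), max_eq_left (by linarith), smul_smul,
        one_div_mul_cancel (by linarith), one_smul]
    · simp only [ballToSphere, ContinuousMap.coe_mk, hn]
      rw [min_eq_right (by linarith), max_eq_right (by linarith)]
      ring

theorem eq_or_norm_eq_one_of_ballToSphere_eq {x y : closedBall (0 : V) 1}
    (h : ballToSphere x = ballToSphere y) : x = y ∨ ‖(x : V)‖ = 1 ∧ ‖(y : V)‖ = 1 := by
  have hx : ‖(x : V)‖ ≤ 1 := mem_closedBall_zero_iff.1 x.2
  have hy : ‖(y : V)‖ ≤ 1 := mem_closedBall_zero_iff.1 y.2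
  have hx0 := norm_nonneg (x : V)
  have hy0 := norm_nonneg (y : V)
  have hA : (min 1 (3 - 3 * ‖(x : V)‖) / max ‖(x : V)‖ (1 / 3)) • (x : V) =
      (min 1 (3 - 3 * ‖(y : V)‖) / max ‖(y : V)‖ (1 / 3)) • (y : V) := congrArg (fun z => z.1.1) h
  have hB : max (-1) (min 1 (6 * ‖(x : V)‖ - 3)) = max (-1) (min 1 (6 * ‖(y : V)‖ - 3)) :=
    congrArg (fun z => z.1.2) h
  have hC := congrArg norm hA
  rw [norm_wrap_smul hx0 hx rfl, norm_wrap_smul hy0 hy rfl] at hC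
  have hxy : ‖(x : V)‖ = ‖(y : V)‖ := by
    rcases wrap_profile ‖(x : V)‖ with ⟨h1, h2, h3⟩ | ⟨h1, h2, h3, h4⟩ | ⟨h1, h2, h3⟩ <;>
    rcases wrap_profile ‖(y : V)‖ with ⟨h1', h2', h3'⟩ | ⟨h1', h2', h3', h4'⟩ | ⟨h1', h2', h3'⟩ <;>
    linarith
  rcases lt_or_eq_of_le hx with h1 | h1
  · left
    rw [← hxy] at hA
    have : 0 < min 1 (3 - 3 * ‖(x : V)‖) / max ‖(x : V)‖ (1 / 3) :=
      div_pos (lt_min zero_lt_one (by linarith)) (lt_max_of_lt_right (by norm_num))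
    ext
    exact smul_right_injective V this.ne' hA
  · exact Or.inr ⟨h1, hxy ▸ h1⟩

open Topology.Homotopy in
/-- A space with trivial `n`-th homotopy groups has only nullhomotopic maps from the unit sphere
of `ℝⁿ × ℝ` for the supremum norm. -/
theorem nullhomotopic_of_homotopyGroup_subsingleton {Y : Type*} [TopologicalSpace Y] {n : ℕ}
    (hn : n ≠ 0) (hY : ∀ y : Y, Subsingleton (π_ n Y y))
    (g : C(sphere (0 : (Fin n → ℝ) × ℝ) 1, Y)) : g.Nullhomotopic := by
  have : NeZero n := ⟨hn⟩
  -- The unit ball of the supremum norm is a cube, so an affine map matches its unit sphere with the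
  -- cube boundary in the definition of `π_ n`.
  let aff : C(Fin n → I, closedBall (0 : Fin n → ℝ) 1) :=
    ⟨fun y => ⟨fun i => 2 * (y i : ℝ) - 1, by
      rw [mem_closedBall_zero_iff, pi_norm_le_iff_of_nonneg zero_le_one]
      intro i
      rw [Real.norm_eq_abs, abs_le]
      constructor <;> linarith [(y i).2.1, (y i).2.2]⟩, by fun_prop⟩
  have haff_inj : Function.Injective aff := by
    intro y z h
    ext i
    have h1 : 2 * (y i : ℝ) - 1 = 2 * (z i : ℝ) - 1 := congrFun (congrArg Subtype.val h) i
    linarith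
  have haff_surj : Function.Surjective aff := by
    rintro ⟨x, hx⟩
    rw [mem_closedBall_zero_iff, pi_norm_le_iff_of_nonneg zero_le_one] at hx
    refine ⟨fun i => ⟨(x i + 1) / 2, ?_⟩, ?_⟩
    · have := abs_le.1 (hx i)
      constructor <;> linarith
    · ext i
      simp only [aff, ContinuousMap.coe_mk]
      ring
  have hbd : ∀ y, y ∈ Cube.boundary (Fin n) ↔ ‖(aff y : Fin n → ℝ)‖ = 1 := by
    intro y
    constructor
    · rintro ⟨i, hi⟩
      apply le_antisymm (mem_closedBall_zero_iff.1 (aff y).2)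
      have h1 : ‖(aff y : Fin n → ℝ) i‖ = 1 := by
        rcases hi with hi | hi <;> simp [aff, hi]; norm_num
      exact h1.symm.le.trans (norm_le_pi_norm (aff y : Fin n → ℝ) i)
    · intro h
      obtain ⟨i, hi⟩ : ∃ i, ‖(aff y : Fin n → ℝ) i‖ = 1 := by
        obtain ⟨i, -, hi⟩ := Finset.exists_mem_eq_sup' (Finset.univ_nonempty (α := Fin n))
          (fun i => ‖(aff y : Fin n → ℝ) i‖)
        refine ⟨i, le_antisymm ((norm_le_pi_norm _ i).trans h.le) (h.symm.le.trans ?_)⟩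
        rw [← hi, pi_norm_le_iff_of_nonempty]
        exact fun b => Finset.le_sup' (fun i => ‖(aff y : Fin n → ℝ) i‖) (Finset.mem_univ b)
      refine ⟨i, ?_⟩
      have h2 : |2 * (y i : ℝ) - 1| = 1 := hi
      rcases eq_or_eq_neg_of_abs_eq h2 with h3 | h3
      · exact Or.inr (Subtype.ext (show (y i : ℝ) = 1 by linarith))
      · exact Or.inl (Subtype.ext (show (y i : ℝ) = 0 by linarith))
  let q : C(Fin n → I, sphere (0 : (Fin n → ℝ) × ℝ) 1) := ballToSphere.comp aff
  have hq_surj : Function.Surjective q := ballToSphere_surjective.comp haff_surj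
  have hq_eq : ∀ {y z}, q y = q z →
      y = z ∨ y ∈ Cube.boundary (Fin n) ∧ z ∈ Cube.boundary (Fin n) := by
    intro y z h
    rcases eq_or_norm_eq_one_of_ballToSphere_eq h with h | h
    · exact Or.inl (haff_inj h)
    · exact Or.inr ⟨(hbd y).2 h.1, (hbd z).2 h.2⟩
  let p : Fin n → I := fun _ => 0
  have hp : p ∈ Cube.boundary (Fin n) := ⟨0, Or.inl rfl⟩
  have hbase : ∀ y ∈ Cube.boundary (Fin n), q y = q p := by
    intro y hy
    have h1 := (hbd y).1 hy
    have h2 := (hbd p).1 hp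
    ext : 1
    simp only [q, ballToSphere, ContinuousMap.comp_apply, ContinuousMap.coe_mk, h1, h2]
    norm_num
  let ω : Ω^ (Fin n) Y (g (q p)) := ⟨g.comp q, fun y hy => congrArg g (hbase y hy)⟩
  obtain ⟨H⟩ : GenLoop.Homotopic ω GenLoop.const :=
    Quotient.exact ((hY (g (q p))).elim (Quotient.mk (GenLoop.Homotopic.setoid _ _) ω)
      (Quotient.mk (GenLoop.Homotopic.setoid _ _) GenLoop.const))
  have hHb : ∀ t, ∀ y ∈ Cube.boundary (Fin n), H (t, y) = g (q p) := by
    intro t y hy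
    rw [H.eq_fst t hy]
    exact congrArg g (hbase y hy)
  -- The homotopy is relative to the boundary of the cube, hence descends along the collapse to the
  -- sphere at every time.
  let Q : C(I × (Fin n → I), I × sphere (0 : (Fin n → ℝ) × ℝ) 1) := (ContinuousMap.id I).prodMap q
  have hQ : Topology.IsQuotientMap Q := Topology.IsQuotientMap.of_surjective_continuous
    (Function.surjective_id.prodMap hq_surj) Q.continuous
  have hfac : Function.FactorsThrough H.toContinuousMap Q := by
    rintro ⟨s, y⟩ ⟨t, z⟩ h
    obtain ⟨h1, h2⟩ := Prod.ext_iff.1 h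
    change s = t at h1
    subst h1
    rcases hq_eq h2 with rfl | ⟨hy, hz⟩
    · rfl
    · exact (hHb s y hy).trans (hHb s z hz).symm
  have hF : ∀ s y, hQ.lift H.toContinuousMap hfac (s, q y) = H (s, y) := fun s y =>
    DFunLike.congr_fun (hQ.lift_comp H.toContinuousMap hfac) (s, y)
  refine ⟨g (q p), ⟨{ toContinuousMap := hQ.lift H.toContinuousMap hfac, map_zero_left := ?_, map_one_left := ?_ }⟩⟩
  · intro x
    obtain ⟨y, rfl⟩ := hq_surj x
    exact (hF 0 y).trans (H.apply_zero y)
  · intro x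
    obtain ⟨y, rfl⟩ := hq_surj x
    exact (hF 1 y).trans (H.apply_one y)

/-- Two maps from a disk to a space with trivial `n`-th homotopy groups are homotopic, with a
prescribed homotopy on the boundary. -/
theorem exists_homotopy_extend_sphere {Y : Type*} [TopologicalSpace Y] {n : ℕ} (hn : n ≠ 0)
    (hY : ∀ y : Y, Subsingleton (π_ n Y y))
    (W₀ W₁ : C(closedBall (0 : EuclideanSpace ℝ (Fin n)) 1, Y))
    (γ : C(sphere (0 : EuclideanSpace ℝ (Fin n)) 1, C(I, Y)))
    (h₀ : ∀ x : sphere (0 : EuclideanSpace ℝ (Fin n)) 1, γ x 0 = W₀ ⟨x, sphere_subset_closedBall x.2⟩)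
    (h₁ : ∀ x : sphere (0 : EuclideanSpace ℝ (Fin n)) 1, γ x 1 = W₁ ⟨x, sphere_subset_closedBall x.2⟩) :
    ∃ G : C(closedBall (0 : EuclideanSpace ℝ (Fin n)) 1, C(I, Y)), (∀ x, G x 0 = W₀ x) ∧
      (∀ x, G x 1 = W₁ x) ∧ ∀ x : sphere (0 : EuclideanSpace ℝ (Fin n)) 1,
        G ⟨x, sphere_subset_closedBall x.2⟩ = γ x := by
  let E := EuclideanSpace ℝ (Fin n)
  have hS : ∀ z : sphere (0 : E × ℝ) 1, max ‖z.1.1‖ |z.1.2| = 1 := fun z => by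
    have h := mem_sphere_zero_iff_norm.1 z.2
    rwa [Prod.norm_def, Real.norm_eq_abs] at h
  have hS₁ : ∀ z : sphere (0 : E × ℝ) 1, z.1.1 ∈ closedBall (0 : E) 1 := fun z =>
    mem_closedBall_zero_iff.2 ((le_max_left _ _).trans (hS z).le)
  have hS₂ : ∀ z : sphere (0 : E × ℝ) 1, (z.1.2 + 1) / 2 ∈ I := fun z => by
    have := abs_le.1 ((le_max_right _ _).trans (hS z).le)
    constructor <;> linarith
  -- Bottom, top and side of the cylinder. The maps `W₀`, `W₁` and `γ` glue to a map on its
  -- boundary, and filling the cylinder is the required homotopy.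
  let A : Fin 3 → Set (sphere (0 : E × ℝ) 1) :=
    ![{z | z.1.2 = -1}, {z | z.1.2 = 1}, {z | ‖z.1.1‖ = 1}]
  classical
  let g₂ : {z : sphere (0 : E × ℝ) 1 | ‖z.1.1‖ = 1} → Y := fun z =>
    γ ⟨z.1.1.1, mem_sphere_zero_iff_norm.2 z.2⟩ ⟨(z.1.1.2 + 1) / 2, hS₂ z.1⟩
  let g : sphere (0 : E × ℝ) 1 → Y := fun z =>
    if h : ‖z.1.1‖ = 1 then g₂ ⟨z, h⟩ else
      if z.1.2 = -1 then W₀ ⟨z.1.1, hS₁ z⟩ else W₁ ⟨z.1.1, hS₁ z⟩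
  have hg₂ : ∀ (z : sphere (0 : E × ℝ) 1) (h : ‖z.1.1‖ = 1), g z = g₂ ⟨z, h⟩ := fun z h => dif_pos h
  have hg₀ : ∀ z, z.1.2 = -1 → g z = W₀ ⟨z.1.1, hS₁ z⟩ := by
    intro z hz
    by_cases h : ‖z.1.1‖ = 1
    · rw [hg₂ z h]
      refine Eq.trans ?_ (h₀ ⟨z.1.1, mem_sphere_zero_iff_norm.2 h⟩)
      simp only [g₂]
      congr 1
      ext
      simp [hz]
    · simp only [g, dif_neg h, if_pos hz]
  have hg₁ : ∀ z, z.1.2 = 1 → g z = W₁ ⟨z.1.1, hS₁ z⟩ := by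
    intro z hz
    by_cases h : ‖z.1.1‖ = 1
    · rw [hg₂ z h]
      refine Eq.trans ?_ (h₁ ⟨z.1.1, mem_sphere_zero_iff_norm.2 h⟩)
      simp only [g₂]
      congr 1
      ext
      simp [hz]
    · simp only [g, dif_neg h]
      rw [if_neg (by rw [hz]; norm_num)]
  have hcont : Continuous g := by
    refine (locallyFinite_of_finite A).continuous ?_ ?_ ?_
    · ext z
      simp only [Set.mem_iUnion, Set.mem_univ, iff_true]
      rcases max_choice ‖z.1.1‖ |z.1.2| with hc | hc
      · exact ⟨2, hc.symm.trans (hS z)⟩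
      · rcases eq_or_eq_neg_of_abs_eq (hc.symm.trans (hS z)) with h | h
        · exact ⟨1, h⟩
        · exact ⟨0, h⟩
    · intro i
      fin_cases i
      · exact isClosed_eq (by fun_prop) continuous_const
      · exact isClosed_eq (by fun_prop) continuous_const
      · exact isClosed_eq (by fun_prop) continuous_const
    · intro i
      fin_cases i
      · exact ContinuousOn.congr (Continuous.continuousOn (by fun_prop)) (fun z hz => hg₀ z hz)
      · exact ContinuousOn.congr (Continuous.continuousOn (by fun_prop)) (fun z hz => hg₁ z hz)
      · rw [continuousOn_iff_continuous_domRestrict]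
        have : Continuous g₂ := by fun_prop
        exact this.congr fun z => (hg₂ z.1 z.2).symm
  -- The vanishing result is for the supremum norm on `ℝⁿ`, while the disks here are Euclidean;
  -- radial rescaling identifies the spheres.
  let L : ((Fin n → ℝ) × ℝ) ≃L[ℝ] E × ℝ :=
    (EuclideanSpace.equiv (Fin n) ℝ).symm.prodCongr (ContinuousLinearEquiv.refl ℝ ℝ)
  let e := L.sphereHomeomorph
  have hnull : ContinuousMap.Nullhomotopic (⟨g, hcont⟩ : C(sphere (0 : E × ℝ) 1, Y)) := by
    have h1 := nullhomotopic_of_homotopyGroup_subsingleton hn hY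
      ((⟨g, hcont⟩ : C(sphere (0 : E × ℝ) 1, Y)).comp
        (e : C(sphere (0 : (Fin n → ℝ) × ℝ) 1, sphere (0 : E × ℝ) 1)))
    have h2 := h1.comp_left (e.symm : C(sphere (0 : E × ℝ) 1, sphere (0 : (Fin n → ℝ) × ℝ) 1))
    convert h2 using 1
    ext z
    simp
  obtain ⟨K, hK⟩ := hnull.exists_extend_closedBall
  have hmem : ∀ (x : closedBall (0 : E) 1) (t : I),
      ((x : E), 2 * (t : ℝ) - 1) ∈ closedBall (0 : E × ℝ) 1 := by
    intro x t
    rw [mem_closedBall_zero_iff, Prod.norm_def]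
    refine max_le (mem_closedBall_zero_iff.1 x.2) ?_
    rw [Real.norm_eq_abs, abs_le]
    constructor <;> linarith [t.2.1, t.2.2]
  let G : C(closedBall (0 : E) 1 × I, Y) :=
    ⟨fun p => K ⟨((p.1 : E), 2 * (p.2 : ℝ) - 1), hmem p.1 p.2⟩, by fun_prop⟩
  have hsph : ∀ (x : closedBall (0 : E) 1) (t : I)
      (h : ((x : E), 2 * (t : ℝ) - 1) ∈ sphere (0 : E × ℝ) 1), G (x, t) = g ⟨_, h⟩ :=
    fun x t h => hK ⟨_, h⟩
  have hx : ∀ x : closedBall (0 : E) 1, ‖(x : E)‖ ≤ 1 := fun x => mem_closedBall_zero_iff.1 x.2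
  refine ⟨G.curry, fun x => ?_, fun x => ?_, fun (x : sphere (0 : E) 1) => ?_⟩
  · have h : ((x : E), 2 * ((0 : I) : ℝ) - 1) ∈ sphere (0 : E × ℝ) 1 := by
      rw [mem_sphere_zero_iff_norm, Prod.norm_def]
      simp [hx x]
    exact (hsph x 0 h).trans (hg₀ _ (by simp))
  · have h : ((x : E), 2 * ((1 : I) : ℝ) - 1) ∈ sphere (0 : E × ℝ) 1 := by
      rw [mem_sphere_zero_iff_norm, Prod.norm_def]
      norm_num [hx x]
    exact (hsph x 1 h).trans (hg₁ _ (by norm_num))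
  · ext t
    have hx1 : ‖(x : E)‖ = 1 := mem_sphere_zero_iff_norm.1 x.2
    have h : ((x : E), 2 * (t : ℝ) - 1) ∈ sphere (0 : E × ℝ) 1 := by
      rw [mem_sphere_zero_iff_norm, Prod.norm_def, hx1, max_eq_left]
      rw [Real.norm_eq_abs, abs_le]
      constructor <;> linarith [t.2.1, t.2.2]
    refine (hsph ⟨x, sphere_subset_closedBall x.2⟩ t h).trans
      ((hg₂ ⟨((x : E), 2 * (t : ℝ) - 1), h⟩ hx1).trans ?_)
    simp only [g₂]
    congr 1
    ext
    simp

end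

/-! ### Factoring a map up to homotopy through a space with contractible cover. -/

section Factorization

universe u

variable {C Γ Y : Type*} [TopologicalSpace C] [TopologicalSpace Γ] [TopologicalSpace Y]
  (φ : C(C, Y)) (b : C(Γ, Y)) {c₀ : C} {t₀ : Γ} (γ₀ : Path (b t₀) (φ c₀))

/-- The points `(c, t, γ)` with `γ` a path from `b t` to `φ c` that can be connected to the base
point `(c₀, t₀, γ₀)` through such triples. -/
def factorSpace : Set (C × Γ × C(I, Y)) :=
  {p | ∃ (h₀ : p.2.2 0 = b p.2.1) (h₁ : p.2.2 1 = φ p.1) (e : Path c₀ p.1) (α : Path t₀ p.2.1),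
    ((α.map b.continuous).trans ⟨p.2.2, h₀, h₁⟩).Homotopic (γ₀.trans (e.map φ.continuous))}

variable {φ b γ₀}

/-- A square of paths from `b (τ s)` to `φ (d s)` is a path in the homotopy pullback; appending `d`
and `τ` to the connecting paths keeps the endpoint in the same component. -/
theorem mem_factorSpace_of_square {c c' : C} {t t' : Γ} {γ γ' : C(I, Y)} (d : Path c c')
    (τ : Path t t') (F : C(I × I, Y)) (h : (c, t, γ) ∈ factorSpace φ b γ₀)
    (hb : ∀ s, F (s, 0) = b (τ s)) (hr : ∀ s, F (1, s) = γ' s) (hl : ∀ s, F (0, s) = γ s)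
    (ht : ∀ s, F (s, 1) = φ (d s)) : (c', t', γ') ∈ factorSpace φ b γ₀ := by
  obtain ⟨h₀, h₁, e, α, he⟩ := h
  have h₀' : γ' 0 = b t' := by rw [← hr, hb, τ.target]
  have h₁' : γ' 1 = φ c' := by rw [← hr, ht, d.target]
  refine ⟨h₀', h₁', e.trans d, α.trans τ, ?_⟩
  have key : ((τ.map b.continuous).trans ⟨γ', h₀', h₁'⟩).Homotopic
      (Path.trans ⟨γ, h₀, h₁⟩ (d.map φ.continuous)) :=
    Path.homotopic_of_square F _ _ _ _ hb hr hl ht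
  rw [← Path.Homotopic.Quotient.eq] at *
  simp only [Path.map_trans, Path.Homotopic.Quotient.mk_trans] at *
  rw [Path.Homotopic.Quotient.trans_assoc, key, ← Path.Homotopic.Quotient.trans_assoc, he,
    Path.Homotopic.Quotient.trans_assoc]

theorem mem_factorSpace_of_path {c c' : C} {t t' : Γ} (d : Path c c') (τ : Path t t')
    (F : C(I × I, Y)) (h : (c, t, F.curry 0) ∈ factorSpace φ b γ₀)
    (hb : ∀ s, F (s, 0) = b (τ s)) (ht : ∀ s, F (s, 1) = φ (d s)) (s : I) :
    (d s, τ s, F.curry s) ∈ factorSpace φ b γ₀ := by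
  refine mem_factorSpace_of_square (⟨⟨fun r => d (r * s), by fun_prop⟩, by simp, by simp⟩ : Path c (d s))
   
    (⟨⟨fun r => τ (r * s), by fun_prop⟩, by simp, by simp⟩ : Path t (τ s))
    ⟨fun p => F (p.1 * s, p.2), by fun_prop⟩ h ?_ ?_ ?_ ?_
  · intro r; exact hb _
  · intro r; simp
  · intro r; simp
  · intro r; exact ht _

/-- Two points of the component can be joined over any prescribed path in `C`: the discrepancy is
the `φ`-image of a loop, and `hrange` cancels it by a loop `δ` in `Γ`. -/
theorem exists_path_of_mem_factorSpace
    (hrange : ∀ g : Path c₀ c₀, ∃ δ : Path t₀ t₀,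
      ((δ.map b.continuous).trans γ₀).Homotopic (γ₀.trans (g.map φ.continuous)))
    {c c' : C} {t t' : Γ} {γ γ' : C(I, Y)} (d : Path c c') (h : (c, t, γ) ∈ factorSpace φ b γ₀)
    (h' : (c', t', γ') ∈ factorSpace φ b γ₀) :
    ∃ (τ : Path t t') (F : C(I × I, Y)), (∀ s, F (s, 0) = b (τ s)) ∧ (∀ s, F (1, s) = γ' s) ∧
      (∀ s, F (0, s) = γ s) ∧ ∀ s, F (s, 1) = φ (d s) := by
  obtain ⟨h₀, h₁, e, α, he⟩ := h
  obtain ⟨h₀', h₁', e', α', he'⟩ := h'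
  obtain ⟨δ, hδ⟩ := hrange ((e.trans d).trans e'.symm)
  let τ : Path t t' := α.symm.trans (δ.trans α')
  have key : ((τ.map b.continuous).trans ⟨γ', h₀', h₁'⟩).Homotopic
      (Path.trans ⟨γ, h₀, h₁⟩ (d.map φ.continuous)) := by
    rw [← Path.Homotopic.Quotient.eq] at *
    simp only [τ, Path.map_trans, ← Path.map_symm, Path.Homotopic.Quotient.mk_trans,
      Path.Homotopic.Quotient.mk_symm, Path.Homotopic.Quotient.trans_assoc] at *
    rw [he']
    have h2 := congrArg (fun z => Path.Homotopic.Quotient.trans z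
      (Path.Homotopic.Quotient.mk (e'.map φ.continuous))) hδ
    simp only [Path.Homotopic.Quotient.trans_assoc, Path.Homotopic.Quotient.symm_trans,
      Path.Homotopic.Quotient.trans_refl] at h2
    have h3 := congrArg (fun z => Path.Homotopic.Quotient.trans z
      (Path.Homotopic.Quotient.mk (d.map φ.continuous))) he
    simp only [Path.Homotopic.Quotient.trans_assoc] at h3
    rw [h2, ← h3, ← Path.Homotopic.Quotient.trans_assoc, Path.Homotopic.Quotient.symm_trans,
      Path.Homotopic.Quotient.refl_trans]
  obtain ⟨F, hF⟩ := key.exists_square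
  exact ⟨τ, F, hF⟩

/-- Conjugation by `α` carries injectivity of `b` on `π₁` from `t₀` to any other point of its path
component. -/
theorem homotopic_refl_of_map_homotopic_refl
    (hinj : ∀ ω : Path t₀ t₀, (ω.map b.continuous).Homotopic (Path.refl _) →
      ω.Homotopic (Path.refl _)) {t : Γ} (α : Path t₀ t) (ω : Path t t)
    (h : (ω.map b.continuous).Homotopic (Path.refl _)) : ω.Homotopic (Path.refl _) := by
  have h1 := hinj ((α.trans ω).trans α.symm) (by
    rw [← Path.Homotopic.Quotient.eq] at *
    simp only [Path.map_trans, ← Path.map_symm, Path.Homotopic.Quotient.mk_trans,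
      Path.Homotopic.Quotient.mk_symm, Path.Homotopic.Quotient.mk_refl] at *
    rw [h, Path.Homotopic.Quotient.trans_refl, Path.Homotopic.Quotient.trans_symm])
  rw [← Path.Homotopic.Quotient.eq] at *
  simp only [Path.Homotopic.Quotient.mk_trans, Path.Homotopic.Quotient.mk_symm,
    Path.Homotopic.Quotient.mk_refl] at *
  have h2 := congrArg (fun z => (Path.Homotopic.Quotient.mk α).symm.trans
    (z.trans (Path.Homotopic.Quotient.mk α))) h1
  simpa only [Path.Homotopic.Quotient.trans_assoc, Path.Homotopic.Quotient.symm_trans,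
    Path.Homotopic.Quotient.trans_refl, Path.Homotopic.Quotient.refl_trans,
    ← Path.Homotopic.Quotient.trans_assoc (Path.Homotopic.Quotient.mk α).symm
      (Path.Homotopic.Quotient.mk α)] using h2

open Metric

/-- The disk is an interval, so this is path lifting with both endpoints prescribed. It is the only
dimension in which the inclusion of `π₁`-images is needed. -/
theorem exists_extend_factorSpace_disk_one
    (hrange : ∀ g : Path c₀ c₀, ∃ δ : Path t₀ t₀,
      ((δ.map b.continuous).trans γ₀).Homotopic (γ₀.trans (g.map φ.continuous)))
    (f : C(sphere (0 : EuclideanSpace ℝ (Fin 1)) 1, factorSpace φ b γ₀))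
    (g : C(closedBall (0 : EuclideanSpace ℝ (Fin 1)) 1, C))
    (hfg : ∀ x : sphere (0 : EuclideanSpace ℝ (Fin 1)) 1, (f x).1.1 = g ⟨x, sphere_subset_closedBall x.2⟩) :
    ∃ h : C(closedBall (0 : EuclideanSpace ℝ (Fin 1)) 1, factorSpace φ b γ₀),
      (∀ x : sphere (0 : EuclideanSpace ℝ (Fin 1)) 1,
        h ⟨x, sphere_subset_closedBall x.2⟩ = f x) ∧ ∀ x, (h x).1.1 = g x := by
  have hnorm : ∀ x : EuclideanSpace ℝ (Fin 1), ‖x‖ = |x 0| := fun x => by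
    rw [EuclideanSpace.norm_eq]; simp [Real.sqrt_sq_eq_abs]
  let pt : ℝ → EuclideanSpace ℝ (Fin 1) := fun r => WithLp.toLp 2 (fun _ => r)
  have hpt : ∀ r, ‖pt r‖ = |r| := fun r => by rw [hnorm]
  have hptc : Continuous pt := by fun_prop
  have heta : ∀ x : EuclideanSpace ℝ (Fin 1), pt (x 0) = x := fun x => by
    ext i
    rw [Subsingleton.elim i 0]
  let pneg : sphere (0 : EuclideanSpace ℝ (Fin 1)) 1 := ⟨pt (-1), by rw [mem_sphere_zero_iff_norm, hpt]; norm_num⟩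
  let ppos : sphere (0 : EuclideanSpace ℝ (Fin 1)) 1 := ⟨pt 1, by rw [mem_sphere_zero_iff_norm, hpt]; norm_num⟩
  let par : I → closedBall (0 : EuclideanSpace ℝ (Fin 1)) 1 := fun s => ⟨pt (2 * s - 1), by
    rw [mem_closedBall_zero_iff, hpt, abs_le]
    constructor <;> linarith [s.2.1, s.2.2]⟩
  let d : Path (f pneg).1.1 (f ppos).1.1 :=
    ⟨⟨fun s => g (par s), by fun_prop⟩, by
      rw [hfg]; simp only [par, pneg]; congr; norm_num, by
      rw [hfg]; simp only [par, ppos]; congr; norm_num⟩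
  obtain ⟨τ, F, hb, hr, hl, ht⟩ := exists_path_of_mem_factorSpace hrange d (f pneg).2 (f ppos).2
  have hmem : ∀ s, (d s, τ s, F.curry s) ∈ factorSpace φ b γ₀ := by
    refine mem_factorSpace_of_path d τ F ?_ hb ht
    have : F.curry 0 = (f pneg).1.2.2 := by ext s; exact hl s
    rw [this]
    exact (f pneg).2
  let inv : closedBall (0 : EuclideanSpace ℝ (Fin 1)) 1 → I := fun x => ⟨(x.1 0 + 1) / 2, by
    have := mem_closedBall_zero_iff.1 x.2
    rw [hnorm, abs_le] at this
    constructor <;> linarith⟩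
  have hinv : ∀ x, par (inv x) = x := by
    intro x
    ext : 1
    simp only [par, inv]
    rw [← heta x.1]
    congr 1
    simp only [pt]
    ring
  refine ⟨⟨fun x => ⟨(d (inv x), τ (inv x), F.curry (inv x)), hmem _⟩, ?_⟩, ?_, ?_⟩
  · refine Continuous.subtype_mk ?_ _
    have hc : Continuous inv := by
      have : Continuous fun x : closedBall (0 : EuclideanSpace ℝ (Fin 1)) 1 => (x.1 : EuclideanSpace ℝ (Fin 1)) 0 := by
        fun_prop
      exact Continuous.subtype_mk (by fun_prop) _
    fun_prop
  · intro x
    have h1 := mem_sphere_zero_iff_norm.1 x.2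
    rw [hnorm] at h1
    rcases eq_or_eq_neg_of_abs_eq h1 with h | h
    · have hx : x = ppos := by ext : 1; rw [← heta x.1, h]
      subst hx
      have h3 : inv ⟨ppos, sphere_subset_closedBall ppos.2⟩ = 1 := by
        ext; simp only [inv, ppos, pt]; norm_num
      ext : 1
      simp only [ContinuousMap.coe_mk, h3, d.target, τ.target]
      refine Prod.ext rfl (Prod.ext rfl ?_)
      ext s
      exact hr s
    · have hx : x = pneg := by ext : 1; rw [← heta x.1, h]
      subst hx
      have h3 : inv ⟨pneg, sphere_subset_closedBall pneg.2⟩ = 0 := by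
        ext; simp only [inv, pneg, pt]; norm_num
      ext : 1
      simp only [ContinuousMap.coe_mk, h3, d.source, τ.source]
      refine Prod.ext rfl (Prod.ext rfl ?_)
      ext s
      exact hl s
  · intro x
    exact congrArg g (hinv x)

/-- The component in `Γ` is extended over the disk by lifting it to the contractible cover; the
paths are then extended using that `π_ n Y` vanishes. -/
theorem exists_extend_factorSpace_disk_of_two_le {T : Type*} [TopologicalSpace T]
    [ContractibleSpace T] {q : T → Γ} (hq : IsCoveringMap q) (hq' : Function.Surjective q)
    (hinj : ∀ ω : Path t₀ t₀, (ω.map b.continuous).Homotopic (Path.refl _) →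
      ω.Homotopic (Path.refl _)) {n : ℕ} (hn : 2 ≤ n) (hY : ∀ y : Y, Subsingleton (π_ n Y y))
    (f : C(sphere (0 : EuclideanSpace ℝ (Fin n)) 1, factorSpace φ b γ₀))
    (g : C(closedBall (0 : EuclideanSpace ℝ (Fin n)) 1, C))
    (hfg : ∀ x : sphere (0 : EuclideanSpace ℝ (Fin n)) 1, (f x).1.1 = g ⟨x, sphere_subset_closedBall x.2⟩) :
    ∃ h : C(closedBall (0 : EuclideanSpace ℝ (Fin n)) 1, factorSpace φ b γ₀),
      (∀ x : sphere (0 : EuclideanSpace ℝ (Fin n)) 1,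
        h ⟨x, sphere_subset_closedBall x.2⟩ = f x) ∧ ∀ x, (h x).1.1 = g x := by
  obtain ⟨k, rfl⟩ := Nat.exists_eq_add_of_le' hn
  let E := EuclideanSpace ℝ (Fin (k + 2))
  have : Fact (Module.finrank ℝ E = (k + 1) + 1) := ⟨by simp [E]⟩
  have : Nontrivial E := Module.nontrivial_of_finrank_pos (R := ℝ) (by simp [E])
  have : PathConnectedSpace (sphere (0 : E) 1) := isPathConnected_iff_pathConnectedSpace.1
    (isPathConnected_sphere (by
      rw [← Module.finrank_eq_rank]
      have : Module.finrank ℝ E = k + 2 := by simp [E]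
      rw [this]; exact_mod_cast (by omega : 1 < k + 2)) 0 zero_le_one)
  have : LocallyPathConnectedSpace (sphere (0 : E) 1) :=
    ChartedSpace.locallyPathConnectedSpace (EuclideanSpace ℝ (Fin (k + 1))) _
  have : ContractibleSpace (closedBall (0 : E) 1) :=
    (convex_closedBall (0 : E) 1).contractibleSpace ⟨0, by simp⟩
  let inc : C(sphere (0 : E) 1, closedBall (0 : E) 1) :=
    ⟨fun x => ⟨x, sphere_subset_closedBall x.2⟩, by fun_prop⟩
  let u : C(sphere (0 : E) 1, Γ) := ⟨fun x => (f x).1.2.1, by fun_prop⟩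
  let γ : C(sphere (0 : E) 1, C(I, Y)) := ⟨fun x => (f x).1.2.2, by fun_prop⟩
  have hγ₀ : ∀ x, γ x 0 = b (u x) := fun x => (f x).2.choose
  have hγ₁ : ∀ x, γ x 1 = φ (g (inc x)) := fun x =>
    (f x).2.choose_spec.choose.trans (congrArg φ (hfg x))
  -- The paths `γ` deform `b ∘ u` into the restriction of `φ ∘ g`, which extends over the disk.
  have hnull : (b.comp u).Nullhomotopic := by
    obtain ⟨y, hy⟩ := ((id_nullhomotopic (closedBall (0 : E) 1)).comp_right (φ.comp g)).comp_left inc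
    refine ⟨y, ContinuousMap.Homotopic.trans ⟨?_⟩ hy⟩
    exact
      { toFun := fun p => γ p.2 p.1
        continuous_toFun := by fun_prop
        map_zero_left := hγ₀
        map_one_left := hγ₁ }
  obtain ⟨W, hW⟩ := hnull.exists_extend_closedBall
  obtain ⟨x₀⟩ : Nonempty (sphere (0 : E) 1) := inferInstance
  obtain ⟨e₀, he₀⟩ := hq' (u x₀)
  -- The lifting criterion has content because the sphere may be a circle. A loop pushed into `Y`
  -- contracts through the extension `W`, so it already contracts in `Γ` by injectivity of `b` on
  -- `π₁`.
  have hle : (FundamentalGroup.map u x₀).range ≤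
      (FundamentalGroup.mapOfEq ⟨q, hq.continuous⟩ he₀).range := by
    rintro _ ⟨ω, rfl⟩
    suffices FundamentalGroup.map u x₀ ω = 1 by rw [this]; exact one_mem _
    obtain ⟨ω, rfl⟩ := Path.Homotopic.Quotient.mk_surjective ω
    have h1 : (ω.map u.continuous).Homotopic (Path.refl _) := by
      obtain ⟨-, -, -, α, -⟩ := (f x₀).2
      refine homotopic_refl_of_map_homotopic_refl hinj α _ ?_
      have h2 := (SimplyConnectedSpace.paths_homotopic (ω.map inc.continuous)
        (Path.refl (inc x₀))).map W
      have h3 := h2.pathCast (hW x₀).symm (hW x₀).symm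
      have e1 : (ω.map u.continuous).map b.continuous =
          ((ω.map inc.continuous).map W.continuous).cast (hW x₀).symm (hW x₀).symm := by
        ext s
        exact (hW (ω s)).symm
      have e2 : Path.refl (b (u x₀)) =
          ((Path.refl (inc x₀)).map W.continuous).cast (hW x₀).symm (hW x₀).symm := by
        ext s
        exact (hW x₀).symm
      exact (e1 ▸ e2 ▸ h3 :)
    exact Path.Homotopic.Quotient.eq.2 h1
  obtain ⟨U₀, ⟨-, hU₀⟩, -⟩ := hq.existsUnique_continuousMap_lifts_of_range_le he₀ hle
  obtain ⟨U, hU⟩ := ((id_nullhomotopic T).comp_left U₀).exists_extend_closedBall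
  have hqU : ∀ x : sphere (0 : E) 1, q (U (inc x)) = u x := fun x => by
    have : U (inc x) = U₀ x := hU x
    rw [this]
    exact congrFun hU₀ x
  let t : C(closedBall (0 : E) 1, Γ) := ⟨fun x => q (U x), hq.continuous.comp U.continuous⟩
  obtain ⟨G, hG₀, hG₁, hG⟩ := exists_homotopy_extend_sphere (by omega) hY (b.comp t) (φ.comp g) γ
    (fun x => (hγ₀ x).trans (congrArg b (hqU x).symm)) hγ₁
  have hfx : ∀ x : sphere (0 : E) 1, (g (inc x), t (inc x), G (inc x)) = (f x).1 := by
    intro x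
    refine Prod.ext (hfg x).symm (Prod.ext (hqU x) (hG x))
  have hmem : ∀ x, (g x, t x, G x) ∈ factorSpace φ b γ₀ := by
    intro x
    let p := PathConnectedSpace.somePath (inc x₀) x
    refine mem_factorSpace_of_square (c := g (inc x₀)) (t := t (inc x₀)) (γ := G (inc x₀))
      (p.map g.continuous) (p.map t.continuous)
      ⟨fun z => G (p z.1) z.2, by fun_prop⟩ ?_ ?_ ?_ ?_ ?_
    · rw [hfx]; exact (f x₀).2
    · intro s; exact hG₀ _
    · intro s; simp
    · intro s; simp
    · intro s; exact hG₁ _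
  refine ⟨⟨fun x => ⟨_, hmem x⟩, by fun_prop⟩, fun x => Subtype.ext (hfx x), fun x => rfl⟩

theorem exists_extend_factorSpace_disk_zero [PathConnectedSpace C]
    (f : C(sphere (0 : EuclideanSpace ℝ (Fin 0)) 1, factorSpace φ b γ₀))
    (g : C(closedBall (0 : EuclideanSpace ℝ (Fin 0)) 1, C)) :
    ∃ h : C(closedBall (0 : EuclideanSpace ℝ (Fin 0)) 1, factorSpace φ b γ₀),
      (∀ x : sphere (0 : EuclideanSpace ℝ (Fin 0)) 1,
        h ⟨x, sphere_subset_closedBall x.2⟩ = f x) ∧ ∀ x, (h x).1.1 = g x := by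
  let o : closedBall (0 : EuclideanSpace ℝ (Fin 0)) 1 := ⟨0, by simp⟩
  let d := PathConnectedSpace.somePath c₀ (g o)
  have hmem : (g o, t₀, (γ₀.trans (d.map φ.continuous)).toContinuousMap) ∈ factorSpace φ b γ₀ :=
    ⟨Path.source _, Path.target _, d, Path.refl _, by
      rw [← Path.Homotopic.Quotient.eq]
      simp only [Path.Homotopic.Quotient.mk_trans]
      exact Path.Homotopic.Quotient.refl_trans (x₀ := b t₀) _⟩
  refine ⟨.const _ ⟨_, hmem⟩, fun x => ?_, fun x => ?_⟩
  · have h := mem_sphere_zero_iff_norm.1 x.2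
    rw [Subsingleton.elim x.1 0, norm_zero] at h
    exact absurd h zero_ne_one
  · exact congrArg g (Subsingleton.elim o x)

theorem hasLiftsAgainst_factorSpace [PathConnectedSpace C] {T : Type*} [TopologicalSpace T]
    [ContractibleSpace T] {q : T → Γ} (hq : IsCoveringMap q) (hq' : Function.Surjective q)
    (hinj : ∀ ω : Path t₀ t₀, (ω.map b.continuous).Homotopic (Path.refl _) →
      ω.Homotopic (Path.refl _))
    (hrange : ∀ g : Path c₀ c₀, ∃ δ : Path t₀ t₀,
      ((δ.map b.continuous).trans γ₀).Homotopic (γ₀.trans (g.map φ.continuous)))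
    (hY : ∀ n, 2 ≤ n → ∀ y : Y, Subsingleton (π_ n Y y)) (n : ℕ) :
    HasLiftsAgainst (TopCat.diskBoundaryInclusion.{u} n)
      (⟨fun z => z.1.1, by fun_prop⟩ : C(factorSpace φ b γ₀, C)) := by
  intro f g hfg
  let f' : C(sphere (0 : EuclideanSpace ℝ (Fin n)) 1, factorSpace φ b γ₀) :=
    ⟨fun x => f (ULift.up x), f.continuous.comp continuous_uliftUp⟩
  let g' : C(closedBall (0 : EuclideanSpace ℝ (Fin n)) 1, C) :=
    ⟨fun x => g (ULift.up x), g.continuous.comp continuous_uliftUp⟩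
  have hfg' : ∀ x : sphere (0 : EuclideanSpace ℝ (Fin n)) 1,
      (f' x).1.1 = g' ⟨x, sphere_subset_closedBall x.2⟩ := fun x => hfg (ULift.up x)
  obtain ⟨h, h1, h2⟩ : ∃ h : C(closedBall (0 : EuclideanSpace ℝ (Fin n)) 1, factorSpace φ b γ₀),
      (∀ x : sphere (0 : EuclideanSpace ℝ (Fin n)) 1,
        h ⟨x, sphere_subset_closedBall x.2⟩ = f' x) ∧ ∀ x, (h x).1.1 = g' x := by
    clear_value f' g'
    clear hfg f g
    rcases n with _ | _ | n
    · exact exists_extend_factorSpace_disk_zero f' g'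
    · exact exists_extend_factorSpace_disk_one hrange f' g' hfg'
    · have hn : 2 ≤ n + 1 + 1 := by omega
      exact exists_extend_factorSpace_disk_of_two_le hq hq' hinj hn (hY _ hn) f' g' hfg'
  exact ⟨⟨fun x => h x.down, h.continuous.comp continuous_uliftDown⟩, fun x => h1 x.down,
    fun x => h2 x.down⟩

end Factorization

section

universe u

/-- Lifting the identity of `C` gives a section of the homotopy pullback: its `Γ`-component is the
factor `a`, its path component the homotopy. -/
theorem TopCat.CWComplex.exists_homotopic_comp {C : TopCat.{u}} (cw : TopCat.CWComplex C)
    [PathConnectedSpace C] {Γ Y T : Type*} [TopologicalSpace Γ] [TopologicalSpace Y]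
    [TopologicalSpace T] [ContractibleSpace T] {q : T → Γ} (hq : IsCoveringMap q)
    (hq' : Function.Surjective q) (φ : C(C, Y)) (b : C(Γ, Y)) {c₀ : C} {t₀ : Γ}
    (γ₀ : Path (b t₀) (φ c₀))
    (hinj : ∀ ω : Path t₀ t₀, (ω.map b.continuous).Homotopic (Path.refl _) →
      ω.Homotopic (Path.refl _))
    (hrange : ∀ g : Path c₀ c₀, ∃ δ : Path t₀ t₀,
      ((δ.map b.continuous).trans γ₀).Homotopic (γ₀.trans (g.map φ.continuous)))
    (hY : ∀ n, 2 ≤ n → ∀ y : Y, Subsingleton (π_ n Y y)) :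
    ∃ a : C(C, Γ), φ.Homotopic (b.comp a) := by
  obtain ⟨h, hh⟩ := cw.exists_lift (hasLiftsAgainst_factorSpace hq hq' hinj hrange hY)
    (ContinuousMap.id C)
  refine ⟨⟨fun c => (h c).1.2.1, by fun_prop⟩, ContinuousMap.Homotopic.symm ⟨?_⟩⟩
  exact
    { toFun := fun p => (h p.2).1.2.2 p.1
      continuous_toFun := by fun_prop
      map_zero_left := fun c => (h c).2.choose
      map_one_left := fun c => (h c).2.choose_spec.choose.trans (congrArg φ (hh c)) }

end

/-! ### A degree argument on the torus. -/

/-- Without a zero, `F` has a continuous logarithm on the plane and so winding number zero on every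
circle. On a circle of radius larger than `M` it must wind once, like the identity. -/
theorem Complex.exists_eq_zero_of_norm_sub_le {F : ℂ → ℂ} (hF : Continuous F) {M : ℝ}
    (hM : ∀ z, ‖F z - z‖ ≤ M) : ∃ z, F z = 0 := by
  by_contra! h0
  obtain ⟨L, hL, hLF⟩ := Complex.exists_continuousOn_eqOn_exp_comp (U := Set.univ) (g := F)
    (by
      have : ContractibleSpace (Set.univ : Set ℂ) := (convex_univ).contractibleSpace ⟨0, trivial⟩
      exact SimplyConnectedSpace.ofContractible _) isOpen_univ hF.continuousOn (by simpa using h0)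
  replace hL : Continuous L := continuousOn_univ.1 hL
  replace hLF : ∀ z, Complex.exp (L z) = F z := fun z => hLF (Set.mem_univ z)
  have hM0 : 0 ≤ M := (norm_nonneg _).trans (hM 0)
  let R : ℝ := M + 1
  have hR : 0 < R := by positivity
  let c : ℝ → ℂ := fun θ => R * Complex.exp (θ * Complex.I)
  have hc : Continuous c := by fun_prop
  have hc0 : ∀ θ, c θ ≠ 0 := fun θ => mul_ne_zero (by exact_mod_cast hR.ne') (Complex.exp_ne_zero _)
  have hcn : ∀ θ, ‖c θ‖ = R := fun θ => by
    simp only [c, norm_mul, Complex.norm_exp_ofReal_mul_I, mul_one, Complex.norm_real]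
    exact abs_of_pos hR
  have hslit : ∀ θ, F (c θ) / c θ ∈ Complex.slitPlane := by
    intro θ
    refine Complex.mem_slitPlane_of_norm_lt_one (z := F (c θ) / c θ - 1) ?_ |> fun h => by
      simpa using h
    rw [div_sub_one (hc0 θ), norm_div, hcn, div_lt_one hR]
    exact (hM _).trans_lt (lt_add_one M)
  -- Since `F (c θ) / c θ` stays within distance one of `1`, the principal logarithm is continuous
  -- there. Then `exp (D θ)` is the constant `R`, so `D` moves only by multiples of `2πi`, yet it
  -- changes by `-2πi` over one turn.
  let D : ℝ → ℂ := fun θ => L (c θ) - θ * Complex.I - Complex.log (F (c θ) / c θ)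
  have hD : Continuous D := by
    refine (Continuous.sub (hL.comp hc) (by fun_prop)).sub ?_
    exact Continuous.clog ((hF.comp hc).div₀ hc hc0) hslit
  have hexp : ∀ θ, Complex.exp (D θ) = R := by
    intro θ
    have h1 := h0 (c θ)
    have h2 := hc0 θ
    simp only [D]
    rw [Complex.exp_sub, Complex.exp_sub, Complex.exp_log (div_ne_zero h1 h2), hLF]
    have h3 := Complex.exp_ne_zero (θ * Complex.I)
    have h4 : c θ = R * Complex.exp (θ * Complex.I) := rfl
    field_simp
    rw [h4, mul_comm]
  have hint : ∀ θ, ∃ k : ℤ, (D θ - D 0).im / (2 * Real.pi) = k := by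
    intro θ
    have : Complex.exp (D θ - D 0) = 1 := by
      rw [Complex.exp_sub, hexp, hexp, div_self (by exact_mod_cast hR.ne')]
    obtain ⟨k, hk⟩ := Complex.exp_eq_one_iff.1 this
    refine ⟨k, ?_⟩
    rw [hk]
    have := Real.pi_ne_zero
    simp
  have hc2 : c (2 * Real.pi) = c 0 := by
    simp only [c]
    congr 1
    push_cast
    rw [Complex.exp_two_pi_mul_I]
    simp
  have h2 : (D (2 * Real.pi) - D 0).im / (2 * Real.pi) = -1 := by
    have : D (2 * Real.pi) - D 0 = -(2 * Real.pi * Complex.I) := by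
      simp only [D, hc2]
      push_cast
      ring
    rw [this]
    have := Real.pi_ne_zero
    simp
  -- Any noninteger between `-1` and `0` serves as the intermediate value.
  obtain ⟨θ, hθ⟩ := mem_range_of_exists_le_of_exists_ge (c := (-1 / 2 : ℝ))
    (f := fun θ => (D θ - D 0).im / (2 * Real.pi)) (by fun_prop)
    ⟨2 * Real.pi, by rw [h2]; norm_num⟩ ⟨0, by simp; norm_num⟩
  obtain ⟨k, hk⟩ := hint θ
  simp only at hθ
  rw [hθ] at hk
  have h5 : (2 * k : ℤ) = -1 := by
    have : (2 * k : ℝ) = -1 := by rw [← hk]; norm_num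
    exact_mod_cast this
  omega

theorem exists_eq_of_dist_le {F : ℝ × ℝ → ℝ × ℝ} (hF : Continuous F) {M : ℝ}
    (hM : ∀ p, ‖F p - p‖ ≤ M) (q : ℝ × ℝ) : ∃ p, F p = q := by
  let e := Complex.equivRealProdCLM
  have hb : ∀ p, ‖e (e.symm (F p - q)) - p‖ ≤ M + ‖q‖ := fun p => by
    rw [e.apply_symm_apply, sub_right_comm]
    exact (norm_sub_le _ _).trans (by gcongr; exact hM p)
  obtain ⟨z, hz⟩ := Complex.exists_eq_zero_of_norm_sub_le
    (F := fun z => e.symm (F (e z) - q)) (by fun_prop)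
    (M := ‖(e.symm : ℝ × ℝ →L[ℝ] ℂ)‖ * (M + ‖q‖)) (fun z => by
      have h1 : e.symm (F (e z) - q) - z = e.symm (e (e.symm (F (e z) - q)) - e z) := by
        rw [map_sub e.symm (e _), e.symm_apply_apply, e.symm_apply_apply]
      rw [h1]
      refine ((e.symm : ℝ × ℝ →L[ℝ] ℂ).le_opNorm _).trans ?_
      gcongr
      exact hb _)
  refine ⟨e z, sub_eq_zero.1 ?_⟩
  exact e.symm.map_eq_zero_iff.1 hz

theorem exists_bound_of_periodic {A : ℝ × ℝ → ℝ} (hA : Continuous A)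
    (h1 : ∀ p : ℝ × ℝ, A (p + (1, 0)) = A p) (h2 : ∀ p : ℝ × ℝ, A (p + (0, 1)) = A p) :
    ∃ M, ∀ p, |A p| ≤ M := by
  obtain ⟨M, hM⟩ := (isCompact_Icc (a := (0 : ℝ)) (b := 1)).prod
    (isCompact_Icc (a := (0 : ℝ)) (b := 1)) |>.exists_bound_of_continuousOn hA.continuousOn
  refine ⟨M, fun p => ?_⟩
  have e1 : ∀ t, Function.Periodic (fun s => A (s, t)) 1 := fun t s => by
    simpa using h1 (s, t)
  have e2 : ∀ s, Function.Periodic (fun t => A (s, t)) 1 := fun s t => by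
    simpa using h2 (s, t)
  have hp : A p = A (Int.fract p.1, Int.fract p.2) := by
    have h3 := (e1 p.2).sub_int_mul_eq ⌊p.1⌋ (x := p.1)
    have h4 := (e2 (Int.fract p.1)).sub_int_mul_eq ⌊p.2⌋ (x := p.2)
    simp only [mul_one] at h3 h4
    simp only [Int.fract] at h4 ⊢
    rw [h4, h3]
  rw [hp]
  exact hM _ ⟨⟨Int.fract_nonneg _, (Int.fract_lt_one _).le⟩,
    ⟨Int.fract_nonneg _, (Int.fract_lt_one _).le⟩⟩

/-- The cut-off `r` vanishes on the open complement of `K`, so the values of `u` outside `V` do not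
matter. -/
theorem continuous_mul_of_continuousOn {Z : Type*} [TopologicalSpace Z] {V K : Set Z}
    (hV : IsOpen V) (hK : IsClosed K) (hKV : K ⊆ V) {r u : Z → ℝ} (hr : Continuous r)
    (hr0 : ∀ z ∉ K, r z = 0) (hu : ContinuousOn u V) : Continuous fun z => r z * u z := by
  rw [continuous_iff_continuousAt]
  intro z
  by_cases hz : z ∈ K
  · exact hr.continuousAt.mul (hu.continuousAt (hV.mem_nhds (hKV hz)))
  · refine (continuousAt_const (y := (0 : ℝ))).congr ?_
    filter_upwards [hK.isOpen_compl.mem_nhds hz] with w hw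
    rw [hr0 w hw, zero_mul]

/-- The torus is not covered by two open sets such that the first generator of the first cohomology
vanishes on one and the second generator vanishes on the other. -/
theorem false_of_equivariant_cover {V₀ V₁ : Set (ℝ × ℝ)} (ho₀ : IsOpen V₀) (ho₁ : IsOpen V₁)
    (hcov : ∀ p, p ∈ V₀ ∨ p ∈ V₁)
    (hV₀ : ∀ p, p + (1, 0) ∈ V₀ ↔ p ∈ V₀) (hV₀' : ∀ p, p + (0, 1) ∈ V₀ ↔ p ∈ V₀)
    (hV₁ : ∀ p, p + (1, 0) ∈ V₁ ↔ p ∈ V₁) (hV₁' : ∀ p, p + (0, 1) ∈ V₁ ↔ p ∈ V₁)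
    {n₀ n₁ : ℝ × ℝ → ℤ} (hn₀ : ContinuousOn n₀ V₀) (hn₁ : ContinuousOn n₁ V₁)
    (h₀ : ∀ p ∈ V₀, n₀ (p + (1, 0)) = n₀ p + 1) (h₀' : ∀ p ∈ V₀, n₀ (p + (0, 1)) = n₀ p)
    (h₁ : ∀ p ∈ V₁, n₁ (p + (1, 0)) = n₁ p) (h₁' : ∀ p ∈ V₁, n₁ (p + (0, 1)) = n₁ p + 1) :
    False := by
  -- Neither set is the whole plane, since a continuous integer function there is constant. This
  -- matters because `Metric.infDist` to the empty set is zero, which would spoil `hpos`.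
  have huniv : ∀ {V : Set (ℝ × ℝ)} {n : ℝ × ℝ → ℤ}, ContinuousOn n V →
      (∃ v, ∀ p ∈ V, n (p + v) = n p + 1) → (Vᶜ).Nonempty := by
    rintro V n hn ⟨v, hv⟩
    rw [Set.nonempty_compl]
    rintro rfl
    have := isPreconnected_univ.constant hn (Set.mem_univ v) (Set.mem_univ 0)
    have h := hv 0 trivial
    rw [zero_add] at h
    omega
  have hc₀ := huniv hn₀ ⟨_, h₀⟩
  have hc₁ := huniv hn₁ ⟨_, h₁'⟩
  have hinf : ∀ {V : Set (ℝ × ℝ)} {v : ℝ × ℝ}, (∀ p, p + v ∈ V ↔ p ∈ V) → ∀ p,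
      Metric.infDist (p + v) Vᶜ = Metric.infDist p Vᶜ := by
    intro V v hv p
    have h : (· + v) '' Vᶜ = Vᶜ := by
      ext z
      simp only [Set.mem_image, Set.mem_compl_iff]
      constructor
      · rintro ⟨y, hy, rfl⟩
        rwa [hv]
      · intro hz
        exact ⟨z - v, by rwa [← hv, sub_add_cancel], sub_add_cancel _ _⟩
    conv_lhs => rw [← h]
    exact Metric.infDist_image (isometry_add_right v)
  have hpos : ∀ {V : Set (ℝ × ℝ)}, IsOpen V → (Vᶜ).Nonempty → ∀ p, 0 < Metric.infDist p Vᶜ ↔ p ∈ V := by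
    intro V hV hc p
    rw [← hV.isClosed_compl.notMem_iff_infDist_pos hc, Set.notMem_compl_iff]
  let δ₀ : ℝ × ℝ → ℝ := fun p => Metric.infDist p V₀ᶜ
  let δ₁ : ℝ × ℝ → ℝ := fun p => Metric.infDist p V₁ᶜ
  have hδ₀ : Continuous δ₀ := Metric.continuous_infDist_pt _
  have hδ₁ : Continuous δ₁ := Metric.continuous_infDist_pt _
  have hsum : ∀ p, 0 < δ₀ p + δ₁ p := fun p => by
    rcases hcov p with h | h
    · exact add_pos_of_pos_of_nonneg ((hpos ho₀ hc₀ p).2 h) Metric.infDist_nonneg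
    · exact add_pos_of_nonneg_of_pos Metric.infDist_nonneg ((hpos ho₁ hc₁ p).2 h)
  let x : ℝ × ℝ → ℝ := fun p => δ₀ p / (δ₀ p + δ₁ p)
  have hx : Continuous x := hδ₀.div₀ (hδ₀.add hδ₁) fun p => (hsum p).ne'
  -- Both cut-offs equal `1` at `x = 1/2`, so at every point at least one of them is `1`; the
  -- thresholds `1/4` and `3/4` keep the closed sets outside which they vanish inside `V₀` and `V₁`.
  let r₀ : ℝ × ℝ → ℝ := fun p => max 0 (min 1 (4 * x p - 1))
  let r₁ : ℝ × ℝ → ℝ := fun p => max 0 (min 1 (3 - 4 * x p))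
  have hr₀ : Continuous r₀ := by fun_prop
  have hr₁ : Continuous r₁ := by fun_prop
  -- On `V₀` the function `p.1 - n₀ p` is doubly periodic, and likewise `p.2 - n₁ p` on `V₁`; after
  -- cutting off, both are periodic on the plane and hence bounded.
  let A₀ : ℝ × ℝ → ℝ := fun p => r₀ p * (p.1 - n₀ p)
  let A₁ : ℝ × ℝ → ℝ := fun p => r₁ p * (p.2 - n₁ p)
  have hz₀ : ∀ p, ¬ 1 / 4 ≤ x p → r₀ p = 0 := fun p h => by
    refine max_eq_left ((min_le_right _ _).trans ?_)
    linarith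
  have hz₁ : ∀ p, ¬ x p ≤ 3 / 4 → r₁ p = 0 := fun p h => by
    refine max_eq_left ((min_le_right _ _).trans ?_)
    linarith
  have hs₀ : ∀ p, 1 / 4 ≤ x p → p ∈ V₀ := fun p h => by
    rw [← hpos ho₀ hc₀]
    have h2 : 0 < x p := by linarith
    exact (div_pos_iff_of_pos_right (hsum p)).1 h2
  have hs₁ : ∀ p, x p ≤ 3 / 4 → p ∈ V₁ := fun p h => by
    rw [← hpos ho₁ hc₁]
    have h2 : δ₀ p < δ₀ p + δ₁ p := by
      have := (div_le_iff₀ (hsum p)).1 h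
      have := hsum p
      linarith
    exact pos_of_lt_add_right h2
  have hA₀ : Continuous A₀ := by
    refine continuous_mul_of_continuousOn ho₀ (isClosed_le continuous_const hx) hs₀ hr₀ hz₀ ?_
    exact continuousOn_fst.sub (continuous_of_discreteTopology.comp_continuousOn hn₀)
  have hA₁ : Continuous A₁ := by
    refine continuous_mul_of_continuousOn ho₁ (isClosed_le hx continuous_const) hs₁ hr₁ hz₁ ?_
    exact continuousOn_snd.sub (continuous_of_discreteTopology.comp_continuousOn hn₁)
  have hx1 : ∀ p, x (p + (1, 0)) = x p := fun p => by
    simp only [x, δ₀, δ₁, hinf hV₀, hinf hV₁]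
  have hx2 : ∀ p, x (p + (0, 1)) = x p := fun p => by
    simp only [x, δ₀, δ₁, hinf hV₀', hinf hV₁']
  have hP₀ : ∀ {v : ℝ × ℝ}, (∀ p, x (p + v) = x p) → (∀ p ∈ V₀, (p + v).1 - n₀ (p + v) = p.1 - n₀ p) →
      ∀ p, A₀ (p + v) = A₀ p := by
    intro v hv hv' p
    have h : r₀ (p + v) = r₀ p := by simp only [r₀, hv]
    by_cases hp : 1 / 4 ≤ x p
    · simp only [A₀, h, hv' p (hs₀ p hp)]
    · simp only [A₀, h, hz₀ p hp, zero_mul]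
  have hP₁ : ∀ {v : ℝ × ℝ}, (∀ p, x (p + v) = x p) → (∀ p ∈ V₁, (p + v).2 - n₁ (p + v) = p.2 - n₁ p) →
      ∀ p, A₁ (p + v) = A₁ p := by
    intro v hv hv' p
    have h : r₁ (p + v) = r₁ p := by simp only [r₁, hv]
    by_cases hp : x p ≤ 3 / 4
    · simp only [A₁, h, hv' p (hs₁ p hp)]
    · simp only [A₁, h, hz₁ p hp, zero_mul]
  obtain ⟨M₀, hM₀⟩ := exists_bound_of_periodic hA₀
    (hP₀ hx1 fun p hp => by rw [h₀ p hp]; simp)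
    (hP₀ hx2 fun p hp => by rw [h₀' p hp]; simp)
  obtain ⟨M₁, hM₁⟩ := exists_bound_of_periodic hA₁
    (hP₁ hx1 fun p hp => by rw [h₁ p hp]; simp)
    (hP₁ hx2 fun p hp => by rw [h₁' p hp]; simp)
  -- A bounded perturbation of the identity is surjective. But where `r₀ = 1` the first coordinate
  -- of this map is the integer `n₀ p`, and where `r₁ = 1` the second is `n₁ p`, so `(1/2, 1/2)`
  -- cannot be attained.
  obtain ⟨p, hp⟩ := exists_eq_of_dist_le (F := fun p => (p.1 - A₀ p, p.2 - A₁ p)) (by fun_prop)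
    (M := max M₀ M₁) (fun p => by
      rw [Prod.norm_def]
      refine max_le_max ?_ ?_
      · simpa using hM₀ p
      · simpa using hM₁ p) (1 / 2, 1 / 2)
  rw [Prod.mk.injEq] at hp
  have hhalf : ∀ k : ℤ, (k : ℝ) ≠ 1 / 2 := fun k hk => by
    have : (2 * k : ℤ) = 1 := by
      have : (2 * k : ℝ) = 1 := by rw [hk]; norm_num
      exact_mod_cast this
    omega
  rcases le_total (1 / 2) (x p) with h | h
  · have : r₀ p = 1 := by
      simp only [r₀]
      rw [min_eq_left (by linarith), max_eq_right zero_le_one]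
    refine hhalf (n₀ p) ?_
    rw [← hp.1]
    simp [A₀, this]
  · have : r₁ p = 1 := by
      simp only [r₁]
      rw [min_eq_left (by linarith), max_eq_right zero_le_one]
    refine hhalf (n₁ p) ?_
    rw [← hp.2]
    simp [A₁, this]

/-! ### Monodromy of motion planners along two loops. -/

section PeriodicExtension

variable {X : Type*} [TopologicalSpace X] {x : X}

/-- The `1`-periodic map `ℝ → X` given by a loop. -/
noncomputable def Path.periodicExtend (p : Path x x) : C(ℝ, X) :=
  ⟨fun s => p.extend (Int.fract s), by
    refine ContinuousOn.comp_fract'' (f := p.extend) p.continuous_extend.continuousOn ?_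
    rw [p.extend_zero, p.extend_one]⟩

theorem Path.periodicExtend_add_one (p : Path x x) (s : ℝ) :
    p.periodicExtend (s + 1) = p.periodicExtend s := by
  simp [Path.periodicExtend]

theorem Path.periodicExtend_zero (p : Path x x) : p.periodicExtend 0 = x := by
  simp [Path.periodicExtend]

theorem Path.periodicExtend_coe (p : Path x x) (s : I) : p.periodicExtend s = p s := by
  rcases eq_or_ne s 1 with rfl | h
  · have := p.periodicExtend_add_one 0
    rw [zero_add, p.periodicExtend_zero] at this
    simpa using this
  · have h1 : (s : ℝ) < 1 := lt_of_le_of_ne s.2.2 fun h' => h (Subtype.ext h')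
    simp only [Path.periodicExtend, ContinuousMap.coe_mk]
    rw [Int.fract_eq_self.2 ⟨s.2.1, h1⟩, p.extend_apply s.2]

/-- The path along the periodic extension of a loop from its base point. -/
noncomputable def Path.periodicSegment (p : Path x x) (a : ℝ) : Path x (p.periodicExtend a) :=
  ((⟨⟨fun s : I => s * a, by fun_prop⟩, by simp, by simp⟩ : Path (0 : ℝ) a).map
    p.periodicExtend.continuous).cast p.periodicExtend_zero.symm rfl

theorem Path.periodicSegment_homotopic_trans (p : Path x x) {a b : ℝ} (e : Path a b) :
    (p.periodicSegment b).Homotopic ((p.periodicSegment a).trans (e.map p.periodicExtend.continuous)) := by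
  let l : ∀ a : ℝ, Path (0 : ℝ) a := fun a => ⟨⟨fun s : I => s * a, by fun_prop⟩, by simp, by simp⟩
  have h := ((SimplyConnectedSpace.paths_homotopic (l b) ((l a).trans e)).map
    p.periodicExtend).pathCast p.periodicExtend_zero.symm rfl
  rw [Path.map_trans] at h
  exact h

theorem Path.periodicSegment_add_one (p : Path x x) (a : ℝ) :
    (p.periodicSegment (a + 1)).Homotopic
      ((p.trans (p.periodicSegment a)).cast rfl (p.periodicExtend_add_one a)) := by
  let l : ∀ a : ℝ, Path (0 : ℝ) a := fun a => ⟨⟨fun s : I => s * a, by fun_prop⟩, by simp, by simp⟩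
  let l' : Path (1 : ℝ) (a + 1) := ⟨⟨fun s : I => s * a + 1, by fun_prop⟩, by simp, by simp⟩
  have h := ((SimplyConnectedSpace.paths_homotopic (l (a + 1)) ((l 1).trans l')).map
    p.periodicExtend).pathCast p.periodicExtend_zero.symm rfl
  rw [Path.map_trans] at h
  have h2 : (((l 1).map p.periodicExtend.continuous).trans
      (l'.map p.periodicExtend.continuous)).cast p.periodicExtend_zero.symm rfl =
      (p.trans (p.periodicSegment a)).cast rfl (p.periodicExtend_add_one a) := by
    ext s
    simp only [Path.cast_coe, Path.trans_apply]
    split_ifs with h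
    · simp only [Path.map_coe, Function.comp_apply, l, Path.coe_mk_mk, mul_one]
      rw [← p.periodicExtend_coe]
    · simp only [Path.map_coe, Function.comp_apply, l', Path.coe_mk_mk]
      rw [p.periodicExtend_add_one]
      rfl
  rw [h2] at h
  exact h

end PeriodicExtension

theorem Path.Homotopic.conj_cast {Y : Type*} [TopologicalSpace Y] {y₀ z₀ y₁ y₂ z₁ z₂ : Y}
    (e : y₁ = y₂) (e' : z₁ = z₂) {p : Path y₀ y₁} {q : Path y₀ y₂} {u₁ : Path y₁ z₁}
    {u₂ : Path y₂ z₂} {r : Path z₀ z₁} {r' : Path z₀ z₂} (hp : p.Homotopic (q.cast rfl e))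
    (hu : u₁ = u₂.cast e e') (hr : r.Homotopic (r'.cast rfl e')) :
    ((p.trans u₁).trans r.symm).Homotopic ((q.trans u₂).trans r'.symm) := by
  subst e e' hu
  exact (hp.hcomp (.refl _)).hcomp hr.symm₂

theorem Path.Homotopic.Quotient.conj_eq {Y : Type*} [TopologicalSpace Y] {y₀ z₀ y₁ y₂ z₁ z₂ : Y}
    {p : Path.Homotopic.Quotient y₀ y₁} {q : Path.Homotopic.Quotient y₁ y₂}
    {u₁ : Path.Homotopic.Quotient y₁ z₁} {u₂ : Path.Homotopic.Quotient y₂ z₂}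
    {r : Path.Homotopic.Quotient z₀ z₁} {t : Path.Homotopic.Quotient z₁ z₂}
    (h : q.trans u₂ = u₁.trans t) :
    ((p.trans q).trans u₂).trans (r.trans t).symm = (p.trans u₁).trans r.symm := by
  have h1 : t.trans (r.trans t).symm = r.symm := by
    calc t.trans (r.trans t).symm = ((r.symm.trans r).trans t).trans (r.trans t).symm := by
          rw [symm_trans, refl_trans]
      _ = r.symm := by rw [trans_assoc r.symm, trans_assoc r.symm, trans_symm, trans_refl]
  rw [trans_assoc p, h, ← trans_assoc p, trans_assoc _ t, h1]

section Monodromy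

variable {X Y : Type*} [TopologicalSpace X] [TopologicalSpace Y] {φ : C(X, Y)} {x : X}

/-- The value `h z` is the class of the loop that follows `p` to its point at time `z.1`, then the
planned path, then `p'` backwards. A full extra turn of `p` or `p'` inserts a factor at the
corresponding end. -/
theorem exists_monodromy (p p' : Path x x) {U : Set (X × X)} (hU : IsOpen U)
    {s : C(U, C(I, Y))} (hs : IsMotionPlanner φ U s) :
    ∃ h : ℝ × ℝ → Path.Homotopic.Quotient (φ x) (φ x),
      (∀ z : ℝ × ℝ, (p.periodicExtend z.1, p'.periodicExtend z.2) ∈ U →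
        ∀ᶠ w in 𝓝 z, h w = h z) ∧
      (∀ z : ℝ × ℝ, (p.periodicExtend z.1, p'.periodicExtend z.2) ∈ U →
        h (z + (1, 0)) = Path.Homotopic.Quotient.trans (.mk (p.map φ.continuous)) (h z)) ∧
      ∀ z : ℝ × ℝ, (p.periodicExtend z.1, p'.periodicExtend z.2) ∈ U →
        h (z + (0, 1)) = (h z).trans (Path.Homotopic.Quotient.mk (p'.map φ.continuous)).symm := by
  classical
  let V : Set (ℝ × ℝ) := {z | (p.periodicExtend z.1, p'.periodicExtend z.2) ∈ U}
  have hV : IsOpen V := hU.preimage (by fun_prop)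
  let P : ∀ z ∈ V, Path (φ (p.periodicExtend z.1)) (φ (p'.periodicExtend z.2)) := fun z hz =>
    ⟨s ⟨_, hz⟩, (hs ⟨_, hz⟩).1, (hs ⟨_, hz⟩).2⟩
  let R : ∀ z ∈ V, Path (φ x) (φ x) := fun z hz =>
    (((p.periodicSegment z.1).map φ.continuous).trans (P z hz)).trans
      ((p'.periodicSegment z.2).map φ.continuous).symm
  -- The value outside `V` is arbitrary.
  let h : ℝ × ℝ → Path.Homotopic.Quotient (φ x) (φ x) := fun z =>
    if hz : z ∈ V then .mk (R z hz) else .refl _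
  have hh : ∀ z hz, h z = .mk (R z hz) := fun z hz => dif_pos hz
  refine ⟨h, ?_, ?_, ?_⟩
  · intro z hz
    obtain ⟨ε, hε, hball⟩ := Metric.isOpen_iff.1 hV z hz
    filter_upwards [Metric.ball_mem_nhds z hε] with w hw
    let e : Path z w := Path.segment z w
    have he : ∀ r, e r ∈ V := by
      intro r
      refine hball ((convex_ball z ε).segment_subset (Metric.mem_ball_self hε) hw ?_)
      rw [← Path.range_segment]
      exact ⟨r, rfl⟩
    rw [hh w (hball hw), hh z hz]
    -- The planner over the segment from `z` to `w` is a square whose boundary relation is exactly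
    -- what makes the two loops homotopic.
    let F : C(I × I, Y) := ⟨fun q => s ⟨_, he q.1⟩ q.2, by fun_prop⟩
    have hsq : (((e.map continuous_fst).map p.periodicExtend.continuous |>.map φ.continuous).trans
        (P w (hball hw))).Homotopic ((P z hz).trans
          ((e.map continuous_snd).map p'.periodicExtend.continuous |>.map φ.continuous)) := by
      refine Path.homotopic_of_square F _ _ _ _ ?_ ?_ ?_ ?_
      · intro r
        exact (hs ⟨_, he r⟩).1
      · intro r
        simp only [F, ContinuousMap.coe_mk, P, e.target]
        rfl
      · intro r
        simp only [F, ContinuousMap.coe_mk, P, e.source]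
        rfl
      · intro r
        exact (hs ⟨_, he r⟩).2
    have h1 := (p.periodicSegment_homotopic_trans (e.map continuous_fst)).map φ
    have h2 := (p'.periodicSegment_homotopic_trans (e.map continuous_snd)).map φ
    rw [Path.map_trans] at h1 h2
    rw [← Path.Homotopic.Quotient.eq] at h1 h2 hsq
    simp only [R, Path.Homotopic.Quotient.mk_trans, Path.Homotopic.Quotient.mk_symm] at *
    rw [h1, h2]
    exact Path.Homotopic.Quotient.conj_eq hsq
  · rintro ⟨a, b⟩ hz
    have ez : ((a, b) : ℝ × ℝ) + (1, 0) = (a + 1, b) := by simp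
    have hz' : (a + 1, b) ∈ V := by
      simpa [V, p.periodicExtend_add_one] using hz
    rw [ez, hh _ hz', hh _ hz, ← Path.Homotopic.Quotient.mk_trans, Path.Homotopic.Quotient.eq]
    have h1 : ((p.periodicSegment (a + 1)).map φ.continuous).Homotopic
        (((p.map φ.continuous).trans ((p.periodicSegment a).map φ.continuous)).cast rfl
          (congrArg φ (p.periodicExtend_add_one a))) := by
      rw [← Path.map_trans]
      exact (p.periodicSegment_add_one a).map φ
    refine (Path.Homotopic.conj_cast (congrArg φ (p.periodicExtend_add_one a)) rfl h1
      (u₂ := P _ hz) (r' := (p'.periodicSegment b).map φ.continuous) ?_ (.refl _)).trans ?_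
    · ext r
      simp only [P, Path.cast_coe, p.periodicExtend_add_one]
      rfl
    · rw [← Path.Homotopic.Quotient.eq]
      simp only [R, Path.Homotopic.Quotient.mk_trans, Path.Homotopic.Quotient.trans_assoc]
  · rintro ⟨a, b⟩ hz
    have ez : ((a, b) : ℝ × ℝ) + (0, 1) = (a, b + 1) := by simp
    have hz' : (a, b + 1) ∈ V := by
      simpa [V, p'.periodicExtend_add_one] using hz
    rw [ez, hh _ hz', hh _ hz, ← Path.Homotopic.Quotient.mk_symm,
      ← Path.Homotopic.Quotient.mk_trans, Path.Homotopic.Quotient.eq]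
    have h1 : ((p'.periodicSegment (b + 1)).map φ.continuous).Homotopic
        (((p'.map φ.continuous).trans ((p'.periodicSegment b).map φ.continuous)).cast rfl
          (congrArg φ (p'.periodicExtend_add_one b))) := by
      rw [← Path.map_trans]
      exact (p'.periodicSegment_add_one b).map φ
    refine (Path.Homotopic.conj_cast rfl (congrArg φ (p'.periodicExtend_add_one b)) (.refl _)
      (u₂ := P _ hz) (q := (p.periodicSegment a).map φ.continuous) ?_ h1).trans ?_
    · ext r
      simp only [P, Path.cast_coe, p'.periodicExtend_add_one]
      rfl
    · rw [← Path.Homotopic.Quotient.eq]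
      simp only [R, Path.trans_symm, Path.Homotopic.Quotient.mk_trans,
        Path.Homotopic.Quotient.trans_assoc]

end Monodromy

/-! ### Lower bounds from monodromy. -/

section LowerBounds

variable {X Y : Type*} [TopologicalSpace X] [TopologicalSpace Y] {φ : C(X, Y)} {x : X}

theorem FundamentalGroup.map_mk (p : Path x x) :
    FundamentalGroup.map φ x (Path.Homotopic.Quotient.mk p) =
      Path.Homotopic.Quotient.mk (p.map φ.continuous) := rfl

/-- Multiplication in `FundamentalGroup` is concatenation in the reverse order, so turns of the
first loop act on the right. The maps `c` and `c'` are chosen before `U`, so that all the sets of a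
cover are pulled back to the same plane. -/
theorem exists_group_monodromy (γ γ' : FundamentalGroup X x) :
    ∃ c c' : C(ℝ, X), (∀ s, c (s + 1) = c s) ∧ (∀ s, c' (s + 1) = c' s) ∧
    ∀ {U : Set (X × X)} (_ : IsOpen U) {s : C(U, C(I, Y))} (_ : IsMotionPlanner φ U s),
    ∃ h : ℝ × ℝ → FundamentalGroup Y (φ x),
      (∀ z : ℝ × ℝ, (c z.1, c' z.2) ∈ U → ∀ᶠ w in 𝓝 z, h w = h z) ∧
      (∀ z : ℝ × ℝ, (c z.1, c' z.2) ∈ U → h (z + (1, 0)) = h z * FundamentalGroup.map φ x γ) ∧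
      ∀ z : ℝ × ℝ, (c z.1, c' z.2) ∈ U →
        h (z + (0, 1)) = (FundamentalGroup.map φ x γ')⁻¹ * h z := by
  obtain ⟨p, rfl⟩ := Path.Homotopic.Quotient.mk_surjective γ
  obtain ⟨p', rfl⟩ := Path.Homotopic.Quotient.mk_surjective γ'
  refine ⟨p.periodicExtend, p'.periodicExtend, p.periodicExtend_add_one,
    p'.periodicExtend_add_one, fun hU s hs => exists_monodromy p p' hU hs⟩

theorem map_eq_one_of_hasMotionPlanning_zero (hφ : HasMotionPlanning φ 0)
    (γ : FundamentalGroup X x) : FundamentalGroup.map φ x γ = 1 := by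
  obtain ⟨U, hU, hcov, hs⟩ := hφ
  obtain ⟨s, hs⟩ := hs 0
  obtain ⟨c, c', -, -, H⟩ := exists_group_monodromy (φ := φ) γ γ
  obtain ⟨h, h1, h2, -⟩ := H (hU 0) hs
  have hmem : ∀ z : X × X, z ∈ U 0 := fun z => by
    obtain ⟨i, hi⟩ := Set.mem_iUnion.1 (hcov.symm ▸ Set.mem_univ z : z ∈ ⋃ i, U i)
    rwa [show i = 0 from Subsingleton.elim (α := Fin 1) i 0] at hi
  have hloc : IsLocallyConstant h :=
    (IsLocallyConstant.iff_eventually_eq h).2 fun z => h1 z (hmem _)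
  have h3 := h2 0 (hmem _)
  rw [hloc.apply_eq_of_preconnectedSpace (0 + (1, 0)) 0] at h3
  exact (mul_eq_left.1 h3.symm)

/-- The hypothesis says that `ℤ × ℤ` acts freely by `h ↦ b ^ (-j) * h * a ^ i`. Choosing a
representative of each orbit, the exponents leading to an element are unique and give its
coordinates. -/
theorem exists_equivariant {G : Type*} [Group G] {a b : G}
    (H : ∀ (h : G) (i j : ℤ), h * a ^ i = b ^ j * h → i = 0 ∧ j = 0) :
    ∃ n : G → ℤ × ℤ, (∀ h, n (h * a) = n h + (1, 0)) ∧ ∀ h, n (b⁻¹ * h) = n h + (0, 1) := by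
  let S : Setoid G :=
    { r := fun g h => ∃ i j : ℤ, h = b ^ (-j) * g * a ^ i
      iseqv :=
        { refl := fun g => ⟨0, 0, by simp⟩
          symm := by
            rintro g h ⟨i, j, rfl⟩
            exact ⟨-i, -j, by group⟩
          trans := by
            rintro g h k ⟨i, j, rfl⟩ ⟨i', j', rfl⟩
            exact ⟨i + i', j + j', by group⟩ } }
  have hr : ∀ g, ∃ i j : ℤ, g = b ^ (-j) * (Quotient.mk S g).out * a ^ i := fun g =>
    Quotient.exact (s := S) (Quotient.out_eq (Quotient.mk S g))
  have huniq : ∀ (r : G) (i j i' j' : ℤ), b ^ (-j) * r * a ^ i = b ^ (-j') * r * a ^ i' →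
      (i, j) = (i', j') := by
    intro r i j i' j' h
    have h2 : r * a ^ (i - i') = b ^ (j - j') * r := by
      calc r * a ^ (i - i') = b ^ j * (b ^ (-j) * r * a ^ i) * a ^ (-i') := by group
        _ = b ^ j * (b ^ (-j') * r * a ^ i') * a ^ (-i') := by rw [h]
        _ = _ := by group
    obtain ⟨h3, h4⟩ := H r _ _ h2
    rw [sub_eq_zero.1 h3, sub_eq_zero.1 h4]
  choose i j hij using hr
  refine ⟨fun g => (i g, j g), fun h => ?_, fun h => ?_⟩
  · have e : Quotient.mk S (h * a) = Quotient.mk S h :=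
      (Quotient.sound (s := S) ⟨1, 0, by simp⟩ : Quotient.mk S h = _).symm
    have h1 := hij (h * a)
    rw [e] at h1
    rw [Prod.mk_add_mk, add_zero]
    refine huniq (Quotient.mk S h).out _ _ _ _ ?_
    rw [← h1, zpow_add, zpow_one, ← mul_assoc, ← hij h]
  · have e : Quotient.mk S (b⁻¹ * h) = Quotient.mk S h :=
      (Quotient.sound (s := S) ⟨0, 1, by simp⟩ : Quotient.mk S h = _).symm
    have h1 := hij (b⁻¹ * h)
    rw [e] at h1
    rw [Prod.mk_add_mk, add_zero]
    refine huniq (Quotient.mk S h).out _ _ _ _ ?_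
    rw [← h1]
    conv_lhs => rw [hij h]
    group

/-- Over the first set the first coordinate of the equivariant map is kept, over the second set the
second; each trivializes one of the two generators of the cohomology of the torus. -/
theorem not_hasMotionPlanning_one {γ γ' : FundamentalGroup X x}
    (H : ∀ (h : FundamentalGroup Y (φ x)) (i j : ℤ),
      h * FundamentalGroup.map φ x γ ^ i = FundamentalGroup.map φ x γ' ^ j * h → i = 0 ∧ j = 0) :
    ¬ HasMotionPlanning φ 1 := by
  rintro ⟨U, hU, hcov, hs⟩
  obtain ⟨s₀, hs₀⟩ := hs 0
  obtain ⟨s₁, hs₁⟩ := hs 1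
  obtain ⟨c, c', hc, hc', K⟩ := exists_group_monodromy (φ := φ) γ γ'
  obtain ⟨h₀, h1, h2, h3⟩ := K (hU 0) hs₀
  obtain ⟨h₁, h1', h2', h3'⟩ := K (hU 1) hs₁
  obtain ⟨n, hna, hnb⟩ := exists_equivariant H
  let V : Fin 2 → Set (ℝ × ℝ) := fun k => {z | (c z.1, c' z.2) ∈ U k}
  have hV : ∀ k, IsOpen (V k) := fun k => (hU k).preimage (by fun_prop)
  have hV1 : ∀ k p, p + (1, 0) ∈ V k ↔ p ∈ V k := fun k p => by simp [V, hc]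
  have hV2 : ∀ k p, p + (0, 1) ∈ V k ↔ p ∈ V k := fun k p => by simp [V, hc']
  refine false_of_equivariant_cover (n₀ := fun z => (n (h₀ z)).1) (n₁ := fun z => (n (h₁ z)).2)
    (hV 0) (hV 1) ?_ (hV1 0) (hV2 0) (hV1 1) (hV2 1) ?_ ?_ ?_ ?_ ?_ ?_
  · intro p
    obtain ⟨i, hi⟩ := Set.mem_iUnion.1
      (hcov.symm ▸ Set.mem_univ (c p.1, c' p.2) : (c p.1, c' p.2) ∈ ⋃ i, U i)
    fin_cases i
    · exact Or.inl hi
    · exact Or.inr hi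
  · intro z hz
    refine ContinuousAt.continuousWithinAt (continuousAt_const.congr (f := fun _ => (n (h₀ z)).1) ?_)
    filter_upwards [h1 z hz] with w hw
    rw [hw]
  · intro z hz
    refine ContinuousAt.continuousWithinAt (continuousAt_const.congr (f := fun _ => (n (h₁ z)).2) ?_)
    filter_upwards [h1' z hz] with w hw
    rw [hw]
  · intro p hp
    simp only [h2 p hp, hna, Prod.fst_add]
  · intro p hp
    simp only [h3 p hp, hnb, Prod.fst_add, add_zero]
  · intro p hp
    simp only [h2' p hp, hna, Prod.snd_add, add_zero]
  · intro p hp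
    simp only [h3' p hp, hnb, Prod.snd_add]

end LowerBounds

/-! ### A faithful matrix representation of free groups. -/

section FreeGroupRep

open Polynomial Matrix

/-- The nilpotent rank one matrix with kernel and image spanned by `(1, i)`. -/
def slopeMatrix (i : ℕ) : Matrix (Fin 2) (Fin 2) ℚ := vecMulVec ![1, (i : ℚ)] ![-(i : ℚ), 1]

theorem slopeMatrix_mul_vecMulVec (i j : ℕ) (c : Fin 2 → ℚ) :
    slopeMatrix i * vecMulVec ![1, (j : ℚ)] c = vecMulVec ![1, (i : ℚ)] (((j : ℚ) - i) • c) := by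
  rw [slopeMatrix, vecMulVec_mul_vecMulVec]
  congr 2
  simp [dotProduct, Fin.sum_univ_two]
  ring

theorem slopeMatrix_mul_self (i : ℕ) : slopeMatrix i * slopeMatrix i = 0 := by
  conv_lhs => rhs; rw [slopeMatrix]
  rw [slopeMatrix_mul_vecMulVec, sub_self, zero_smul, vecMulVec_zero]

/-- The one-parameter group `k ↦ 1 + k N X` of polynomials over the matrix ring, for the matrix `N`
given by `slopeMatrix`. -/
noncomputable def slopeHom (i : ℕ) :
    Multiplicative ℤ →* (Matrix (Fin 2) (Fin 2) ℚ)[X]ˣ :=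
  MonoidHom.toHomUnits
    { toFun := fun k => 1 + C ((k.toAdd : ℤ) • slopeMatrix i) * X
      map_one' := by simp
      map_mul' := fun k l => by
        have h : C (k.toAdd • slopeMatrix i) * X * (C (l.toAdd • slopeMatrix i) * X) = 0 := by
          rw [← mul_assoc, mul_assoc (C _) X, Polynomial.X_mul_C, ← mul_assoc, ← C_mul,
            smul_mul_smul_comm, slopeMatrix_mul_self, smul_zero, C_0, zero_mul, zero_mul]
        rw [add_mul, mul_add, mul_add, h, toAdd_mul, add_smul, C_add]
        simp only [one_mul, mul_one]
        rw [add_mul]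
        abel }

theorem coe_slopeHom (i : ℕ) (k : Multiplicative ℤ) :
    (slopeHom i k : (Matrix (Fin 2) (Fin 2) ℚ)[X]) = 1 + C ((k.toAdd : ℤ) • slopeMatrix i) * X :=
  rfl

/-- The polynomials whose leading coefficient has image spanned by `(1, i)`. -/
def slopeSet (i : ℕ) : Set (Matrix (Fin 2) (Fin 2) ℚ)[X] :=
  {p | ∃ c : Fin 2 → ℚ, c ≠ 0 ∧ p.leadingCoeff = vecMulVec ![1, (i : ℚ)] c}

theorem slopeSet_disjoint {i j : ℕ} (hij : i ≠ j) : Disjoint (slopeSet i) (slopeSet j) := by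
  rw [Set.disjoint_left]
  rintro p ⟨c, hc, h⟩ ⟨c', -, h'⟩
  rw [h] at h'
  apply hc
  ext k
  have h0 := congrFun (congrFun h' 0) k
  have h1 := congrFun (congrFun h' 1) k
  simp only [vecMulVec_apply, cons_val_zero, cons_val_one, one_mul] at h0 h1
  rw [← h0, ← sub_eq_zero, ← sub_mul, mul_eq_zero] at h1
  exact h1.resolve_left (sub_ne_zero.2 (by exact_mod_cast hij))

/-- The ping-pong step. For `i ≠ j` the product of leading coefficients is a nonzero multiple, by `k
* (j - i)`, of a rank one matrix with image spanned by `(1, i)`; it does not cancel, so the term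
with the extra `X` dominates. -/
theorem slopeHom_smul_slopeSet {i j : ℕ} (hij : i ≠ j) {k : Multiplicative ℤ} (hk : k ≠ 1)
    {p : (Matrix (Fin 2) (Fin 2) ℚ)[X]} (hp : p ∈ slopeSet j) :
    (slopeHom i k : (Matrix (Fin 2) (Fin 2) ℚ)[X]) * p ∈ slopeSet i := by
  obtain ⟨c, hc, h⟩ := hp
  have hk0 : (k.toAdd : ℚ) ≠ 0 := by exact_mod_cast (fun h => hk (Multiplicative.toAdd.injective h))
  have hd : ((j : ℚ) - i) ≠ 0 := sub_ne_zero.2 (by exact_mod_cast hij.symm)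
  let c' : Fin 2 → ℚ := (k.toAdd : ℚ) • ((j : ℚ) - i) • c
  have hc' : c' ≠ 0 := smul_ne_zero hk0 (smul_ne_zero hd hc)
  let q : (Matrix (Fin 2) (Fin 2) ℚ)[X] := C ((k.toAdd : ℤ) • slopeMatrix i) * X
  have hq : q.leadingCoeff * p.leadingCoeff = vecMulVec ![1, (i : ℚ)] c' := by
    rw [leadingCoeff_mul_X, leadingCoeff_C, h, smul_mul_assoc, slopeMatrix_mul_vecMulVec]
    simp only [c', vecMulVec_smul]
    rw [Int.cast_smul_eq_zsmul]
  have hne : vecMulVec ![1, (i : ℚ)] c' ≠ 0 := by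
    intro h0
    apply hc'
    ext l
    simpa using congrFun (congrFun h0 0) l
  have hne' : q.leadingCoeff * p.leadingCoeff ≠ 0 := hq ▸ hne
  have hN : (k.toAdd : ℤ) • slopeMatrix i ≠ 0 := by
    intro h0
    apply hne'
    simp only [q, h0, C_0, zero_mul, leadingCoeff_zero]
  refine ⟨c', hc', ?_⟩
  rw [coe_slopeHom, add_mul, one_mul, leadingCoeff_add_of_degree_lt, leadingCoeff_mul' hne', hq]
  rw [degree_mul' hne', degree_C_mul_X hN]
  have hp0 : p ≠ 0 := by
    rintro rfl
    simp at hne'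
  rw [degree_eq_natDegree hp0]
  norm_cast
  omega

/-- A faithful representation of a free group of finite rank. -/
noncomputable def slopeRep (m : ℕ) : FreeGroup (Fin m) →* (Matrix (Fin 2) (Fin 2) ℚ)[X]ˣ :=
  FreeGroup.lift fun i => slopeHom i (Multiplicative.ofAdd 1)

theorem slopeRep_injective (m : ℕ) (hm : Nontrivial (Fin m)) :
    Function.Injective (slopeRep m) := by
  let f : ∀ _ : Fin m, FreeGroup Unit →* (Matrix (Fin 2) (Fin 2) ℚ)[X]ˣ := fun i =>
    FreeGroup.lift fun _ => slopeHom i (Multiplicative.ofAdd 1)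
  have h : slopeRep m = (Monoid.CoprodI.lift f).comp
      (@freeGroupEquivCoprodI (Fin m)).toMonoidHom := by
    ext i
    simp [slopeRep, f]
  rw [h, MonoidHom.coe_comp]
  refine Function.Injective.comp ?_ (MulEquiv.injective freeGroupEquivCoprodI)
  refine Monoid.CoprodI.lift_injective_of_ping_pong f ?_
    (fun i => slopeSet i) (fun i => ?_) (fun i j hij => ?_) (fun i j hij => ?_)
  -- Ping-pong with only two factors needs a factor with at least three elements; here each factor
  -- is infinite cyclic.
  · right
    refine ⟨hm.exists_pair_ne.choose, ?_⟩
    rw [FreeGroup.freeGroupUnitEquivInt.cardinal_eq, Cardinal.mk_denumerable]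
    exact Cardinal.natCast_le_aleph0
  · exact ⟨C (vecMulVec ![1, ((i : ℕ) : ℚ)] ![1, 0]), ![1, 0], by simp, by simp⟩
  · exact slopeSet_disjoint (Fin.val_ne_of_ne hij)
  · refine FreeGroup.freeGroupUnitEquivInt.forall_congr_left.mpr ?_
    intro n hn
    rintro _ ⟨p, hp, rfl⟩
    change (f i (FreeGroup.of () ^ n) : (Matrix (Fin 2) (Fin 2) ℚ)[X]) * p ∈ _
    rw [map_zpow, FreeGroup.lift_apply_of, ← map_zpow]
    refine slopeHom_smul_slopeSet (Fin.val_ne_of_ne hij) ?_ hp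
    intro h0
    apply hn
    have : n = 0 := by simpa [← ofAdd_zsmul] using h0
    rw [this]
    rfl

end FreeGroupRep

/-! ### Order of vanishing of `g - 1` for polynomial units. -/

section Depth

open Polynomial

variable {A : Type*} [Ring A]

/-- The unit `g` of `A[X]` is congruent to `1` modulo `X ^ d` but not modulo `X ^ (d + 1)`. -/
def HasDepth (g : A[X]ˣ) (d : ℕ) : Prop := ∃ a : A[X], (g : A[X]) = 1 + X ^ d * a ∧ a.coeff 0 ≠ 0

theorem HasDepth.coeff {g : A[X]ˣ} {d : ℕ} (h : HasDepth g d) :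
    ((g : A[X]) - 1).coeff d ≠ 0 ∧ ∀ e < d, ((g : A[X]) - 1).coeff e = 0 := by
  obtain ⟨a, h, ha⟩ := h
  rw [h, add_sub_cancel_left]
  refine ⟨by simpa [coeff_X_pow_mul'] using ha, fun e he => ?_⟩
  rw [coeff_X_pow_mul', if_neg (by omega)]

theorem hasDepth_iff {g : A[X]ˣ} {d : ℕ} : HasDepth g d ↔
    ((g : A[X]) - 1).coeff d ≠ 0 ∧ ∀ e < d, ((g : A[X]) - 1).coeff e = 0 := by
  refine ⟨HasDepth.coeff, fun ⟨h, h'⟩ => ?_⟩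
  obtain ⟨a, ha⟩ := X_pow_dvd_iff.2 h'
  refine ⟨a, by rw [← ha]; abel, ?_⟩
  rw [ha, coeff_X_pow_mul'] at h
  simpa using h

theorem HasDepth.unique {g : A[X]ˣ} {d e : ℕ} (h : HasDepth g d) (h' : HasDepth g e) : d = e := by
  rcases lt_trichotomy d e with hde | hde | hde
  · exact absurd (h'.coeff.2 d hde) h.coeff.1
  · exact hde
  · exact absurd (h.coeff.2 e hde) h'.coeff.1

theorem HasDepth.ne_one {g : A[X]ˣ} {d : ℕ} (h : HasDepth g d) : g ≠ 1 := by
  rintro rfl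
  simpa using h.coeff.1

theorem exists_hasDepth {g : A[X]ˣ} (hg : g ≠ 1) (h0 : (g : A[X]).coeff 0 = 1) :
    ∃ d, 0 < d ∧ HasDepth g d := by
  classical
  have h : (g : A[X]) - 1 ≠ 0 := fun h => hg (Units.ext (sub_eq_zero.1 h))
  have hex : ∃ d, ((g : A[X]) - 1).coeff d ≠ 0 := by
    by_contra! h'
    exact h (Polynomial.ext h')
  refine ⟨Nat.find hex, ?_, hasDepth_iff.2 ⟨Nat.find_spec hex, fun e he =>
    not_not.1 (Nat.find_min hex he)⟩⟩
  rw [Nat.find_pos]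
  simp [h0]

theorem HasDepth.conj {g : A[X]ˣ} {d : ℕ} (h : HasDepth g d) (k : A[X]ˣ) :
    HasDepth (k * g * k⁻¹) d := by
  obtain ⟨a, h, ha⟩ := h
  refine ⟨k * a * (k⁻¹ : A[X]ˣ), ?_, fun h0 => ha ?_⟩
  · push_cast
    rw [h, mul_add, add_mul, mul_one, Units.mul_inv, ← mul_assoc, ← X_pow_mul (p := (k : A[X]))]
    simp only [mul_assoc]
  · have : a = (k⁻¹ : A[X]ˣ) * (k * a * (k⁻¹ : A[X]ˣ)) * k := by
      simp [mul_assoc]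
    rw [this, mul_coeff_zero, mul_coeff_zero, h0, mul_zero, zero_mul]

theorem HasDepth.inv {g : A[X]ˣ} {d : ℕ} (h : HasDepth g d) : HasDepth g⁻¹ d := by
  obtain ⟨a, h, ha⟩ := h
  refine ⟨-(a * (g⁻¹ : A[X]ˣ)), ?_, fun h0 => ha ?_⟩
  · have h1 : (g : A[X]) * (g⁻¹ : A[X]ˣ) = 1 := Units.mul_inv g
    rw [mul_neg, ← mul_assoc, eq_add_neg_iff_add_eq]
    conv_rhs => rw [← h1]
    conv_rhs => rw [h]
    rw [add_mul, one_mul]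
  · have : a = a * (g⁻¹ : A[X]ˣ) * g := by simp [mul_assoc]
    rw [coeff_neg, neg_eq_zero] at h0
    rw [this, mul_coeff_zero, h0, zero_mul]

/-- The lowest coefficient of `g ^ n - 1` is `n` times that of `g - 1`: cross terms have higher
order because `0 < d`, and the multiple is nonzero because `A` is a rational vector space. -/
theorem HasDepth.pow [Module ℚ A] {g : A[X]ˣ} {d : ℕ} (hd : 0 < d)
    (h : HasDepth g d) {n : ℕ} (hn : n ≠ 0) : HasDepth (g ^ n) d := by
  obtain ⟨a, h, ha⟩ := h
  have key : ∀ n : ℕ, ∃ b : A[X], ((g ^ n : A[X]ˣ) : A[X]) = 1 + X ^ d * b ∧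
      b.coeff 0 = n • a.coeff 0 := by
    intro n
    induction n with
    | zero => exact ⟨0, by simp, by simp⟩
    | succ n ih =>
      obtain ⟨b, hb, hb'⟩ := ih
      refine ⟨b + a + X ^ d * b * a, ?_, ?_⟩
      · rw [pow_succ, Units.val_mul, hb, h]
        have : X ^ d * b * (X ^ d * a) = X ^ d * (X ^ d * b * a) := by
          rw [mul_assoc, ← mul_assoc b, ← X_pow_mul (p := b)]
        rw [mul_add, mul_one, add_mul, one_mul, this, mul_add, mul_add]
        abel
      · rw [coeff_add, coeff_add, hb', mul_coeff_zero, mul_coeff_zero, coeff_X_pow,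
          if_neg (by omega), zero_mul, zero_mul, add_zero, succ_nsmul]
  obtain ⟨b, hb, hb'⟩ := key n
  exact ⟨b, hb, by rw [hb']; exact fun h0 => ha (by
    rw [← Nat.cast_smul_eq_nsmul ℚ, smul_eq_zero] at h0
    exact h0.resolve_left (by exact_mod_cast hn))⟩

theorem HasDepth.zpow [Module ℚ A] {g : A[X]ˣ} {d : ℕ} (hd : 0 < d)
    (h : HasDepth g d) {n : ℤ} (hn : n ≠ 0) : HasDepth (g ^ n) d := by
  obtain ⟨k, rfl | rfl⟩ := n.eq_nat_or_neg
  · rw [zpow_natCast]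
    exact h.pow hd (by simpa using hn)
  · rw [zpow_neg, zpow_natCast]
    exact (h.pow hd (by simpa using hn)).inv

/-- The commutator minus `1` is `(u * v - v * u) * (u⁻¹ * v⁻¹)`, and in `u * v - v * u` only the
products of the two vanishing parts survive. -/
theorem HasDepth.commutator {u v : A[X]ˣ} {d e f : ℕ} (hu : HasDepth u d) (hv : HasDepth v e)
    (h : HasDepth (u * v * u⁻¹ * v⁻¹) f) : d + e ≤ f := by
  obtain ⟨a, ha, -⟩ := hu
  obtain ⟨b, hb, -⟩ := hv
  by_contra! hlt
  refine h.coeff.1 ?_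
  have h1 : ((u * v * u⁻¹ * v⁻¹ : A[X]ˣ) : A[X]) - 1 =
      X ^ (d + e) * ((a * b - b * a) * ((u⁻¹ * v⁻¹ : A[X]ˣ) : A[X])) := by
    have h2 : (u : A[X]) * (v : A[X]) - (v : A[X]) * (u : A[X]) = X ^ (d + e) * (a * b - b * a) := by
      have e1 : X ^ d * a * (X ^ e * b) = X ^ (d + e) * (a * b) := by
        rw [mul_assoc, ← mul_assoc a, ← X_pow_mul (p := a), pow_add]
        simp only [mul_assoc]
      have e2 : X ^ e * b * (X ^ d * a) = X ^ (d + e) * (b * a) := by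
        rw [mul_assoc, ← mul_assoc b, ← X_pow_mul (p := b), add_comm, pow_add]
        simp only [mul_assoc]
      rw [ha, hb]
      simp only [mul_add, add_mul, one_mul, mul_one, e1, e2, mul_sub]
      abel
    rw [← mul_assoc, ← h2, sub_mul, ← Units.val_mul, ← Units.val_mul, ← Units.val_mul,
      ← Units.val_mul]
    congr 2
    · group
    · rw [show v * u * (u⁻¹ * v⁻¹) = 1 by group, Units.val_one]
  rw [h1, coeff_X_pow_mul', if_neg (by omega)]

end Depth

/-! ### Commutators and conjugacy in free groups. -/

section FreeGroup

/-- A nontrivial power of `u`, or a conjugate of it, has the depth `d` of `u`, while nontrivial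
powers of the commutator have depth at least `d + e > d`. If one exponent vanishes, the other must
too, because depth also excludes the identity. -/
theorem zpow_conj_commutator_freeGroup {m : ℕ} {u v : FreeGroup (Fin m)} (huv : u * v ≠ v * u)
    (h : FreeGroup (Fin m)) (i j : ℤ) (hij : h * u ^ i = (u * v * u⁻¹ * v⁻¹) ^ j * h) :
    i = 0 ∧ j = 0 := by
  -- With at most one generator the group is abelian; the ping-pong representation needs two.
  have hm : Nontrivial (Fin m) := by
    by_contra hm
    rw [not_nontrivial_iff_subsingleton] at hm
    rcases isEmpty_or_nonempty (Fin m) with he | ⟨⟨k⟩⟩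
    · exact huv (Subsingleton.elim _ _)
    · have : Unique (Fin m) := ⟨⟨k⟩, fun l => Subsingleton.elim _ _⟩
      exact huv (FreeGroup.mulEquivIntOfUnique.injective (by rw [map_mul, map_mul, mul_comm]))
  have hinj := slopeRep_injective m hm
  have h0 : ∀ g, (slopeRep m g : Polynomial (Matrix (Fin 2) (Fin 2) ℚ)).coeff 0 = 1 := by
    intro g
    have : (Units.map (Polynomial.constantCoeff : Polynomial (Matrix (Fin 2) (Fin 2) ℚ) →+* _).toMonoidHom).comp
        (slopeRep m) = 1 := by
      ext k : 2
      simp [slopeRep, coe_slopeHom]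
    have h1 := congrArg Units.val (DFunLike.congr_fun this g)
    simpa using h1
  have hdepth : ∀ g, g ≠ 1 → ∃ d, 0 < d ∧ HasDepth (slopeRep m g) d := fun g hg =>
    exists_hasDepth (fun h => hg (hinj (h.trans (map_one _).symm))) (h0 g)
  have hu : u ≠ 1 := by rintro rfl; simp at huv
  have hv : v ≠ 1 := by rintro rfl; simp at huv
  have hc : u * v * u⁻¹ * v⁻¹ ≠ 1 := fun hc => huv (by
    rw [mul_inv_eq_one, mul_inv_eq_iff_eq_mul] at hc
    exact hc)
  obtain ⟨d, hd, hud⟩ := hdepth u hu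
  obtain ⟨e, he, hve⟩ := hdepth v hv
  obtain ⟨f, hf, hcf⟩ := hdepth _ hc
  have hlt : d + e ≤ f := hud.commutator hve (by simpa only [map_mul, map_inv] using hcf)
  have hij' : h * u ^ i * h⁻¹ = (u * v * u⁻¹ * v⁻¹) ^ j := by rw [hij, mul_inv_cancel_right]
  have hi : i = 0 := by
    by_contra hi
    have h1 := (hud.zpow hd hi).conj (slopeRep m h)
    rw [← map_inv, ← map_zpow, ← map_mul, ← map_mul, hij'] at h1
    rcases eq_or_ne j 0 with rfl | hj
    · exact h1.ne_one (by simp)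
    · rw [map_zpow] at h1
      have := h1.unique (hcf.zpow hf hj)
      omega
  refine ⟨hi, ?_⟩
  by_contra hj
  subst hi
  have h1 := hcf.zpow hf hj
  rw [← map_zpow, ← hij'] at h1
  exact h1.ne_one (by simp)

/-- Two adjacent transpositions in the symmetric group on three letters do not commute. -/
theorem freeGroup_of_mul_of_ne {ι : Type*} {i j : ι} (h : i ≠ j) :
    FreeGroup.of i * FreeGroup.of j ≠ FreeGroup.of j * FreeGroup.of i := by
  classical
  intro he
  have := congrArg (FreeGroup.lift fun k => if k = i then (Equiv.swap 0 1 : Equiv.Perm (Fin 3))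
    else Equiv.swap 1 2) he
  simp only [map_mul, FreeGroup.lift_apply_of, if_true, if_neg h.symm] at this
  exact absurd this (by decide)

theorem exists_not_commute_of_isFreeGroup {G : Type*} [Group G] [IsFreeGroup G]
    (h1 : Nontrivial G) (h2 : ¬ Nonempty (G ≃* Multiplicative ℤ)) :
    ∃ u v : G, u * v ≠ v * u := by
  by_contra! hcomm
  let e := IsFreeGroup.toFreeGroup G
  have hsub : Subsingleton (IsFreeGroup.Generators G) := ⟨fun i j => by
    by_contra hij
    apply freeGroup_of_mul_of_ne hij
    apply e.symm.injective
    rw [map_mul, map_mul, hcomm]⟩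
  rcases isEmpty_or_nonempty (IsFreeGroup.Generators G) with he | ⟨⟨k⟩⟩
  · have := e.toEquiv.subsingleton
    exact not_subsingleton G this
  · have : Unique (IsFreeGroup.Generators G) := ⟨⟨k⟩, fun l => Subsingleton.elim _ _⟩
    exact h2 ⟨(e.trans (FreeGroup.freeGroupCongr (Equiv.ofUnique _ Unit))).trans
      FreeGroup.mulEquivIntOfUnique⟩

end FreeGroup

/-! ### Constructing motion planners. -/

section Planners

variable {X Y Γ : Type*} [TopologicalSpace X] [TopologicalSpace Y] [TopologicalSpace Γ]

theorem exists_motionPlanner_of_family {f : C(X, Y)} {Z : Set (X × X)}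
    (P : ∀ z : Z, Path (f z.1.1) (f z.1.2)) (hP : Continuous ↿P) :
    ∃ s : C(Z, C(I, Y)), IsMotionPlanner f Z s :=
  ⟨ContinuousMap.curry ⟨fun p : Z × I => P p.1 p.2, hP⟩, fun z => ⟨(P z).source, (P z).target⟩⟩

theorem IsMotionPlanner.exists_mono {f : C(X, Y)} {Z Z' : Set (X × X)} (h : Z' ⊆ Z)
    {s : C(Z, C(I, Y))} (hs : IsMotionPlanner f Z s) :
    ∃ s' : C(Z', C(I, Y)), IsMotionPlanner f Z' s' :=
  ⟨s.comp ⟨Set.inclusion h, continuous_inclusion h⟩, fun z => hs (Set.inclusion h z)⟩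

/-- Move along the homotopy from `φ x₀` to `b (a x₀)`, follow the image of the planned path in `Γ`,
and return along the homotopy. -/
theorem HasMotionPlanning.of_homotopic_comp {φ : C(X, Y)} (a : C(X, Γ)) (b : C(Γ, Y))
    (h : φ.Homotopic (b.comp a)) {k : ℕ} (hk : HasMotionPlanning (ContinuousMap.id Γ) k) :
    HasMotionPlanning φ k := by
  obtain ⟨H⟩ := h
  obtain ⟨U, hU, hcov, hs⟩ := hk
  refine ⟨fun i => Prod.map a a ⁻¹' U i, fun i => (hU i).preimage (by fun_prop), ?_, fun i => ?_⟩
  · rw [← Set.preimage_iUnion, hcov, Set.preimage_univ]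
  · obtain ⟨s, hs⟩ := hs i
    let M : ∀ z : (Prod.map a a ⁻¹' U i : Set (X × X)), Path (a z.1.1) (a z.1.2) := fun z =>
      ⟨s ⟨_, z.2⟩, (hs ⟨_, z.2⟩).1, (hs ⟨_, z.2⟩).2⟩
    refine exists_motionPlanner_of_family (fun z => ((H.evalAt z.1.1).trans
      ((M z).map b.continuous)).trans (H.evalAt z.1.2).symm) ?_
    refine Path.trans_continuous_family _ (Path.trans_continuous_family _ ?_ _ ?_) _
      (Path.symm_continuous_family _ ?_)
    · exact H.continuous.comp (by fun_prop :
        Continuous fun p : (Prod.map a a ⁻¹' U i : Set (X × X)) × I => (p.2, p.1.1.1))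
    · refine b.continuous.comp ?_
      exact (by fun_prop : Continuous fun p : (Prod.map a a ⁻¹' U i : Set (X × X)) × I =>
        s ⟨Prod.map a a p.1.1, p.1.2⟩ p.2)
    · exact H.continuous.comp (by fun_prop :
        Continuous fun p : (Prod.map a a ⁻¹' U i : Set (X × X)) × I => (p.2, p.1.1.2))

theorem hasMotionPlanning_id_of_subsingleton [Subsingleton Γ] :
    HasMotionPlanning (ContinuousMap.id Γ) 0 :=
  ⟨fun _ => Set.univ, fun _ => isOpen_univ, Set.iUnion_const _, fun _ =>
    exists_motionPlanner_of_family (fun z => (Path.refl z.1.1).cast rfl (Subsingleton.elim _ _))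
      (by exact (by fun_prop : Continuous fun p : ↥(Set.univ : Set (Γ × Γ)) × I => p.1.1.1))⟩

theorem exists_motionPlanner_prod {A B : Set Γ} {x₀ : Γ} (P : ∀ z : A, Path z.1 x₀)
    (hP : Continuous ↿P) (Q : ∀ z : B, Path z.1 x₀) (hQ : Continuous ↿Q) :
    ∃ s : C((A ×ˢ B : Set (Γ × Γ)), C(I, Γ)),
      IsMotionPlanner (ContinuousMap.id Γ) (A ×ˢ B) s := by
  refine exists_motionPlanner_of_family
    (fun z => (P ⟨z.1.1, z.2.1⟩).trans (Q ⟨z.1.2, z.2.2⟩).symm) ?_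
  refine Path.trans_continuous_family _ ?_ _ (Path.symm_continuous_family _ ?_)
  · exact hP.comp (by fun_prop : Continuous fun p : (A ×ˢ B : Set (Γ × Γ)) × I =>
      ((⟨p.1.1.1, p.1.2.1⟩ : A), p.2))
  · exact hQ.comp (by fun_prop : Continuous fun p : (A ×ˢ B : Set (Γ × Γ)) × I =>
      ((⟨p.1.1.2, p.1.2.2⟩ : B), p.2))

theorem IsMotionPlanner.exists_union [Nonempty Y] {f : C(X, Y)} {U V : Set (X × X)} (hU : IsOpen U)
    (hV : IsOpen V) (hUV : Disjoint U V) {s : C(U, C(I, Y))} (hs : IsMotionPlanner f U s)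
    {t : C(V, C(I, Y))} (ht : IsMotionPlanner f V t) :
    ∃ r : C((U ∪ V : Set (X × X)), C(I, Y)), IsMotionPlanner f (U ∪ V) r := by
  classical
  obtain ⟨y⟩ : Nonempty Y := inferInstance
  let F : X × X → C(I, Y) := fun z => if h : z ∈ U then s ⟨z, h⟩ else
    if h : z ∈ V then t ⟨z, h⟩ else .const _ y
  have hFU : ∀ z (h : z ∈ U), F z = s ⟨z, h⟩ := fun z h => dif_pos h
  have hFV : ∀ z (h : z ∈ V), F z = t ⟨z, h⟩ := fun z h => by
    simp only [F, dif_neg (hUV.notMem_of_mem_right h), dif_pos h]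
  have hF : ContinuousOn F (U ∪ V) := by
    refine ContinuousOn.union_of_isOpen ?_ ?_ hU hV
    · rw [continuousOn_iff_continuous_domRestrict]
      exact s.continuous.congr fun z => (hFU z.1 z.2).symm
    · rw [continuousOn_iff_continuous_domRestrict]
      exact t.continuous.congr fun z => (hFV z.1 z.2).symm
  refine ⟨⟨fun z => F z.1, continuousOn_iff_continuous_domRestrict.1 hF⟩, ?_⟩
  rintro ⟨z, h | h⟩
  · exact (congrArg (fun g : C(I, Y) => g 0 = f z.1 ∧ g 1 = f z.2) (hFU z h)).mpr (hs ⟨z, h⟩)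
  · exact (congrArg (fun g : C(I, Y) => g 0 = f z.1 ∧ g 1 = f z.2) (hFV z h)).mpr (ht ⟨z, h⟩)

/-- A space with a numerable cover by two open sets that deform to a point inside the space has
topological complexity at most two. -/
theorem hasMotionPlanning_two {A B : Set Γ} (hA : IsOpen A) (hB : IsOpen B) (ρ : C(Γ, ℝ))
    (hρA : ∀ x, ρ x ≠ 0 → x ∈ A) (hρB : ∀ x, ρ x ≠ 1 → x ∈ B) {x₀ : Γ}
    (P : ∀ z : A, Path z.1 x₀) (hP : Continuous ↿P) (Q : ∀ z : B, Path z.1 x₀)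
    (hQ : Continuous ↿Q) : HasMotionPlanning (ContinuousMap.id Γ) 2 := by
  let S : Set Γ := {x | 1 / 2 < ρ x}
  let S' : Set Γ := {x | ρ x < 1 / 2}
  have hS : IsOpen S := isOpen_lt continuous_const ρ.continuous
  have hS' : IsOpen S' := isOpen_lt ρ.continuous continuous_const
  have hSA : S ⊆ A := fun x hx => hρA x (by
    have : 1 / 2 < ρ x := hx
    linarith)
  have hSB : S' ⊆ B := fun x hx => hρB x (by
    have : ρ x < 1 / 2 := hx
    linarith)
  have hdisj : Disjoint (S ×ˢ S') (S' ×ˢ S) := by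
    rw [Set.disjoint_left]
    rintro ⟨x, y⟩ ⟨h1, -⟩ ⟨h2, -⟩
    exact lt_asymm (show 1 / 2 < ρ x from h1) h2
  -- A pair in neither `A ×ˢ A` nor `B ×ˢ B` has `ρ` equal to `0` at one point and `1` at the other,
  -- so it lies in the middle set. There the two products are disjoint and open, and their planners
  -- glue.
  refine ⟨![A ×ˢ A, S ×ˢ S' ∪ S' ×ˢ S, B ×ˢ B], ?_, ?_, ?_⟩
  · intro i
    fin_cases i
    · exact hA.prod hA
    · exact (hS.prod hS').union (hS'.prod hS)
    · exact hB.prod hB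
  · refine Set.eq_univ_of_forall fun ⟨x, y⟩ => Set.mem_iUnion.2 ?_
    by_cases h0 : (x, y) ∈ A ×ˢ A
    · exact ⟨0, h0⟩
    by_cases h2 : (x, y) ∈ B ×ˢ B
    · exact ⟨2, h2⟩
    refine ⟨1, ?_⟩
    have e0 : ρ x = 0 ∨ ρ y = 0 := by
      by_contra! h
      exact h0 ⟨hρA x h.1, hρA y h.2⟩
    have e2 : ρ x = 1 ∨ ρ y = 1 := by
      by_contra! h
      exact h2 ⟨hρB x h.1, hρB y h.2⟩
    rcases e0 with h | h <;> rcases e2 with h' | h'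
    · norm_num [h] at h'
    · exact Or.inr ⟨by simp only [S', Set.mem_ofPred_eq, h]; norm_num,
        by simp only [S, Set.mem_ofPred_eq, h']; norm_num⟩
    · exact Or.inl ⟨by simp only [S, Set.mem_ofPred_eq, h']; norm_num,
        by simp only [S', Set.mem_ofPred_eq, h]; norm_num⟩
    · norm_num [h] at h'
  · intro i
    have : Nonempty Γ := ⟨x₀⟩
    fin_cases i
    · exact exists_motionPlanner_prod P hP P hP
    · obtain ⟨s, hs⟩ := exists_motionPlanner_prod P hP Q hQ
      obtain ⟨s, hs⟩ := hs.exists_mono (Set.prod_mono hSA hSB)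
      obtain ⟨t, ht⟩ := exists_motionPlanner_prod Q hQ P hP
      obtain ⟨t, ht⟩ := ht.exists_mono (Set.prod_mono hSB hSA)
      exact hs.exists_union (hS.prod hS') (hS'.prod hS) hdisj ht
    · exact exists_motionPlanner_prod Q hQ Q hQ

/-- Rotate `z.1` at constant speed through an angle carrying it to `z.2`; the argument shifted by
`c` chooses this angle continuously away from one branch cut. -/
theorem Circle.exists_motionPlanner (c : ℝ) :
    ∃ s : C({z : Circle × Circle | ((z.1⁻¹ * z.2 * Circle.exp c : Circle) : ℂ) ∈ Complex.slitPlane},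
      C(I, Circle)), IsMotionPlanner (ContinuousMap.id Circle) _ s := by
  let Z := {z : Circle × Circle | ((z.1⁻¹ * z.2 * Circle.exp c : Circle) : ℂ) ∈ Complex.slitPlane}
  let F : C(Z × I, Circle) :=
    ⟨fun p => p.1.1.1 *
      Circle.exp (p.2 * (Complex.arg (p.1.1.1⁻¹ * p.1.1.2 * Circle.exp c : Circle) - c)), by
      have : Continuous fun p : Z × I =>
          Complex.arg (p.1.1.1⁻¹ * p.1.1.2 * Circle.exp c : Circle) := by
        rw [continuous_iff_continuousAt]
        intro p
        exact (Complex.continuousAt_arg p.1.2).comp (f := fun p : Z × I =>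
          ((p.1.1.1⁻¹ * p.1.1.2 * Circle.exp c : Circle) : ℂ)) (by fun_prop)
      fun_prop⟩
  refine ⟨F.curry, fun z => ⟨?_, ?_⟩⟩
  · simp only [F, ContinuousMap.curry_apply, ContinuousMap.coe_mk, Set.Icc.coe_zero, zero_mul,
      Circle.exp_zero, mul_one, ContinuousMap.id_apply]
  · simp only [F, ContinuousMap.curry_apply, ContinuousMap.coe_mk, Set.Icc.coe_one, one_mul,
      Circle.exp_sub, Circle.exp_arg, ContinuousMap.id_apply]
    simp

theorem Circle.hasMotionPlanning_one : HasMotionPlanning (ContinuousMap.id Circle) 1 := by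
  let U : ℝ → Set (Circle × Circle) := fun c =>
    {z | ((z.1⁻¹ * z.2 * Circle.exp c : Circle) : ℂ) ∈ Complex.slitPlane}
  have hU : ∀ c, IsOpen (U c) := fun c => Complex.isOpen_slitPlane.preimage (by fun_prop)
  refine ⟨![U 0, U Real.pi], ?_, ?_, ?_⟩
  · intro i
    fin_cases i <;> exact hU _
  · refine Set.eq_univ_of_forall fun z => Set.mem_iUnion.2 ?_
    -- For nonzero `w`, at least one of `w` and `-w` avoids the closed negative real axis, and
    -- multiplication by `exp (πi)` changes the sign.
    by_cases h : z ∈ U 0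
    · exact ⟨0, h⟩
    · refine ⟨1, ?_⟩
      change ((z.1⁻¹ * z.2 * Circle.exp Real.pi : Circle) : ℂ) ∈ Complex.slitPlane
      replace h : ((z.1⁻¹ * z.2 * Circle.exp 0 : Circle) : ℂ) ∉ Complex.slitPlane := h
      rw [Circle.exp_zero, mul_one, Complex.mem_slitPlane_iff, not_or, not_lt, not_not] at h
      set w := z.1⁻¹ * z.2
      rw [Circle.coe_mul, Circle.coe_exp, Complex.exp_pi_mul_I, mul_neg_one,
        Complex.mem_slitPlane_iff]
      left
      rw [Complex.neg_re, Left.neg_pos_iff]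
      refine lt_of_le_of_ne h.1 fun h0 => ?_
      exact Circle.coe_ne_zero w (Complex.ext h0 h.2)
  · intro i
    fin_cases i
    · exact Circle.exists_motionPlanner 0
    · exact Circle.exists_motionPlanner Real.pi

end Planners

/-! ### Generators of the fundamental group of a quotient. -/

section CoveringGenerators

variable {Γ T G ι : Type*} [TopologicalSpace Γ] [TopologicalSpace T] [Group G] [MulAction G T]
  {q : T → Γ}

/-- The loop in the base of a quotient covering map given by a path from a point to a
translate. -/
def IsQuotientCoveringMap.loop (hq : IsQuotientCoveringMap q G) {t₀ : T} {g : G}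
    (e : Path t₀ (g • t₀)) : Path (q t₀) (q t₀) :=
  (e.map hq.isCoveringMap.continuous).cast rfl (hq.map_smul g).symm

/-- The class of `IsQuotientCoveringMap.loop` in the fundamental group. -/
def IsQuotientCoveringMap.loopClass (hq : IsQuotientCoveringMap q G) {t₀ : T} {g : G}
    (e : Path t₀ (g • t₀)) : FundamentalGroup Γ (q t₀) :=
  Path.Homotopic.Quotient.mk (hq.loop e)

theorem IsQuotientCoveringMap.exists_path_of_mem_closure (hq : IsQuotientCoveringMap q G) {t₀ : T}
    {g : ι → G} (e : ∀ i, Path t₀ (g i • t₀)) (K : Subgroup (FundamentalGroup Γ (q t₀)))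
    (hK : ∀ i, hq.loopClass (e i) ∈ K) {h : G}
    (hh : h ∈ Subgroup.closure (Set.range g)) :
    ∃ p : Path t₀ (h • t₀), hq.loopClass p ∈ K := by
  have := hq.toContinuousConstSMul
  induction hh using Subgroup.closure_induction with
  | mem h hh =>
    obtain ⟨i, rfl⟩ := hh
    exact ⟨e i, hK i⟩
  | one =>
    refine ⟨(Path.refl t₀).cast rfl (one_smul G t₀), ?_⟩
    exact K.one_mem
  | mul h k _ _ ih ih' =>
    obtain ⟨p, hp⟩ := ih
    obtain ⟨p', hp'⟩ := ih'
    refine ⟨(p.trans (p'.map (continuous_const_smul h))).cast rfl (mul_smul h k t₀), ?_⟩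
    have h1 : hq.loop ((p.trans (p'.map (continuous_const_smul h))).cast rfl (mul_smul h k t₀)) =
        (hq.loop p).trans (hq.loop p') := by
      ext s
      simp only [loop, Path.cast_coe, Path.map_coe, Function.comp_apply, Path.trans_apply]
      split_ifs
      · rfl
      · exact hq.map_smul h
    rw [loopClass, h1]
    -- The order is swapped because multiplication in `FundamentalGroup` reverses concatenation.
    exact K.mul_mem hp' hp
  | inv h _ ih =>
    obtain ⟨p, hp⟩ := ih
    refine ⟨(p.symm.map (continuous_const_smul h⁻¹)).cast (inv_smul_smul h t₀).symm rfl, ?_⟩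
    have h1 : hq.loop ((p.symm.map (continuous_const_smul h⁻¹)).cast
        (inv_smul_smul h t₀).symm rfl) = (hq.loop p).symm := by
      ext s
      exact hq.map_smul h⁻¹
    rw [loopClass, h1]
    exact K.inv_mem hp

/-- A loop lifts to a path from `t₀` to some translate `h • t₀`, and simple connectivity makes its
class depend only on `h`. Expressing `h` through the generators gives a path with the same endpoints
whose class is in the subgroup. -/
theorem IsQuotientCoveringMap.closure_loop_eq_top [SimplyConnectedSpace T]
    (hq : IsQuotientCoveringMap q G) {t₀ : T} {g : ι → G}
    (hg : Subgroup.closure (Set.range g) = ⊤) (e : ∀ i, Path t₀ (g i • t₀)) :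
    Subgroup.closure (Set.range fun i => hq.loopClass (e i)) = ⊤ := by
  set K := Subgroup.closure (Set.range fun i => hq.loopClass (e i))
  rw [Subgroup.eq_top_iff']
  intro ω
  obtain ⟨ω, rfl⟩ := Path.Homotopic.Quotient.mk_surjective (x₀ := q t₀) (x₁ := q t₀) ω
  obtain ⟨w, hw, hw0⟩ := hq.isCoveringMap.exists_path_lifts (ω : C(I, Γ)) t₀ ω.source
  have hw1 : q (w 1) = q t₀ := (congrFun hw 1).trans ω.target
  obtain ⟨h, hh⟩ := hq.apply_eq_iff_mem_orbit.1 hw1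
  obtain ⟨p, hp⟩ := hq.exists_path_of_mem_closure e K
    (fun i => Subgroup.subset_closure ⟨i, rfl⟩) (hg ▸ Subgroup.mem_top h)
  let w' : Path t₀ (h • t₀) := ⟨w, hw0, hh.symm⟩
  have h1 : ω = hq.loop w' := by
    ext s
    exact (congrFun hw s).symm
  have h2 : (hq.loop w').Homotopic (hq.loop p) :=
    ((SimplyConnectedSpace.paths_homotopic w' p).map ⟨q, hq.isCoveringMap.continuous⟩).pathCast _ _
  rw [h1, Path.Homotopic.Quotient.eq.2 h2]
  exact hp

end CoveringGenerators

/-! ### Upper bounds from factorizations. -/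

section

variable {X Y Γ T G ι : Type*} [TopologicalSpace X] [TopologicalSpace Y] [TopologicalSpace Γ]
  [TopologicalSpace T] [Group G] [MulAction G T] {q : T → Γ}

/-- The factorization is available for CW complexes, so `φ` is first transported along a homotopy
equivalence; the path `μ` tracks the resulting change of base point. -/
theorem HasMotionPlanning.of_map_range_le [PathConnectedSpace X] {φ : C(X, Y)}
    (hX : HasCWHomotopyType X) {x : X}
    (hY : ∀ n, 2 ≤ n → ∀ y : Y, Subsingleton (π_ n Y y)) [ContractibleSpace T]
    (hq : IsCoveringMap q) (hq' : Function.Surjective q) {t₀ : Γ} (b : C(Γ, Y)) (hb : b t₀ = φ x)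
    (hinj : Function.Injective (FundamentalGroup.mapOfEq b hb))
    (hrange : (FundamentalGroup.map φ x).range ≤ (FundamentalGroup.mapOfEq b hb).range) {k : ℕ}
    (hk : HasMotionPlanning (ContinuousMap.id Γ) k) : HasMotionPlanning φ k := by
  obtain ⟨C, ⟨cw⟩, ⟨E⟩⟩ := hX
  obtain ⟨H⟩ := E.left_inv
  obtain ⟨H'⟩ := E.right_inv
  have hC : PathConnectedSpace C := by
    refine ⟨⟨E x⟩, fun c c' => ?_⟩
    have h1 : ∀ c, Joined (E (E.symm c)) c := fun c => ⟨H'.evalAt c⟩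
    have h2 : Joined (E (E.symm c)) (E (E.symm c')) :=
      ⟨(PathConnectedSpace.joined (E.symm c) (E.symm c')).somePath.map E.continuous⟩
    exact (h1 c).symm.trans (h2.trans (h1 c'))
  let φ' : C(C, Y) := φ.comp E.invFun
  let μ : Path (E.invFun (E x)) x := H.evalAt x
  let η : Path (φ' (E x)) (φ x) := μ.map φ.continuous
  let γ₀ : Path (b t₀) (φ' (E x)) := η.symm.cast hb rfl
  have hinj' : ∀ ω : Path t₀ t₀, (ω.map b.continuous).Homotopic (Path.refl _) →
      ω.Homotopic (Path.refl _) := by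
    intro ω hω
    rw [← Path.Homotopic.Quotient.eq]
    refine hinj ?_
    rw [FundamentalGroup.mapOfEq_apply, FundamentalGroup.mapOfEq_apply,
      ← Path.Homotopic.Quotient.mk_map, ← Path.Homotopic.Quotient.mk_map,
      Path.Homotopic.Quotient.eq.2 hω]
    rfl
  have hrange' : ∀ g : Path (E x) (E x), ∃ δ : Path t₀ t₀,
      ((δ.map b.continuous).trans γ₀).Homotopic (γ₀.trans (g.map φ'.continuous)) := by
    intro g
    let p : Path x x := (μ.symm.trans (g.map E.invFun.continuous)).trans μ
    obtain ⟨δ, hδ⟩ := hrange ⟨Path.Homotopic.Quotient.mk p, rfl⟩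
    obtain ⟨δ, rfl⟩ := Path.Homotopic.Quotient.mk_surjective δ
    refine ⟨δ, ?_⟩
    rw [FundamentalGroup.mapOfEq_apply, ← Path.Homotopic.Quotient.mk_map,
      FundamentalGroup.map_mk, ← Path.Homotopic.Quotient.mk_cast] at hδ
    have h1 : (((δ.map b.continuous).cast hb.symm hb.symm).trans η.symm).Homotopic
        (η.symm.trans (g.map φ'.continuous)) := by
      rw [← Path.Homotopic.Quotient.eq, Path.Homotopic.Quotient.mk_trans, hδ]
      have h2 : p.map φ.continuous = (η.symm.trans (g.map φ'.continuous)).trans η := by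
        simp only [p, Path.map_trans]
        rfl
      rw [h2]
      simp only [Path.Homotopic.Quotient.mk_trans, Path.Homotopic.Quotient.mk_symm,
        Path.Homotopic.Quotient.trans_assoc, Path.Homotopic.Quotient.trans_symm,
        Path.Homotopic.Quotient.trans_refl]
    exact h1.pathCast hb rfl
  obtain ⟨a, ha⟩ := cw.exists_homotopic_comp hq hq' φ' b γ₀ hinj' hrange' hY
  refine hk.of_homotopic_comp (a.comp E.toFun) b ?_
  have h1 : φ.Homotopic (φ'.comp E.toFun) := by
    have := (ContinuousMap.Homotopic.refl φ).comp (⟨H⟩ : (E.invFun.comp E.toFun).Homotopic _)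
    exact this.symm
  exact h1.trans (ha.comp (ContinuousMap.Homotopic.refl E.toFun))

/-- The group `π₁(Γ)` need not be computed: the loop classes generate it, and `b` sends them to
elements freely generating a subgroup. Hence `b` is injective on `π₁`. -/
theorem HasMotionPlanning.of_quotientCovering [PathConnectedSpace X] {φ : C(X, Y)}
    (hX : HasCWHomotopyType X) {x : X}
    (hY : ∀ n, 2 ≤ n → ∀ y : Y, Subsingleton (π_ n Y y)) [ContractibleSpace T]
    (hq : IsQuotientCoveringMap q G) {g : ι → G} (hg : Subgroup.closure (Set.range g) = ⊤) {t₀ : T}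
    (e : ∀ i, Path t₀ (g i • t₀)) (b : C(Γ, Y)) (hb : b (q t₀) = φ x)
    {ω : ι → FundamentalGroup Y (φ x)} (hinj : Function.Injective (FreeGroup.lift ω))
    (hω : ∀ i, FundamentalGroup.mapOfEq b hb (hq.loopClass (e i)) = ω i)
    (hrange : (FundamentalGroup.map φ x).range ≤ Subgroup.closure (Set.range ω)) {k : ℕ}
    (hk : HasMotionPlanning (ContinuousMap.id Γ) k) : HasMotionPlanning φ k := by
  let w : ι → FundamentalGroup Γ (q t₀) := fun i => hq.loopClass (e i)
  have hw : (FreeGroup.lift w).range = ⊤ := by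
    rw [FreeGroup.range_lift_eq_closure]
    exact hq.closure_loop_eq_top hg e
  have hcomp : (FundamentalGroup.mapOfEq b hb).comp (FreeGroup.lift w) = FreeGroup.lift ω := by
    ext i
    simpa using hω i
  refine HasMotionPlanning.of_map_range_le hX hY hq.isCoveringMap hq.surjective b hb ?_ ?_ hk
  · rw [injective_iff_map_eq_one]
    intro z hz
    obtain ⟨v, rfl⟩ := MonoidHom.range_eq_top.1 hw z
    have h1 : FreeGroup.lift ω v = 1 := by rw [← hcomp]; exact hz
    rw [(injective_iff_map_eq_one _).1 hinj v h1, map_one]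
  · refine hrange.trans ?_
    rw [← FreeGroup.range_lift_eq_closure, ← hcomp, MonoidHom.range_comp]
    exact Subgroup.map_le_range _ _

theorem hasMotionPlanning_zero_of_map_eq_one [PathConnectedSpace X] {φ : C(X, Y)}
    (hX : HasCWHomotopyType X) {x : X}
    (hY : ∀ n, 2 ≤ n → ∀ y : Y, Subsingleton (π_ n Y y))
    (h : ∀ γ, FundamentalGroup.map φ x γ = 1) : HasMotionPlanning φ 0 := by
  have : Subsingleton (FundamentalGroup PUnit.{1} PUnit.unit) :=
    ⟨fun a b => by
      induction a using Path.Homotopic.Quotient.ind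
      induction b using Path.Homotopic.Quotient.ind
      exact Path.Homotopic.Quotient.eq.2 (SimplyConnectedSpace.paths_homotopic _ _)⟩
  have hq : IsQuotientCoveringMap (id : PUnit.{1} → PUnit.{1}) PUnit.{1} :=
    { (Homeomorph.refl PUnit.{1}).isQuotientMap with
      continuous_const_smul := fun _ => continuous_of_discreteTopology
      apply_eq_iff_mem_orbit := fun {a b} => by simp [Subsingleton.elim a b]
      disjoint := fun _ => ⟨Set.univ, Filter.univ_mem, fun _ _ => rfl⟩ }
  refine HasMotionPlanning.of_map_range_le hX hY hq.isCoveringMap hq.surjective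
    (ContinuousMap.const _ (φ x)) (t₀ := PUnit.unit) (x := x) rfl (fun a b _ => Subsingleton.elim a b) ?_
    hasMotionPlanning_id_of_subsingleton
  rintro _ ⟨γ, rfl⟩
  rw [h]
  exact one_mem _

theorem hasMotionPlanning_one_of_map_range_le [PathConnectedSpace X] {φ : C(X, Y)}
    (hX : HasCWHomotopyType X) {x : X}
    (hY : ∀ n, 2 ≤ n → ∀ y : Y, Subsingleton (π_ n Y y)) {ω : FundamentalGroup Y (φ x)}
    (hω : Function.Injective (zpowersHom _ ω))
    (h : (FundamentalGroup.map φ x).range ≤ Subgroup.zpowers ω) : HasMotionPlanning φ 1 := by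
  obtain ⟨p, hp⟩ := Path.Homotopic.Quotient.mk_surjective ω
  have hexp : Topology.IsQuotientMap (⟨Circle.exp, Circle.exp.continuous⟩ : C(ℝ, Circle)) :=
    Circle.isAddQuotientCoveringMap_exp.toIsQuotientMap
  have hπ : (2 * Real.pi : ℝ) ≠ 0 := by positivity
  -- The rescaling makes the loop `2π`-periodic, so that it descends along `Circle.exp`.
  let pe : C(ℝ, Y) := p.periodicExtend.comp ⟨fun s => s / (2 * Real.pi), by fun_prop⟩
  have hfac : ∀ s t : ℝ, Circle.exp s = Circle.exp t → pe s = pe t := by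
    intro s t hst
    obtain ⟨m, hm⟩ := Circle.exp_eq_exp.1 hst
    have hper : Function.Periodic p.periodicExtend 1 := p.periodicExtend_add_one
    simp only [pe, ContinuousMap.comp_apply, ContinuousMap.coe_mk, hm]
    rw [add_div, mul_div_cancel_right₀ _ hπ]
    simpa using hper.int_mul m (t / (2 * Real.pi))
  let b : C(Circle, Y) := hexp.lift pe hfac
  have hb : ∀ s, b (Circle.exp s) = pe s := fun s =>
    DFunLike.congr_fun (hexp.lift_comp pe hfac) s
  have hq := Circle.isAddQuotientCoveringMap_exp.toMultiplicative
  let g : Multiplicative (AddSubgroup.zmultiples (2 * Real.pi)) :=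
    Multiplicative.ofAdd ⟨2 * Real.pi, AddSubgroup.mem_zmultiples _⟩
  let e : Path (0 : ℝ) (g • (0 : ℝ)) :=
    ⟨⟨fun s : I => s * (2 * Real.pi), by fun_prop⟩, by simp, by
      change (1 : ℝ) * (2 * Real.pi) = 2 * Real.pi + 0
      ring⟩
  have hg : Subgroup.closure (Set.range fun _ : Unit => g) = ⊤ := by
    rw [Set.range_const, ← Subgroup.zpowers_eq_closure, Subgroup.eq_top_iff']
    rintro ⟨z, m, rfl⟩
    exact ⟨m, rfl⟩
  have hb0 : b (Circle.exp 0) = φ x := by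
    rw [hb]
    simp [pe, p.periodicExtend_zero]
  refine HasMotionPlanning.of_quotientCovering hX hY hq hg (fun _ => e) b hb0 (ω := fun _ => ω) ?_ ?_
    ?_ Circle.hasMotionPlanning_one
  · have h1 : FreeGroup.lift (fun _ : Unit => ω) = (zpowersHom _ ω).comp
        FreeGroup.mulEquivIntOfUnique.toMonoidHom := by
      ext i
      have h2 : FreeGroup.mulEquivIntOfUnique (FreeGroup.of i) = Multiplicative.ofAdd 1 := by
        simp [FreeGroup.mulEquivIntOfUnique, FreeGroup.equivIntOfUnique]
      simp [h2]
    rw [h1]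
    exact hω.comp FreeGroup.mulEquivIntOfUnique.injective
  · intro _
    rw [FundamentalGroup.mapOfEq_apply, IsQuotientCoveringMap.loopClass,
      ← Path.Homotopic.Quotient.mk_map, ← Path.Homotopic.Quotient.mk_cast, ← hp]
    congr 1
    ext s
    change b (Circle.exp (s * (2 * Real.pi))) = p s
    rw [hb]
    simp only [pe, ContinuousMap.comp_apply, ContinuousMap.coe_mk]
    rw [mul_div_cancel_right₀ _ hπ, p.periodicExtend_coe]
  · rwa [Set.range_const, ← Subgroup.zpowers_eq_closure]

end

/-! ### The Cayley tree and its free action. -/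

section CayleyTree

variable {ι : Type*}

/-- The gluing relation of the Cayley tree of a free group. -/
inductive CayleyTree.Rel : FreeGroup ι ⊕ (FreeGroup ι × ι × I) → FreeGroup ι ⊕ (FreeGroup ι × ι × I) →
    Prop
  | source (h : FreeGroup ι) (i : ι) : Rel (.inr (h, i, 0)) (.inl h)
  | target (h : FreeGroup ι) (i : ι) : Rel (.inr (h, i, 1)) (.inl (h * FreeGroup.of i))

variable (ι) in
/-- The geometric realization of the Cayley graph of a free group. -/
def CayleyTree : Type _ := Quot (CayleyTree.Rel (ι := ι))

namespace CayleyTree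

/-- The vertices of the Cayley tree. -/
def vertex (h : FreeGroup ι) : CayleyTree ι := Quot.mk _ (.inl h)

/-- The points on the edges of the Cayley tree. -/
def edgePoint (h : FreeGroup ι) (i : ι) (s : I) : CayleyTree ι := Quot.mk _ (.inr (h, i, s))

theorem edgePoint_zero (h : FreeGroup ι) (i : ι) : edgePoint h i 0 = vertex h :=
  Quot.sound (.source h i)

theorem edgePoint_one (h : FreeGroup ι) (i : ι) :
    edgePoint h i 1 = vertex (h * FreeGroup.of i) :=
  Quot.sound (.target h i)

theorem ind {p : CayleyTree ι → Prop} (hv : ∀ h, p (vertex h)) (he : ∀ h i s, p (edgePoint h i s))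
    (x : CayleyTree ι) : p x := by
  obtain ⟨h | ⟨h, i, s⟩⟩ := x
  · exact hv h
  · exact he h i s

/-- The final topology for the edges alone. Vertices impose no condition: each is an endpoint of an
edge, except without generators, when the tree is one point. -/
instance : TopologicalSpace (CayleyTree ι) :=
  ⨆ p : FreeGroup ι × ι, TopologicalSpace.coinduced (edgePoint p.1 p.2) inferInstance

theorem continuous_iff {Z : Type*} [TopologicalSpace Z] {f : CayleyTree ι → Z} :
    Continuous f ↔ ∀ h i, Continuous fun s => f (edgePoint h i s) := by
  rw [continuous_iSup_dom]
  simp only [continuous_coinduced_dom, Prod.forall]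
  rfl

theorem continuous_edgePoint (h : FreeGroup ι) (i : ι) : Continuous (edgePoint h i) :=
  continuous_iff.1 continuous_id h i

/-- The edges of the Cayley tree as paths. -/
def edge (h : FreeGroup ι) (i : ι) : Path (vertex h) (vertex (h * FreeGroup.of i)) :=
  ⟨⟨edgePoint h i, continuous_edgePoint h i⟩, edgePoint_zero h i, edgePoint_one h i⟩

theorem exists_lift {Z : Type*} [TopologicalSpace Z] (v : FreeGroup ι → Z)
    (e : FreeGroup ι → ι → C(I, Z)) (h0 : ∀ h i, e h i 0 = v h)
    (h1 : ∀ h i, e h i 1 = v (h * FreeGroup.of i)) :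
    ∃ F : C(CayleyTree ι, Z), (∀ h, F (vertex h) = v h) ∧ ∀ h i s, F (edgePoint h i s) = e h i s := by
  let f : CayleyTree ι → Z := Quot.lift (Sum.elim v fun p => e p.1 p.2.1 p.2.2) (by
    rintro _ _ (⟨h, i⟩ | ⟨h, i⟩)
    · exact h0 h i
    · exact h1 h i)
  exact ⟨⟨f, continuous_iff.2 fun h i => (e h i).continuous⟩, fun h => rfl, fun h i s => rfl⟩

instance : MulAction (FreeGroup ι) (CayleyTree ι) where
  smul g := Quot.map (Sum.map (g * ·) fun p => (g * p.1, p.2)) (by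
    rintro _ _ (⟨h, i⟩ | ⟨h, i⟩)
    · exact .source (g * h) i
    · simp only [Sum.map_inr, Sum.map_inl, ← mul_assoc]
      exact .target (g * h) i)
  one_smul := ind (fun h => congrArg vertex (one_mul h))
    fun h i s => congrArg (fun h => edgePoint h i s) (one_mul h)
  mul_smul g k := ind (fun h => congrArg vertex (mul_assoc g k h))
    fun h i s => congrArg (fun h => edgePoint h i s) (mul_assoc g k h)

theorem smul_vertex (g h : FreeGroup ι) : g • vertex h = vertex (g * h) := rfl

theorem smul_edgePoint (g h : FreeGroup ι) (i : ι) (s : I) :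
    g • edgePoint h i s = edgePoint (g * h) i s := rfl

instance : ContinuousConstSMul (FreeGroup ι) (CayleyTree ι) :=
  ⟨fun g => continuous_iff.2 fun h i => continuous_edgePoint (g * h) i⟩

theorem exists_vertexFunction [DecidableEq (FreeGroup ι)] (k : FreeGroup ι) :
    ∃ F : C(CayleyTree ι, ℝ), (∀ h, F (vertex h) = if h = k then 1 else 0) ∧
      ∀ h i (s : I), F (edgePoint h i s) = (if h = k then 1 - (s : ℝ) else 0) +
        if h * FreeGroup.of i = k then (s : ℝ) else 0 := by
  refine exists_lift _ (fun h i => ⟨fun s : I => (if h = k then 1 - (s : ℝ) else 0) +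
        if h * FreeGroup.of i = k then (s : ℝ) else 0, ?_⟩) ?_ ?_
  · split_ifs <;> fun_prop
  · intro h i
    simp
  · intro h i
    simp

/-- All edges leaving `k` are selected at once, whatever their label; this is enough to separate
translates because left multiplication is free on initial vertices. -/
theorem exists_edgeFunction [DecidableEq (FreeGroup ι)] (k : FreeGroup ι) :
    ∃ F : C(CayleyTree ι, ℝ), (∀ h, F (vertex h) = 0) ∧
      ∀ h i (s : I), F (edgePoint h i s) = if h = k then (s : ℝ) * (1 - s) else 0 := by
  refine exists_lift _ (fun h i => ⟨fun s : I => if h = k then (s : ℝ) * (1 - s) else 0, ?_⟩) ?_ ?_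
  · split_ifs <;> fun_prop
  · intro h i
    simp
  · intro h i
    simp

theorem exists_nhds_disjoint (x : CayleyTree ι) :
    ∃ U ∈ 𝓝 x, ∀ g : FreeGroup ι, ((g • ·) '' U ∩ U).Nonempty → g = 1 := by
  classical
  have hvert : ∀ k : FreeGroup ι, ∃ U ∈ 𝓝 (vertex k),
      ∀ g : FreeGroup ι, ((g • ·) '' U ∩ U).Nonempty → g = 1 := by
    intro k
    obtain ⟨F, hF, hF'⟩ := exists_vertexFunction k
    refine ⟨{x | 1 / 2 < F x}, (isOpen_lt continuous_const F.continuous).mem_nhds ?_, ?_⟩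
    · simp only [Set.mem_ofPred_eq, hF]
      norm_num
    · rintro g ⟨_, ⟨x, hx, rfl⟩, hx'⟩
      by_contra hg
      simp only [Set.mem_ofPred_eq] at hx hx'
      have hne : ∀ h, h = k → g * h ≠ k := by
        rintro h rfl h'
        exact hg (mul_eq_right.1 h')
      induction x using ind with
      | hv h =>
        rw [smul_vertex, hF] at hx'
        rw [hF] at hx
        split_ifs at hx hx' with h1 h2
        · exact hne h h1 h2
        all_goals linarith
      | he h i s =>
        rw [smul_edgePoint, hF', mul_assoc] at hx'
        rw [hF'] at hx
        have h1 := hne h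
        have h2 := hne (h * FreeGroup.of i)
        have := s.2.1
        have := s.2.2
        split_ifs at hx hx' <;> first | linarith | tauto
  induction x using ind with
  | hv h => exact hvert h
  | he h i s =>
    rcases eq_or_ne s 0 with rfl | h0
    · rw [edgePoint_zero]
      exact hvert _
    rcases eq_or_ne s 1 with rfl | h1
    · rw [edgePoint_one]
      exact hvert _
    have h0' : (0 : ℝ) < s := unitInterval.pos_iff_ne_zero.2 h0
    have h1' : (s : ℝ) < 1 := unitInterval.lt_one_iff_ne_one.2 h1
    obtain ⟨F, hF, hF'⟩ := exists_edgeFunction h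
    refine ⟨{x | 0 < F x}, (isOpen_lt continuous_const F.continuous).mem_nhds ?_, ?_⟩
    · simp only [Set.mem_ofPred_eq, hF', if_true]
      exact mul_pos h0' (by linarith)
    · rintro g ⟨_, ⟨x, hx, rfl⟩, hx'⟩
      simp only [Set.mem_ofPred_eq] at hx hx'
      induction x using ind with
      | hv k =>
        rw [hF] at hx
        exact absurd hx (lt_irrefl 0)
      | he k j r =>
        rw [smul_edgePoint, hF'] at hx'
        rw [hF'] at hx
        split_ifs at hx hx' with e1 e2
        · subst e1
          exact mul_eq_right.1 e2
        all_goals exact absurd ‹_› (lt_irrefl _)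

/-- The free group acts on pairs of a vertex and a class of paths to it from `1`, a generator
appending one edge. The orbit of the constant path gives classes compatible along every edge; this
replaces a combinatorial induction on reduced words. -/
theorem exists_path_family (ι : Type*) :
    ∃ c : ∀ h : FreeGroup ι, Path.Homotopic.Quotient (vertex (1 : FreeGroup ι)) (vertex h),
      ∀ h i, c (h * FreeGroup.of i) = (c h).trans (.mk (edge h i)) := by
  let S : Type _ := Σ h : FreeGroup ι, Path.Homotopic.Quotient (vertex (1 : FreeGroup ι)) (vertex h)
  let t : ι → S → S := fun i z => ⟨z.1 * FreeGroup.of i, z.2.trans (.mk (edge z.1 i))⟩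
  have ht : ∀ i, Function.Bijective (t i) := by
    intro i
    constructor
    · rintro ⟨h, p⟩ ⟨h', p'⟩ e
      obtain rfl : h = h' := mul_right_cancel (congrArg Sigma.fst e)
      have e2 := eq_of_heq (Sigma.mk.inj e).2
      have e3 := congrArg (fun z => Path.Homotopic.Quotient.trans z
        (Path.Homotopic.Quotient.mk (edge h i)).symm) e2
      simp only [Path.Homotopic.Quotient.trans_assoc, Path.Homotopic.Quotient.trans_symm,
        Path.Homotopic.Quotient.trans_refl] at e3
      rw [e3]
    · rintro ⟨k, p⟩
      obtain ⟨h, rfl⟩ : ∃ h, k = h * FreeGroup.of i := ⟨k * (FreeGroup.of i)⁻¹, by simp⟩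
      refine ⟨⟨h, p.trans (Path.Homotopic.Quotient.mk (edge h i)).symm⟩, ?_⟩
      simp only [t, Path.Homotopic.Quotient.trans_assoc, Path.Homotopic.Quotient.symm_trans,
        Path.Homotopic.Quotient.trans_refl]
  -- Appending edges is a right action, hence the opposite group.
  let τ : FreeGroup ι →* (Equiv.Perm S)ᵐᵒᵖ :=
    FreeGroup.lift fun i => MulOpposite.op (Equiv.ofBijective (t i) (ht i))
  have hτ : ∀ h i z, (τ (h * FreeGroup.of i)).unop z = t i ((τ h).unop z) := by
    intro h i z
    simp [τ]
  have hfst : ∀ g z, ((τ g).unop z).1 = z.1 * g := by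
    intro g
    induction g using FreeGroup.induction_on with
    | C1 => intro z; simp
    | of i => intro z; simp [τ, t]
    | inv_of i _ =>
      intro z
      obtain ⟨w, rfl⟩ := (ht i).2 z
      have : (τ (FreeGroup.of i)⁻¹).unop (t i w) = w := by
        simp only [τ, map_inv, FreeGroup.lift_apply_of, MulOpposite.unop_inv, MulOpposite.unop_op]
        exact (Equiv.ofBijective (t i) (ht i)).symm_apply_apply w
      rw [this]
      simp [t]
    | mul g k hg hk =>
      intro z
      rw [map_mul, MulOpposite.unop_mul, Equiv.Perm.mul_apply, hk, hg, mul_assoc]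
  have hc : ∀ h, ∃ c : Path.Homotopic.Quotient (vertex (1 : FreeGroup ι)) (vertex h),
      (τ h).unop ⟨1, .refl _⟩ = ⟨h, c⟩ := by
    intro h
    have := hfst h ⟨1, .refl _⟩
    generalize (τ h).unop ⟨1, .refl _⟩ = z at this
    obtain ⟨k, c⟩ := z
    obtain rfl : k = h := by simpa using this
    exact ⟨c, rfl⟩
  choose c hc using hc
  refine ⟨c, fun h i => ?_⟩
  have h1 := hτ h i ⟨1, .refl _⟩
  rw [hc, hc] at h1
  exact eq_of_heq (Sigma.mk.inj h1).2

instance : ContractibleSpace (CayleyTree ι) := by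
  obtain ⟨c, hc⟩ := exists_path_family ι
  choose p hp using fun h => Path.Homotopic.Quotient.mk_surjective (c h)
  -- Each vertex is contracted to `vertex 1` along its chosen path. Compatibility of the classes
  -- says that the boundary of the square over each edge can be filled, which extends the
  -- contraction over the edges.
  have hsq : ∀ h i, ((edge h i).trans (p (h * FreeGroup.of i)).symm).Homotopic
      ((p h).symm.trans (Path.refl _)) := by
    intro h i
    rw [← Path.Homotopic.Quotient.eq]
    simp only [Path.Homotopic.Quotient.mk_trans, Path.Homotopic.Quotient.mk_symm,
      Path.Homotopic.Quotient.mk_refl, Path.Homotopic.Quotient.trans_refl, hp]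
    have h1 : (c (h * FreeGroup.of i)).trans (c (h * FreeGroup.of i)).symm = .refl _ :=
      Path.Homotopic.Quotient.trans_symm _
    conv_lhs at h1 => lhs; rw [hc]
    have h2 := congrArg (fun z => (c h).symm.trans z) h1
    simp only [← Path.Homotopic.Quotient.trans_assoc, Path.Homotopic.Quotient.symm_trans,
      Path.Homotopic.Quotient.refl_trans, Path.Homotopic.Quotient.trans_refl] at h2
    exact h2
  choose F hF0 hFr hFl hFt using fun h i => (hsq h i).exists_square
  obtain ⟨K, hKv, hKe⟩ := exists_lift (fun h => ((p h).symm : C(I, CayleyTree ι)))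
    (fun h i => (F h i).curry) (fun h i => by ext t; exact hFl h i t)
    (fun h i => by ext t; exact hFr h i t)
  rw [contractible_iff_id_nullhomotopic]
  refine ⟨vertex 1, ⟨?_⟩⟩
  exact
    { toFun := fun z => K z.2 z.1
      continuous_toFun := by fun_prop
      map_zero_left := fun x => by
        induction x using ind with
        | hv h => simp [hKv]
        | he h i s =>
          simp only [hKe]
          exact hF0 h i s
      map_one_left := fun x => by
        induction x using ind with
        | hv h => simp [hKv]
        | he h i s =>
          simp only [hKe]
          exact hFt h i s }

theorem isQuotientCoveringMap (ι : Type*) :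
    IsQuotientCoveringMap (Quotient.mk (MulAction.orbitRel (FreeGroup ι) (CayleyTree ι)))
      (FreeGroup ι) :=
  { isQuotientMap_quotient_mk' with
    continuous_const_smul := continuous_const_smul
    apply_eq_iff_mem_orbit := Quotient.eq''
    disjoint := exists_nhds_disjoint }

end CayleyTree

/-! ### Motion planning on the rose. -/

variable (ι) in
/-- The quotient of the Cayley tree by the free group, a wedge of circles. -/
abbrev Rose : Type _ := MulAction.orbitRel.Quotient (FreeGroup ι) (CayleyTree ι)

namespace Rose

/-- The points on the petals of the rose. -/
def petal (i : ι) (s : I) : Rose ι := Quotient.mk _ (CayleyTree.edgePoint 1 i s)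

variable (ι) in
/-- The base point of the rose. -/
def center : Rose ι := Quotient.mk _ (CayleyTree.vertex 1)

theorem mk_vertex (h : FreeGroup ι) : (Quotient.mk _ (CayleyTree.vertex h) : Rose ι) = center ι :=
  Quotient.sound ⟨h, (CayleyTree.smul_vertex h 1).trans (congrArg _ (mul_one h))⟩

theorem mk_edgePoint (h : FreeGroup ι) (i : ι) (s : I) :
    (Quotient.mk _ (CayleyTree.edgePoint h i s) : Rose ι) = petal i s :=
  Quotient.sound ⟨h, (CayleyTree.smul_edgePoint h 1 i s).trans
    (congrArg (fun h => CayleyTree.edgePoint h i s) (mul_one h))⟩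

theorem petal_zero (i : ι) : petal i 0 = center ι := by
  rw [petal, CayleyTree.edgePoint_zero]
  rfl

theorem petal_one (i : ι) : petal i 1 = center ι := by
  rw [petal, CayleyTree.edgePoint_one, mk_vertex]

theorem continuous_petal (i : ι) : Continuous (petal i) :=
  continuous_quotient_mk'.comp (CayleyTree.continuous_edgePoint 1 i)

theorem ind {p : Rose ι → Prop} (hv : p (center ι)) (he : ∀ i s, p (petal i s)) (x : Rose ι) :
    p x := by
  obtain ⟨x⟩ := x
  induction x using CayleyTree.ind with
  | hv h =>
    change p (Quotient.mk _ (CayleyTree.vertex h))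
    rwa [mk_vertex]
  | he h i s =>
    change p (Quotient.mk _ (CayleyTree.edgePoint h i s))
    rw [mk_edgePoint]
    exact he i s

theorem exists_lift {Z : Type*} [TopologicalSpace Z] (v : Z) (e : ι → C(I, Z))
    (h0 : ∀ i, e i 0 = v) (h1 : ∀ i, e i 1 = v) :
    ∃ F : C(Rose ι, Z), F (center ι) = v ∧ ∀ i s, F (petal i s) = e i s := by
  obtain ⟨F, hF, hF'⟩ := CayleyTree.exists_lift (fun _ => v) (fun _ i => e i) (fun _ => h0)
    (fun _ => h1)
  have hinv : ∀ x y : CayleyTree ι, MulAction.orbitRel (FreeGroup ι) (CayleyTree ι) x y →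
      F x = F y := by
    rintro _ y ⟨g, rfl⟩
    induction y using CayleyTree.ind with
    | hv h => simp only [CayleyTree.smul_vertex, hF]
    | he h i s => simp only [CayleyTree.smul_edgePoint, hF']
  exact ⟨⟨Quotient.lift F hinv, F.continuous.quotient_lift hinv⟩, hF 1, fun i s => hF' 1 i s⟩

/-- Straight-line deformation of the identity of the interval to `f`, performed on all petals
simultaneously; fixing both endpoints lets it pass to the rose. -/
theorem exists_slide (f : C(I, I)) (hf0 : f 0 = 0) (hf1 : f 1 = 1) :
    ∃ K : C(Rose ι, C(I, Rose ι)), (∀ x, K x 0 = x) ∧ (K (center ι) 1 = center ι) ∧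
      ∀ i s, K (petal i s) 1 = petal i (f s) := by
  let l : C(I × I, I) := ⟨fun p => ⟨(1 - (p.2 : ℝ)) * p.1 + p.2 * f p.1, by
      have h1 := p.2.2.1
      have h2 : 0 ≤ 1 - (p.2 : ℝ) := sub_nonneg.2 p.2.2.2
      exact add_nonneg (mul_nonneg h2 p.1.2.1) (mul_nonneg h1 (f p.1).2.1), by
      have h1 := mul_le_mul_of_nonneg_left (f p.1).2.2 p.2.2.1
      have h2 := mul_le_mul_of_nonneg_left p.1.2.2 (sub_nonneg.2 p.2.2.2)
      linarith⟩, by fun_prop⟩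
  have hl0 : ∀ t, l (0, t) = 0 := fun t => by ext; simp [l, hf0]
  have hl1 : ∀ t, l (1, t) = 1 := fun t => by ext; simp [l, hf1]
  obtain ⟨K, hK, hK'⟩ := exists_lift (ContinuousMap.const I (center ι))
    (fun i => ((⟨petal i, continuous_petal i⟩ : C(I, Rose ι)).comp l).curry)
    (fun i => by ext t; simp [hl0, petal_zero]) (fun i => by ext t; simp [hl1, petal_one])
  refine ⟨K, fun x => ?_, by simp [hK], fun i s => ?_⟩
  · induction x using ind with
    | hv => simp [hK]
    | he i s =>
      rw [hK']
      have : l (s, 0) = s := by ext; simp [l]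
      simp [this]
  · rw [hK']
    have : l (s, 1) = f s := by ext; simp [l]
    simp [this]

theorem hasMotionPlanning_two (ι : Type*) : HasMotionPlanning (ContinuousMap.id (Rose ι)) 2 := by
  -- The set `A` consists of the center and the parts `s < 1/3` and `s > 2/3` of the petals, which
  -- `fA` pushes into the center. The set `B` is the part `0 < s < 5/6`, pushed back to the center
  -- by `fB`. The thresholds match the plateaus of `ρ` below.
  let fA : C(I, I) := ⟨fun s => Set.projIcc 0 1 zero_le_one (3 * (s : ℝ) - 1), by fun_prop⟩
  let fB : C(I, I) := ⟨fun s => Set.projIcc 0 1 zero_le_one (6 * (s : ℝ) - 5), by fun_prop⟩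
  obtain ⟨KA, hA0, hAc, hA⟩ := exists_slide (ι := ι) fA
    (Set.projIcc_of_le_left zero_le_one (by norm_num)) (Set.projIcc_of_right_le zero_le_one (by norm_num))
  obtain ⟨KB, hB0, hBc, hB⟩ := exists_slide (ι := ι) fB
    (Set.projIcc_of_le_left zero_le_one (by norm_num)) (Set.projIcc_of_right_le zero_le_one (by norm_num))
  obtain ⟨ρ, hρc, hρ⟩ := exists_lift (ι := ι) (1 : ℝ)
    (fun _ => ⟨fun s : I => max 0 (min 1 (max (1 - 3 * (s : ℝ)) (6 * s - 4))), by fun_prop⟩)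
    (fun _ => by norm_num) (fun _ => by norm_num)
  refine _root_.hasMotionPlanning_two (A := {x | ρ x ≠ 0}) (B := {x | ρ x ≠ 1}) (x₀ := center ι)
    (isOpen_ne.preimage ρ.continuous) (isOpen_ne.preimage ρ.continuous) ρ (fun _ => id)
    (fun _ => id) (fun z => ⟨KA z, hA0 z, ?_⟩) ?_ (fun z => ⟨KB z, hB0 z, ?_⟩) ?_
  · obtain ⟨x, hx⟩ := z
    induction x using ind with
    | hv => exact hAc
    | he i s =>
      refine (hA i s).trans ?_
      have hx' : max 0 (min 1 (max (1 - 3 * (s : ℝ)) (6 * s - 4))) ≠ 0 := fun h => hx ((hρ i s).trans h)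
      rcases le_or_gt (s : ℝ) (1 / 3) with h | h
      · have : fA s = 0 := Set.projIcc_of_le_left zero_le_one (by linarith)
        rw [this, petal_zero]
      rcases le_or_gt (2 / 3) (s : ℝ) with h' | h'
      · have : fA s = 1 := Set.projIcc_of_right_le zero_le_one (by linarith)
        rw [this, petal_one]
      · refine absurd (max_eq_left ((min_le_right _ _).trans (max_le ?_ ?_))) hx' <;> linarith
  · exact (by fun_prop : Continuous fun p : {x : Rose ι | ρ x ≠ 0} × I => KA p.1 p.2)
  · obtain ⟨x, hx⟩ := z
    induction x using ind with
    | hv => exact absurd hρc hx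
    | he i s =>
      refine (hB i s).trans ?_
      have hx' : max 0 (min 1 (max (1 - 3 * (s : ℝ)) (6 * s - 4))) ≠ 1 := fun h => hx ((hρ i s).trans h)
      rcases le_or_gt (s : ℝ) (5 / 6) with h | h
      · have : fB s = 0 := Set.projIcc_of_le_left zero_le_one (by linarith)
        rw [this, petal_zero]
      · refine absurd ?_ hx'
        rw [min_eq_left (le_max_of_le_right (by linarith)), max_eq_right zero_le_one]
  · exact (by fun_prop : Continuous fun p : {x : Rose ι | ρ x ≠ 1} × I => KB p.1 p.2)

end Rose

end CayleyTree

/-! ### The value of the topological complexity. -/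

theorem hasMotionPlanning_two_of_freeGroup {X Y ι : Type*} [TopologicalSpace X]
    [TopologicalSpace Y] [PathConnectedSpace X] {φ : C(X, Y)} (hX : HasCWHomotopyType X) {x : X}
    (hY : ∀ n, 2 ≤ n → ∀ y : Y, Subsingleton (π_ n Y y))
    (e : FreeGroup ι ≃* FundamentalGroup Y (φ x)) : HasMotionPlanning φ 2 := by
  choose p hp using fun i => Path.Homotopic.Quotient.mk_surjective (e (FreeGroup.of i))
  obtain ⟨b, hbc, hb⟩ := Rose.exists_lift (φ x) (fun i => (p i : C(I, Y))) (fun i => (p i).source)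
    (fun i => (p i).target)
  have hbc' : b (Quotient.mk _ (CayleyTree.vertex 1)) = φ x := hbc
  have hlift : FreeGroup.lift (fun i => e (FreeGroup.of i)) = e.toMonoidHom := by
    ext i
    simp
  refine HasMotionPlanning.of_quotientCovering hX hY (CayleyTree.isQuotientCoveringMap ι)
    (FreeGroup.closure_range_of ι) (t₀ := CayleyTree.vertex 1)
    (fun i => (CayleyTree.edge 1 i).cast rfl
      (by rw [CayleyTree.smul_vertex, mul_one, one_mul])) b hbc'
    (ω := fun i => e (FreeGroup.of i)) ?_ ?_ ?_ (Rose.hasMotionPlanning_two ι)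
  · rw [hlift]
    exact e.injective
  · intro i
    rw [FundamentalGroup.mapOfEq_apply, IsQuotientCoveringMap.loopClass,
      ← Path.Homotopic.Quotient.mk_map, ← Path.Homotopic.Quotient.mk_cast, ← hp]
    congr 1
    ext s
    exact hb i s
  · rw [← FreeGroup.range_lift_eq_closure, hlift]
    have h : e.toMonoidHom.range = ⊤ := MonoidHom.range_eq_top.2 e.surjective
    rw [h]
    exact le_top

theorem HasMotionPlanning.mono {X Y : Type*} [TopologicalSpace X] [TopologicalSpace Y]
    {φ : C(X, Y)} {k l : ℕ} (h : HasMotionPlanning φ k) (hkl : k ≤ l) : HasMotionPlanning φ l := by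
  obtain ⟨U, hU, hcov, hs⟩ := h
  have hkl' : k + 1 ≤ l + 1 := by omega
  -- The surplus indices repeat the last set of the cover.
  refine ⟨fun i => U ⟨min i k, by omega⟩, fun i => hU _, ?_, fun i => hs _⟩
  refine Set.eq_univ_of_forall fun z => ?_
  obtain ⟨i, hi⟩ := Set.mem_iUnion.1 (hcov.ge (Set.mem_univ z))
  refine Set.mem_iUnion.2 ⟨Fin.castLE hkl' i, ?_⟩
  convert hi
  simp only [Fin.val_castLE]
  omega

theorem mapTC_eq_zero {X Y : Type*} [TopologicalSpace X] [TopologicalSpace Y] {φ : C(X, Y)}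
    (h : HasMotionPlanning φ 0) : mapTC φ = 0 :=
  le_antisymm (iInf₂_le 0 h) zero_le

theorem mapTC_eq_add_one {X Y : Type*} [TopologicalSpace X] [TopologicalSpace Y] {φ : C(X, Y)}
    {k : ℕ} (h : HasMotionPlanning φ (k + 1)) (h' : ¬ HasMotionPlanning φ k) :
    mapTC φ = (k + 1 : ℕ) := by
  refine le_antisymm (iInf₂_le (k + 1) h) (le_iInf₂ fun l hl => ?_)
  rw [Nat.cast_le]
  by_contra! hlt
  exact h' (hl.mono (Nat.lt_succ_iff.1 hlt))

theorem mainTheorem5 {n m : ℕ} (f : FreeGroup (Fin n) →* FreeGroup (Fin m))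
    {X Y : Type*} [TopologicalSpace X] [TopologicalSpace Y] (φ : C(X, Y))
    (hφ : IsClassifyingMap φ f) :
    (f = 1 → mapTC φ = 0) ∧
    (Nonempty (f.range ≃* Multiplicative ℤ) → mapTC φ = 1) ∧
    (f ≠ 1 → ¬ Nonempty (f.range ≃* Multiplicative ℤ) → mapTC φ = 2) := by
  obtain ⟨⟨hX₀, hX, -, -⟩, ⟨-, -, -, hY'⟩, x, eX, eY, hf⟩ := hφ
  have hY : ∀ n, 2 ≤ n → ∀ y : Y, Subsingleton (π_ n Y y) := fun n hn y => hY' n y hn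
  have hmap : ∀ g, FundamentalGroup.map φ x (eX.symm g) = eY.symm (f g) := fun g => by
    rw [MulEquiv.eq_symm_apply, hf, eX.apply_symm_apply]
  refine ⟨fun h => mapTC_eq_zero (hasMotionPlanning_zero_of_map_eq_one hX hY (x := x) fun γ => ?_),
    fun ⟨e⟩ => ?_, fun h1 h2 => ?_⟩
  · apply eY.injective
    rw [hf, h, map_one, MonoidHom.one_apply]
  · set u := e.symm (Multiplicative.ofAdd 1)
    have hu : ∀ k : ℤ, u ^ k = e.symm (Multiplicative.ofAdd k) := fun k => by
      rw [← map_zpow, ← ofAdd_zsmul, smul_eq_mul, mul_one]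
    have hzu : ∀ k : ℤ, eY.symm (u : FreeGroup (Fin m)) ^ k
        = eY.symm (e.symm (Multiplicative.ofAdd k) : f.range) := fun k => by
      rw [← hu, ← map_zpow, Subgroup.coe_zpow]
    refine mapTC_eq_add_one (hasMotionPlanning_one_of_map_range_le hX hY (x := x)
      (ω := eY.symm u) ?_ ?_) fun h0 => ?_
    · intro k l hkl
      simp only [zpowersHom_apply, hzu] at hkl
      exact e.symm.injective (Subtype.ext (eY.symm.injective hkl))
    · rintro _ ⟨γ, rfl⟩
      refine ⟨Multiplicative.toAdd (e ⟨f (eX γ), eX γ, rfl⟩), ?_⟩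
      simp only [hzu, ofAdd_toAdd, MulEquiv.symm_apply_apply, ← hf]
    · obtain ⟨g, hg⟩ := u.2
      have hu1 : (u : FreeGroup (Fin m)) = 1 := by
        rw [← hg, ← map_eq_one_iff eY.symm eY.symm.injective, ← hmap]
        exact map_eq_one_of_hasMotionPlanning_zero h0 _
      have := (map_eq_one_iff e.symm e.symm.injective).1 (Subtype.ext hu1 : u = 1)
      exact absurd this (by decide)
  · have hnt : Nontrivial f.range := by
      rw [Subgroup.nontrivial_iff_ne_bot]
      exact fun h => h1 (MonoidHom.range_eq_bot_iff.1 h)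
    -- The image is free by Nielsen–Schreier, hence nonabelian here. The torus is then spanned by
    -- loops representing `u` and the commutator of `u` and `v`.
    obtain ⟨⟨_, u, rfl⟩, ⟨_, v, rfl⟩, huv⟩ := exists_not_commute_of_isFreeGroup hnt h2
    have huv' : f u * f v ≠ f v * f u := fun h => huv (Subtype.ext h)
    refine mapTC_eq_add_one (hasMotionPlanning_two_of_freeGroup hX hY eY.symm)
      (not_hasMotionPlanning_one (x := x) (γ := eX.symm u) (γ' := eX.symm (u * v * u⁻¹ * v⁻¹))
        fun h i j hij => zpow_conj_commutator_freeGroup huv' (eY h) i j ?_)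
    have := congrArg eY hij
    simpa only [hmap, map_mul, map_zpow, map_inv, MulEquiv.apply_symm_apply] using this
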